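/- For $k\in\mathbb Z$ consider the three polynomials $$F_{1,k}=x^2+y^2+z^2-4x^2y^2z^2-k,$$ $$F_{2,k}=x^2+y^2+z^2-4(x^2y^2+y^2z^2+z^2x^2)+16x^2y^2z^2-k,$$ $$F_{3,k}=x^2+y^2+z^2+4(x^2y^2+y^2z^2+z^2x^2)-16x^2y^2z^2-k.$$ For each $i\in\{1,2,3\}$ let $\mathcal U_k\subset\mathbb A^3_{\mathbb Z}$ be the affine scheme $F_{i,k}=0$ and $U_k=\mathcal U_k\times_{\mathbb Z}\mathbb Q$ its generic fibre (the affine part of a Markoff-type K3 surface in $\mathbb P^1\times\mathbb P^1\times\mathbb P^1$). Put $\mathcal U_k(\mathbf A_{\mathbb Z})=U_k(\mathbb R)\times\prod_p\mathcal U_k(\mathbb Z_p)$, the product being over all prime numbers $p$, and let $\mathcal U_k(\mathbf A_{\mathbb Z})^{\mathrm{Br}}$ be the set of those $(P_v)_v\in\mathcal U_k(\mathbf A_{\mathbb Z})$ with $\sum_v\mathrm{inv}_v\,\mathcal A(P_v)=0$ in $\mathbb Q/\mathbb Z$ for every class $\mathcal A$ in the Brauer group $\mathrm{Br}\,U_k$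 of classes of Azumaya algebras over $U_k$; here $v$ runs over $\infty$ and all primes, and $\mathrm{inv}_v:\mathrm{Br}\,\mathbb Q_v\to\mathbb Q/\mathbb Z$ is the local invariant, with $\mathbb Q_\infty=\mathbb R$. (Whenever $U_k$ is smooth, that is, for all but finitely many $k$, this group is $\mathrm H^2_{\text{ét}}(U_k,\mathbb G_m)$.) Theorem. For each of the three families, as $M\to+\infty$, $$\#\{k\in\mathbb Z:\ |k|\le M,\ \mathcal U_k(\mathbf A_{\mathbb Z})\ne\emptyset\}\asymp M$$ and $$\#\{k\in\mathbb Z:\ |k|\le M,\ \mathcal U_k(\mathbf A_{\mathbb Z})\ne\emptyset,\ \mathcal U_k(\mathbf A_{\mathbb Z})^{\mathrm{Br}}=\emptyset\}\gg\frac{M^{1/2}}{\log M}.$$ -/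

import Mathlib

open scoped TensorProduct
open Asymptotics Filter

namespace MarkoffK3

noncomputable section

/-! ### The three families of affine surfaces -/

/-- `x² + y² + z² - 4x²y²z² - k`. -/
def F₁ (k : ℤ) : MvPolynomial (Fin 3) ℤ :=
  let x := MvPolynomial.X 0
  let y := MvPolynomial.X 1
  let z := MvPolynomial.X 2
  x ^ 2 + y ^ 2 + z ^ 2 - 4 * (x ^ 2 * y ^ 2 * z ^ 2) - MvPolynomial.C k

/-- `x² + y² + z² - 4(x²y² + y²z² + z²x²) + 16x²y²z² - k`. -/
def F₂ (k : ℤ) : MvPolynomial (Fin 3) ℤ :=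
  let x := MvPolynomial.X 0
  let y := MvPolynomial.X 1
  let z := MvPolynomial.X 2
  x ^ 2 + y ^ 2 + z ^ 2 - 4 * (x ^ 2 * y ^ 2 + y ^ 2 * z ^ 2 + z ^ 2 * x ^ 2)
    + 16 * (x ^ 2 * y ^ 2 * z ^ 2) - MvPolynomial.C k

/-- `x² + y² + z² + 4(x²y² + y²z² + z²x²) - 16x²y²z² - k`. -/
def F₃ (k : ℤ) : MvPolynomial (Fin 3) ℤ :=
  let x := MvPolynomial.X 0
  let y := MvPolynomial.X 1
  let z := MvPolynomial.X 2
  x ^ 2 + y ^ 2 + z ^ 2 + 4 * (x ^ 2 * y ^ 2 + y ^ 2 * z ^ 2 + z ^ 2 * x ^ 2)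
    - 16 * (x ^ 2 * y ^ 2 * z ^ 2) - MvPolynomial.C k

/-! ### Points

For `F ∈ ℤ[x, y, z]` let `𝒰` be the affine scheme `F = 0` over `ℤ` and `U` its generic fibre. -/

/-- `𝒰(S)`: the solutions of `F = 0` with coordinates in the commutative ring `S`. -/
def Points (F : MvPolynomial (Fin 3) ℤ) (S : Type) [CommRing S] : Type :=
  {P : Fin 3 → S // MvPolynomial.aeval P F = 0}

/-- The map `𝒰(S) → 𝒰(T)` induced by a ring homomorphism `S → T`. -/
def Points.map {F : MvPolynomial (Fin 3) ℤ} {S T : Type} [CommRing S] [CommRing T]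
    (f : S →+* T) (P : Points F S) : Points F T :=
  ⟨fun i => f (P.1 i), by
    have h := MvPolynomial.map_aeval (R := ℤ) P.1 f F
    rw [P.2, map_zero] at h
    rw [MvPolynomial.aeval_def, ← MvPolynomial.coe_eval₂Hom, RingHom.ext_int (algebraMap ℤ T)
      (f.comp (algebraMap ℤ S))]
    exact h.symm⟩

/-- The coordinate ring `ℚ[U] = ℚ[x, y, z] / (F)` of `U`. -/
abbrev CoordRing (F : MvPolynomial (Fin 3) ℤ) : Type :=
  MvPolynomial (Fin 3) ℚ ⧸
    Ideal.span ({MvPolynomial.map (Int.castRingHom ℚ) F} : Set (MvPolynomial (Fin 3) ℚ))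

/-- The homomorphism `ℚ[U] → T`, `g ↦ g(P)`, defined by a point `P ∈ U(T)`. -/
def Points.evalHom {F : MvPolynomial (Fin 3) ℤ} {T : Type} [CommRing T] [Algebra ℚ T]
    (P : Points F T) : CoordRing F →ₐ[ℚ] T :=
  Ideal.Quotient.liftₐ _ (MvPolynomial.aeval P.1) (by
    intro a ha
    have hle : Ideal.span ({MvPolynomial.map (Int.castRingHom ℚ) F} :
        Set (MvPolynomial (Fin 3) ℚ)) ≤
        RingHom.ker (MvPolynomial.aeval (R := ℚ) P.1) := by
      rw [Ideal.span_singleton_le_iff_mem, RingHom.mem_ker, MvPolynomial.aeval_def,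
        MvPolynomial.eval₂_map, RingHom.ext_int ((algebraMap ℚ T).comp (Int.castRingHom ℚ))
          (algebraMap ℤ T), ← MvPolynomial.aeval_def]
      exact P.2
    exact hle ha)

instance instFactPrimes (p : Nat.Primes) : Fact (p : ℕ).Prime := ⟨p.2⟩

/-- `𝒰(𝐀_ℤ) = U(ℝ) × ∏_p 𝒰(ℤ_p)`, the product over all prime numbers `p`. -/
abbrev AdelicPoints (F : MvPolynomial (Fin 3) ℤ) : Type :=
  Points F ℝ × ((p : Nat.Primes) → Points F ℤ_[p])

/-! ### Local invariants -/

/-- For a central simple algebra `B` of degree `n` over `ℚ_p` (so `dim B = n²`), the element `q` is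
`inv_p B` computed from an embedding `φ` of the unramified extension `ℚ_p(μ_{pⁿ-1})` of degree
`n` into `B` and a unit `γ` of `B` inducing the Frobenius on it by `a ↦ γ a γ⁻¹`; in that case
`inv_p B` is the class of `v_p(Nrd γ) / n`, and `N_{B/ℚ_p}(γ) = Nrd(γ)ⁿ`. -/
def IsPadicInv (p : ℕ) [Fact p.Prime] (B : Type) [Ring B] [Algebra ℚ_[p] B]
    (q : AddCircle (1 : ℚ)) : Prop :=
  ∃ (n : ℕ) (φ : CyclotomicField (p ^ n - 1) ℚ_[p] →ₐ[ℚ_[p]] B) (γ : Bˣ),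
    Module.finrank ℚ_[p] B = n ^ 2 ∧
    (∀ ζ : CyclotomicField (p ^ n - 1) ℚ_[p], ζ ^ (p ^ n - 1) = 1 →
      (γ : B) * φ ζ * ((γ⁻¹ : Bˣ) : B) = φ (ζ ^ p)) ∧
    q = (((((Algebra.norm ℚ_[p] (γ : B)).valuation : ℚ) / (n : ℚ) ^ 2) : ℚ) : AddCircle (1 : ℚ))

open Classical in
/-- The local invariant `inv_p B ∈ ℚ/ℤ` of a central simple algebra `B` over `ℚ_p` (for which an
element as in `IsPadicInv` exists and is unique). -/
def padicInv (p : ℕ) [Fact p.Prime] (B : Type) [Ring B] [Algebra ℚ_[p] B] : AddCircle (1 : ℚ) :=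
  if h : ∃ q, IsPadicInv p B q then h.choose else 0

open Classical in
/-- The local invariant `inv_∞ B ∈ ℚ/ℤ` of a central simple algebra `B` over `ℝ`: it is `0` if `B`
is a matrix algebra over `ℝ`, and `1/2` otherwise. -/
def realInv (B : Type) [Ring B] [Algebra ℝ B] : AddCircle (1 : ℚ) :=
  if ∃ n : ℕ, Nonempty (B ≃ₐ[ℝ] Matrix (Fin n) (Fin n) ℝ) then 0
  else (((1 / 2 : ℚ)) : AddCircle (1 : ℚ))

/-! ### The integral Brauer–Manin set -/

/-- The underlying type of the base change `L ⊗_R A` of an `R`-algebra `A` along a homomorphism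
`f : R → L`. -/
def BaseChange {R L : Type} [CommRing R] [CommRing L] (f : R →+* L)
    (A : Type) [Ring A] [Algebra R A] : Type :=
  @TensorProduct R _ L A _ _ f.toAlgebra.toModule _

instance instRingBaseChange {R L : Type} [CommRing R] [CommRing L] (f : R →+* L)
    (A : Type) [Ring A] [Algebra R A] : Ring (BaseChange f A) :=
  @Algebra.TensorProduct.instRing R L A _ _ f.toAlgebra _ _

instance instAlgebraBaseChange {R L : Type} [CommRing R] [CommRing L] (f : R →+* L)
    (A : Type) [Ring A] [Algebra R A] : Algebra L (BaseChange f A) :=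
  letI : Algebra R L := f.toAlgebra
  (Algebra.TensorProduct.leftAlgebra : Algebra L (L ⊗[R] A))

/-- The value `A(P) = A ⊗ T` at a point `P ∈ U(T)` of an algebra `A` over `ℚ[U]`. -/
abbrev Points.fibre {F : MvPolynomial (Fin 3) ℤ} {T : Type} [CommRing T] [Algebra ℚ T]
    (P : Points F T) (A : Type) [Ring A] [Algebra (CoordRing F) A] : Type :=
  BaseChange (P.evalHom : CoordRing F →+* T) A

/-- The Brauer–Manin pairing `∑_v inv_v A(P_v)` of an adelic point with the class of an Azumaya
algebra `A` over `U`, the sum being over `v = ∞` and all prime numbers (all but finitely many terms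
vanish). -/
def pairing {F : MvPolynomial (Fin 3) ℤ} (P : AdelicPoints F)
    (A : Type) [Ring A] [Algebra (CoordRing F) A] : AddCircle (1 : ℚ) :=
  realInv (P.1.fibre A) +
    ∑ᶠ p : Nat.Primes, padicInv p (((P.2 p).map (algebraMap ℤ_[p] ℚ_[p])).fibre A)

/-- `𝒰(𝐀_ℤ)^Br`: the integral adelic points orthogonal to the Brauer group of `U`, that is, to
(the class of) every Azumaya algebra over `ℚ[U]`. -/
def brauerManinSet (F : MvPolynomial (Fin 3) ℤ) : Set (AdelicPoints F) :=
  {P | ∀ (A : Type) [Ring A] [Algebra (CoordRing F) A],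
    IsAzumaya (CoordRing F) A → pairing P A = 0}

/-! ### Counting -/

/-- The number of `k ∈ ℤ` with `|k| ≤ M` and `𝒰_k(𝐀_ℤ) ≠ ∅`. -/
def countSoluble (F : ℤ → MvPolynomial (Fin 3) ℤ) (M : ℝ) : ℕ :=
  Set.ncard {k : ℤ | |(k : ℝ)| ≤ M ∧ Nonempty (AdelicPoints (F k))}

/-- The number of `k ∈ ℤ` with `|k| ≤ M`, `𝒰_k(𝐀_ℤ) ≠ ∅` and `𝒰_k(𝐀_ℤ)^Br = ∅`. -/
def countObstructed (F : ℤ → MvPolynomial (Fin 3) ℤ) (M : ℝ) : ℕ :=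
  Set.ncard {k : ℤ | |(k : ℝ)| ≤ M ∧ Nonempty (AdelicPoints (F k)) ∧ brauerManinSet (F k) = ∅}

end

end MarkoffK3

/-! The obstruction comes in each family from a single quaternion algebra. For a special form of `k`
there is an identity `B² - A C = δ ℓ² + G F` with `δ ∈ {-2, -1, 2}`, so the binary form with
coefficients `A, B, C` has nonzero constant discriminant on `U`. Its Clifford algebra `Cl A B C` is
then Azumaya over the whole of `ℚ[U]`, and generically it is the symbol algebra `(A, δ)`. The
choices, up to permuting the coordinates, are `(4x²y² - 1, -2)` for `k = -1 - 2ℓ²` with `ℓ` odd;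
`(4x² - 1, -1)` for `k = -n²` with `n ≠ 0`; `(2(4z² + 1), 2)` for `4k + 1 = ℓ²`, `ℓ = u² + 2v²`, `u,
v` coprime and `k ≡ 2 mod 4`.

For every adelic point one permutation makes all local invariants vanish except the one at 2, which
is `1/2`. At the real place `A > 0`. At an odd prime either `A` is a unit, so that the unramified
symbol `(A, δ)` is trivial, or `A ≡ 0`, and then `B² ≡ δ ℓ²` and the special form of `k` force `δ`
to be a square. At 2 a congruence on `A` identifies the algebra with the division algebra. The sum
is therefore `1/2`, and the Brauer–Manin set is empty (`notMem_brauerManinSet` and the three lemmas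
`brauerManinSet_F₁_eq_empty`, `brauerManinSet_F₂_eq_empty`, `brauerManinSet_F₃_eq_empty`).

The invariant `padicInv` is defined by an arbitrary cyclic presentation, so its value has to be
shown independent of the choice. For quaternion algebras a presentation amounts to an
`UnramifiedPair` with `γ² = s`, of invariant `v(s)/2`; zero divisors force `v(s)` to be even, and
over `ℚ₂` an even `v(s)` produces zero divisors.

Local solubility follows from Hensel's lemma for `k` in suitable residue classes, which gives
positive density. The special `k` in the first two families form quadratic sequences and contribute
`≫ M^(1/2)`. In the third family one counts the values `u² + 2v²`: Cauchy–Schwarz and a bound for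
the number of coincidences give `≫ N²/log N` values for `u, v ≤ 2N`, which is the source of the
logarithm. -/

namespace MarkoffK3

noncomputable section

/-! ### Clifford algebras of binary quadratic forms as Azumaya algebras -/

section

/-- The Clifford algebra of the binary quadratic form `a s² + 2 b s t + c t²`: the free module with
basis `1, j, w, j w`, where `j² = a`, `w² = c` and `j w + w j = 2 b`. -/
def Cl {R : Type*} [CommRing R] (_a _b _c : R) : Type _ := Fin 4 → R

namespace Cl

section Ring

variable {R : Type*} [CommRing R] {a b c : R}

instance : AddCommGroup (Cl a b c) := inferInstanceAs (AddCommGroup (Fin 4 → R))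
instance : Module R (Cl a b c) := inferInstanceAs (Module R (Fin 4 → R))
instance : Module.Free R (Cl a b c) := inferInstanceAs (Module.Free R (Fin 4 → R))
instance : Module.Finite R (Cl a b c) := inferInstanceAs (Module.Finite R (Fin 4 → R))

/-- The element `s + t j + u w + v j w`. -/
def mk (s t u v : R) : Cl a b c := ![s, t, u, v]

@[ext]
theorem ext {x y : Cl a b c} (h0 : x 0 = y 0) (h1 : x 1 = y 1) (h2 : x 2 = y 2)
    (h3 : x 3 = y 3) : x = y := by
  funext i
  fin_cases i <;> assumption

instance [Nontrivial R] : Nontrivial (Cl a b c) := inferInstanceAs (Nontrivial (Fin 4 → R))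

instance : One (Cl a b c) := ⟨mk 1 0 0 0⟩

instance : Mul (Cl a b c) := ⟨fun x y => mk
  (x 0 * y 0 + a * x 1 * y 1 + 2 * b * x 2 * y 1 + c * x 2 * y 2 - a * c * x 3 * y 3)
  (x 0 * y 1 + x 1 * y 0 + 2 * b * x 3 * y 1 + c * x 3 * y 2 - c * x 2 * y 3)
  (x 0 * y 2 + x 2 * y 0 + a * x 1 * y 3 + 2 * b * x 2 * y 3 - a * x 3 * y 1)
  (x 0 * y 3 + x 3 * y 0 + x 1 * y 2 - x 2 * y 1 + 2 * b * x 3 * y 3)⟩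

@[simp] theorem mk_zero (s t u v : R) : (mk s t u v : Cl a b c) 0 = s := rfl
@[simp] theorem mk_one (s t u v : R) : (mk s t u v : Cl a b c) 1 = t := rfl
@[simp] theorem mk_two (s t u v : R) : (mk s t u v : Cl a b c) 2 = u := rfl
@[simp] theorem mk_three (s t u v : R) : (mk s t u v : Cl a b c) 3 = v := rfl
@[simp] theorem one_zero : (1 : Cl a b c) 0 = 1 := rfl
@[simp] theorem one_one : (1 : Cl a b c) 1 = 0 := rfl
@[simp] theorem one_two : (1 : Cl a b c) 2 = 0 := rfl
@[simp] theorem one_three : (1 : Cl a b c) 3 = 0 := rfl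
@[simp] theorem zero_apply (i : Fin 4) : (0 : Cl a b c) i = 0 := rfl
@[simp] theorem add_apply (x y : Cl a b c) (i : Fin 4) : (x + y) i = x i + y i := rfl
@[simp] theorem neg_apply (x : Cl a b c) (i : Fin 4) : (-x) i = -x i := rfl
@[simp] theorem sub_apply (x y : Cl a b c) (i : Fin 4) : (x - y) i = x i - y i := rfl
@[simp] theorem smul_apply (r : R) (x : Cl a b c) (i : Fin 4) : (r • x) i = r * x i := rfl

@[simp] theorem mul_zero' (x y : Cl a b c) : (x * y) 0 =
    x 0 * y 0 + a * x 1 * y 1 + 2 * b * x 2 * y 1 + c * x 2 * y 2 - a * c * x 3 * y 3 := rfl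
@[simp] theorem mul_one' (x y : Cl a b c) : (x * y) 1 =
    x 0 * y 1 + x 1 * y 0 + 2 * b * x 3 * y 1 + c * x 3 * y 2 - c * x 2 * y 3 := rfl
@[simp] theorem mul_two' (x y : Cl a b c) : (x * y) 2 =
    x 0 * y 2 + x 2 * y 0 + a * x 1 * y 3 + 2 * b * x 2 * y 3 - a * x 3 * y 1 := rfl
@[simp] theorem mul_three' (x y : Cl a b c) : (x * y) 3 =
    x 0 * y 3 + x 3 * y 0 + x 1 * y 2 - x 2 * y 1 + 2 * b * x 3 * y 3 := rfl

instance : Ring (Cl a b c) :=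
  { (inferInstance : AddCommGroup (Cl a b c)) with
    mul := (· * ·)
    one := 1
    left_distrib := fun x y z => by ext <;> simp <;> ring
    right_distrib := fun x y z => by ext <;> simp <;> ring
    zero_mul := fun x => by ext <;> simp
    mul_zero := fun x => by ext <;> simp
    mul_assoc := fun x y z => by ext <;> simp <;> ring
    one_mul := fun x => by ext <;> simp
    mul_one := fun x => by ext <;> simp }

instance : Algebra R (Cl a b c) :=
  Algebra.ofModule (fun r x y => by ext <;> simp <;> ring) (fun r x y => by ext <;> simp <;> ring)

theorem algebraMap_eq (r : R) : algebraMap R (Cl a b c) r = mk r 0 0 0 := by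
  rw [Algebra.algebraMap_eq_smul_one]
  ext <;> simp

/-- The reduced trace. -/
def trd (x : Cl a b c) : R := 2 * x 0 + 2 * b * x 3

/-- The reduced norm. -/
def nrd (x : Cl a b c) : R :=
  x 0 * (x 0 + 2 * b * x 3) - a * x 1 ^ 2 - 2 * b * x 1 * x 2 - c * x 2 ^ 2 + a * c * x 3 ^ 2

theorem mul_self_eq (x : Cl a b c) :
    x * x = trd x • x - algebraMap R _ (nrd x) := by
  rw [algebraMap_eq]
  ext <;> simp [trd, nrd] <;> ring

/-- The basis `1, j, w, j w`. -/
def basis : Module.Basis (Fin 4) R (Cl a b c) := Pi.basisFun R (Fin 4)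

theorem basis_apply (i : Fin 4) : (basis : Module.Basis (Fin 4) R (Cl a b c)) i =
    (![mk 1 0 0 0, mk 0 1 0 0, mk 0 0 1 0, mk 0 0 0 1] : Fin 4 → Cl a b c) i := by
  have h : (basis : Module.Basis (Fin 4) R (Cl a b c)) i = (Pi.single i (1 : R) : Fin 4 → R) :=
    Pi.basisFun_apply ..
  rw [h]
  fin_cases i <;> ext <;> simp

theorem basis_repr (x : Cl a b c) (i : Fin 4) : basis.repr x i = x i := rfl

/-- This turns the quantity `v(N γ)/n²` of `IsPadicInv`, with `n = 2`, into `v(nrd γ)/2`. -/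
theorem norm_eq (x : Cl a b c) : Algebra.norm R x = nrd x ^ 2 := by
  rw [Algebra.norm_eq_matrix_det basis]
  have h : Algebra.leftMulMatrix basis x = Matrix.of ![
      ![x 0, a * x 1 + 2 * b * x 2, c * x 2, - a * c * x 3],
      ![x 1, x 0 + 2 * b * x 3, c * x 3, - c * x 2],
      ![x 2, - a * x 3, x 0, a * x 1 + 2 * b * x 2],
      ![x 3, - x 2, x 1, x 0 + 2 * b * x 3]] := by
    ext i k
    rw [Algebra.leftMulMatrix_eq_repr_mul, basis_repr, basis_apply]
    fin_cases i <;> fin_cases k <;> simp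
  rw [h]
  simp [Matrix.det_succ_row_zero, Fin.sum_univ_succ, nrd, Fin.succAbove]
  ring

theorem finrank_eq [Nontrivial R] : Module.finrank R (Cl a b c) = 4 := by
  rw [Module.finrank_eq_card_basis (basis : Module.Basis (Fin 4) R (Cl a b c))]
  simp

/-- The basis `1, jw - b, j, w` is orthogonal up to the last two vectors; `dualSum x` is
`2 d ∑ e x e'` over a basis and its dual basis for the trace form, `d = b² - a c`. -/
theorem dualSum (x : Cl a b c) :
    (b ^ 2 - a * c) • x + mk (-b) 0 0 1 * x * mk (-b) 0 0 1
      - (mk 0 1 0 0 * x * mk 0 c (-b) 0 + mk 0 0 1 0 * x * mk 0 (-b) a 0)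
      = (2 * (b ^ 2 - a * c)) • algebraMap R (Cl a b c) (trd x) := by
  rw [algebraMap_eq]
  ext <;> simp [trd] <;> ring

/-- Expansion of `x` in the basis `1, jw - b, j, w` with coefficients read off by the trace form,
cleared of the denominator `2 (b² - a c)`. -/
theorem reconstruct (x : Cl a b c) :
    ((b ^ 2 - a * c) * trd x) • (1 : Cl a b c) + trd (mk (-b) 0 0 1 * x) • mk (-b) 0 0 1
      - (trd (mk 0 c (-b) 0 * x) • mk 0 1 0 0 + trd (mk 0 (-b) a 0 * x) • mk 0 0 1 0)
      = (2 * (b ^ 2 - a * c)) • x := by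
  ext <;> simp [trd] <;> ring

/-- By `dualSum`, sandwiching between a basis and its dual basis is the trace, so every rank-one map
`x ↦ trd (y x) z` is a combination of two-sided multiplications. By `reconstruct`, every
endomorphism is a sum of such maps. -/
theorem mulLeftRight_surjective (h : IsUnit (2 * (b ^ 2 - a * c))) :
    Function.Surjective (AlgHom.mulLeftRight R (Cl a b c)) := by
  obtain ⟨e, he⟩ := h.exists_left_inv
  have hT : ∀ y z : Cl a b c, ∃ t : Cl a b c ⊗[R] (Cl a b c)ᵐᵒᵖ, ∀ x,
      AlgHom.mulLeftRight R _ t x = trd (y * x) • z := by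
    intro y z
    refine ⟨e • ((b ^ 2 - a * c) • ((z * y) ⊗ₜ MulOpposite.op 1)
      + (z * mk (-b) 0 0 1 * y) ⊗ₜ MulOpposite.op (mk (-b) 0 0 1)
      - ((z * mk 0 1 0 0 * y) ⊗ₜ MulOpposite.op (mk 0 c (-b) 0)
        + (z * mk 0 0 1 0 * y) ⊗ₜ MulOpposite.op (mk 0 (-b) a 0))), fun x => ?_⟩
    have h1 := congrArg (fun w => e • (z * w)) (dualSum (y * x))
    simp only [Algebra.algebraMap_eq_smul_one, smul_smul, mul_smul_comm, he, mul_one,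
      ← mul_assoc, one_mul] at h1
    simp only [map_smul, map_add, map_sub, LinearMap.smul_apply, LinearMap.add_apply,
      LinearMap.sub_apply, AlgHom.mulLeftRight_apply, MulOpposite.unop_op, mul_one]
    simp only [mul_assoc, mul_sub, mul_add, mul_smul_comm] at h1 ⊢
    exact h1
  intro f
  choose t ht using hT
  refine ⟨e • ((b ^ 2 - a * c) • t 1 (f 1) + t (mk (-b) 0 0 1) (f (mk (-b) 0 0 1))
    - (t (mk 0 c (-b) 0) (f (mk 0 1 0 0)) + t (mk 0 (-b) a 0) (f (mk 0 0 1 0)))), ?_⟩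
  refine LinearMap.ext fun x => ?_
  have h1 := congrArg (fun w => e • f w) (reconstruct x)
  simp only [map_smul, map_add, map_sub, smul_smul, he, one_smul] at h1
  rw [← h1]
  simp [ht, smul_smul]

theorem isAzumaya (h : IsUnit (2 * (b ^ 2 - a * c))) : IsAzumaya R (Cl a b c) where
  eq_of_smul_eq_smul {r s} hrs := by
    have := congrFun (hrs 1) 0
    simpa [smul_apply] using this
  bij := by
    have hs := mulLeftRight_surjective h
    refine ⟨?_, hs⟩
    -- Source and target are both free of rank 16, so the surjection is also injective.
    let e1 := ((basis (a := a) (b := b) (c := c)).map (MulOpposite.opLinearEquiv R))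
    let B1 := (basis (a := a) (b := b) (c := c)).tensorProduct e1
    let B2 : Module.Basis (Fin 4 × Fin 4) R (Module.End R (Cl a b c)) := Module.Basis.linearMap
      (basis (a := a) (b := b) (c := c)) (basis (a := a) (b := b) (c := c))
    exact OrzechProperty.injective_of_surjective_of_injective
      (B1.equiv B2 (Equiv.refl _)).toLinearMap
      (AlgHom.mulLeftRight R (Cl a b c)).toLinearMap (B1.equiv B2 (Equiv.refl _)).injective hs

end Ring

end Cl

end

namespace Cl

/-- The homomorphism of Clifford algebras induced by a ring homomorphism. -/
def mapHom {R L : Type*} [CommRing R] [CommRing L] (f : R →+* L) (a b c : R) :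
    Cl a b c →+* Cl (f a) (f b) (f c) where
  toFun := fun x => mk (f (x 0)) (f (x 1)) (f (x 2)) (f (x 3))
  map_one' := by ext <;> simp
  map_mul' := fun x y => by ext <;> simp [map_ofNat]
  map_zero' := by ext <;> simp
  map_add' := fun x y => by ext <;> simp

/-- The map carries the basis `1, j, w, jw` to the basis of the same name. -/
theorem tensor_lift_bijective {R L : Type*} [CommRing R] [CommRing L] [Algebra R L] (a b c : R)
    [Algebra R (Cl (algebraMap R L a) (algebraMap R L b) (algebraMap R L c))]
    [IsScalarTower R L (Cl (algebraMap R L a) (algebraMap R L b) (algebraMap R L c))]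
    (g : Cl a b c →ₐ[R] Cl (algebraMap R L a) (algebraMap R L b) (algebraMap R L c))
    (hg : ∀ x, g x = mapHom (algebraMap R L) a b c x)
    (hc : ∀ (r : L) (x : Cl a b c), Commute (Algebra.ofId L
      (Cl (algebraMap R L a) (algebraMap R L b) (algebraMap R L c)) r) (g x)) :
    Function.Bijective (Algebra.TensorProduct.lift (Algebra.ofId L _) g hc) := by
  have key : (Algebra.TensorProduct.lift (Algebra.ofId L _) g hc).toLinearMap =
      ((Algebra.TensorProduct.basis L (basis (a := a) (b := b) (c := c))).equiv
        (basis (a := algebraMap R L a) (b := algebraMap R L b) (c := algebraMap R L c))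
        (Equiv.refl _)).toLinearMap := by
    refine (Algebra.TensorProduct.basis L (basis (a := a) (b := b) (c := c))).ext fun i => ?_
    rw [LinearEquiv.coe_coe, Module.Basis.equiv_apply, Algebra.TensorProduct.basis_apply,
      AlgHom.toLinearMap_apply, Algebra.TensorProduct.lift_tmul, map_one, one_mul, basis_apply,
      Equiv.refl_apply, basis_apply, hg]
    fin_cases i <;> ext <;> simp [mapHom]
  have h2 := congrArg DFunLike.coe key
  rw [AlgHom.coe_toLinearMap] at h2
  rw [h2]
  exact LinearEquiv.bijective _

/-- The Clifford algebra of a binary form commutes with base change. -/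
def baseChangeEquiv {R L : Type} [CommRing R] [CommRing L] (f : R →+* L) (a b c : R) :
    BaseChange f (Cl a b c) ≃ₐ[L] Cl (f a) (f b) (f c) :=
  letI : Algebra R L := f.toAlgebra
  letI : Algebra R (Cl (f a) (f b) (f c)) :=
    ((algebraMap L (Cl (f a) (f b) (f c))).comp f).toAlgebra'
      (fun r x => Algebra.commutes (f r) x)
  haveI : IsScalarTower R L (Cl (f a) (f b) (f c)) := IsScalarTower.of_algebraMap_eq fun _ => rfl
  let g : Cl a b c →ₐ[R] Cl (f a) (f b) (f c) :=
    { mapHom f a b c with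
      commutes' := fun r => by
        change mapHom f a b c _ = algebraMap L (Cl (f a) (f b) (f c)) (f r)
        rw [algebraMap_eq, algebraMap_eq]
        ext <;> simp [mapHom] }
  AlgEquiv.ofBijective (A₁ := L ⊗[R] Cl a b c) _ (tensor_lift_bijective (L := L) a b c g (fun _ => rfl)
    fun r x => Algebra.commutes r (g x))

/-- If `a` is a nonzero square, the Clifford algebra is a matrix algebra. -/
theorem nonempty_matrix_equiv {K : Type*} [Field K] [NeZero (2 : K)] {a b c e : K}
    (he : e ^ 2 = a) (ha : a ≠ 0) (hd : b ^ 2 - a * c ≠ 0) :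
    Nonempty (Cl a b c ≃ₐ[K] Matrix (Fin 2) (Fin 2) K) := by
  have he0 : e ≠ 0 := by rintro rfl; simp at he; exact ha he.symm
  subst he
  have h2 : (2 : K) ≠ 0 := NeZero.ne 2
  -- Here `j` acts as `diag(e, -e)`, and `w` is the matrix with diagonal `±b/e` whose off-diagonal
  -- entries are chosen so that `w² = c`.
  let g : Cl (e ^ 2) b c →ₗ[K] Matrix (Fin 2) (Fin 2) K :=
    { toFun := fun x => !![x 0 + e * x 1 + b / e * x 2 + b * x 3, x 2 + e * x 3;
        (b ^ 2 - e ^ 2 * c) / e * x 3 - (b ^ 2 - e ^ 2 * c) / e ^ 2 * x 2,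
        x 0 - e * x 1 - b / e * x 2 + b * x 3]
      map_add' := fun x y => by
        ext i j
        fin_cases i <;> fin_cases j <;> simp <;> ring
      map_smul' := fun r x => by
        ext i j
        fin_cases i <;> fin_cases j <;> simp <;> ring }
  let h : Cl (e ^ 2) b c →ₐ[K] Matrix (Fin 2) (Fin 2) K := AlgHom.ofLinearMap g
    (by ext i j; fin_cases i <;> fin_cases j <;> simp [g])
    (fun x y => by
      ext i j
      fin_cases i <;> fin_cases j <;> simp [g, Matrix.mul_apply, Fin.sum_univ_two] <;>
        field_simp <;> ring)
  have hinj : Function.Injective h := by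
    rw [injective_iff_map_eq_zero]
    intro x hx
    have hx' : g x = 0 := hx
    have h00 := congrFun (congrFun hx' 0) 0
    have h01 := congrFun (congrFun hx' 0) 1
    have h10 := congrFun (congrFun hx' 1) 0
    have h11 := congrFun (congrFun hx' 1) 1
    simp [g] at h00 h01 h10 h11
    have e10 : (b ^ 2 - e ^ 2 * c) * (e * x 3 - x 2) = 0 := by
      field_simp at h10
      linear_combination h10
    have e3 : e * x 3 - x 2 = 0 := (mul_eq_zero.mp e10).resolve_left hd
    have x3 : x 3 = 0 := by
      have : (2 * e) * x 3 = 0 := by linear_combination e3 + h01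
      exact (mul_eq_zero.mp this).resolve_left (mul_ne_zero h2 he0)
    have x2 : x 2 = 0 := by rw [x3] at h01; simpa using h01
    have x0 : x 0 = 0 := by
      have : 2 * x 0 = 0 := by rw [x2, x3] at h00 h11; linear_combination h00 + h11
      exact (mul_eq_zero.mp this).resolve_left h2
    have x1 : x 1 = 0 := by
      have : e * x 1 = 0 := by rw [x2, x3, x0] at h00; linear_combination h00
      exact (mul_eq_zero.mp this).resolve_left he0
    ext <;> simpa
  refine ⟨AlgEquiv.ofBijective h ⟨hinj, ?_⟩⟩
  have := (LinearMap.injective_iff_surjective_of_finrank_eq_finrank (f := h.toLinearMap)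
    (by rw [finrank_eq, Module.finrank_matrix]; simp)).mp hinj
  exact this

end Cl

/-! ### Local invariants of quaternion algebras -/

theorem realInv_eq_zero {R : Type} [CommRing R] (f : R →+* ℝ) {a b c : R} (ha : 0 < f a)
    (hd : f b ^ 2 - f a * f c ≠ 0) : realInv (BaseChange f (Cl a b c)) = 0 := by
  obtain ⟨e⟩ := Cl.nonempty_matrix_equiv (Real.sq_sqrt ha.le) ha.ne' hd
  rw [realInv, if_pos]
  exact ⟨2, ⟨(Cl.baseChangeEquiv f a b c).trans e⟩⟩

theorem IsPadicInv.of_algEquiv {p : ℕ} [Fact p.Prime] {B B' : Type} [Ring B] [Algebra ℚ_[p] B]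
    [Ring B'] [Algebra ℚ_[p] B'] (e : B ≃ₐ[ℚ_[p]] B') {q : AddCircle (1 : ℚ)}
    (h : IsPadicInv p B q) : IsPadicInv p B' q := by
  obtain ⟨n, φ, γ, hn, hγ, hq⟩ := h
  refine ⟨n, e.toAlgHom.comp φ, Units.map (e : B →* B') γ, ?_, fun ζ hζ => ?_, ?_⟩
  · rw [← e.toLinearEquiv.finrank_eq, hn]
  · have := congrArg e (hγ ζ hζ)
    simpa using this
  · rw [hq]
    have : Algebra.norm ℚ_[p] (e (γ : B)) = Algebra.norm ℚ_[p] (γ : B) := by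
      exact Algebra.norm_eq_of_algEquiv e _
    simp only [Units.coe_map]
    erw [this]

theorem padicInv_eq {p : ℕ} [Fact p.Prime] {B B' : Type} [Ring B] [Algebra ℚ_[p] B]
    [Ring B'] [Algebra ℚ_[p] B'] (e : B ≃ₐ[ℚ_[p]] B') {q : AddCircle (1 : ℚ)}
    (hex : ∃ q, IsPadicInv p B' q) (h : ∀ q', IsPadicInv p B' q' → q' = q) :
    padicInv p B = q := by
  have hB : ∃ q, IsPadicInv p B q := hex.imp fun q hq => hq.of_algEquiv e.symm
  rw [padicInv, dif_pos hB]
  exact h _ (hB.choose_spec.of_algEquiv e)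

/-- Since `padicInv` defaults to `0` where no presentation exists, vanishing requires no existence
statement. -/
theorem padicInv_eq_zero {p : ℕ} [Fact p.Prime] {B B' : Type} [Ring B] [Algebra ℚ_[p] B]
    [Ring B'] [Algebra ℚ_[p] B'] (e : B ≃ₐ[ℚ_[p]] B')
    (h : ∀ q', IsPadicInv p B' q' → q' = 0) : padicInv p B = 0 := by
  by_cases hB : ∃ q, IsPadicInv p B' q
  · exact padicInv_eq e hB h
  · rw [padicInv, dif_neg]
    exact fun ⟨q, hq⟩ => hB ⟨q, hq.of_algEquiv e⟩

section

/-- A pair `(z, γ)` presenting a quaternion algebra over `ℚ_p` as a cyclic algebra: `z` generates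
the unramified quadratic extension, `γ` induces its nontrivial automorphism and `γ² = s`. -/
structure UnramifiedPair (p : ℕ) [Fact p.Prime] (B : Type) [Ring B] [Algebra ℚ_[p] B]
    (s : ℚ_[p]) where
  /-- The trace of `z`. -/
  τ : ℤ_[p]
  /-- The norm of `z`. -/
  ν : ℤ_[p]
  /-- The generator of the unramified extension. -/
  z : B
  /-- The element inducing the Frobenius. -/
  γ : B
  s_ne : s ≠ 0
  z_sq : z * z = (τ : ℚ_[p]) • z - (ν : ℚ_[p]) • 1
  γ_z : γ * z = (τ : ℚ_[p]) • γ - z * γ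
  γ_sq : γ * γ = s • 1
  anisotropic : ∀ x y : ℤ_[p], ‖x ^ 2 + τ * x * y + ν * y ^ 2‖ < 1 → ‖x‖ < 1 ∧ ‖y‖ < 1
  span : ∀ e : B, ∃ x y u v : ℚ_[p], e = x • 1 + y • z + (u • 1 + v • z) * γ

variable {p : ℕ} [Fact p.Prime]

/-- Dividing by the larger coordinate makes one coordinate equal to `1`, and the form then takes a
unit value. Hence norms from the unramified quadratic extension have even valuation. -/
theorem norm_binary_form {τ ν : ℤ_[p]}
    (h : ∀ x y : ℤ_[p], ‖x ^ 2 + τ * x * y + ν * y ^ 2‖ < 1 → ‖x‖ < 1 ∧ ‖y‖ < 1)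
    (x y : ℚ_[p]) : ∃ t : ℚ_[p], ‖x ^ 2 + τ * x * y + ν * y ^ 2‖ = ‖t‖ ^ 2 ∧
      (t = 0 → x = 0 ∧ y = 0) := by
  have key : ∀ x' y' : ℤ_[p], (x' = 1 ∨ y' = 1) → ‖x' ^ 2 + τ * x' * y' + ν * y' ^ 2‖ = 1 := by
    intro x' y' hxy
    by_contra hne
    have := h x' y' (lt_of_le_of_ne (PadicInt.norm_le_one _) hne)
    rcases hxy with rfl | rfl <;> simp at this
  rcases le_total ‖x‖ ‖y‖ with hxy | hxy
  · refine ⟨y, ?_, fun hy => ⟨by simpa [hy] using hxy, hy⟩⟩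
    by_cases hy : y = 0
    · have hx : x = 0 := by simpa [hy] using hxy
      simp [hx, hy]
    have h1 : ‖x / y‖ ≤ 1 := by
      rw [norm_div]; exact div_le_one_of_le₀ hxy (norm_nonneg _)
    obtain ⟨w, hw⟩ : ∃ w : ℤ_[p], (w : ℚ_[p]) = x / y := ⟨⟨x / y, h1⟩, rfl⟩
    have h2 := key w 1 (Or.inr rfl)
    rw [PadicInt.norm_def] at h2
    push_cast at h2
    rw [hw] at h2
    have : x ^ 2 + τ * x * y + ν * y ^ 2
        = ((x / y) ^ 2 + τ * (x / y) * 1 + ν * 1 ^ 2) * y ^ 2 := by field_simp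
    rw [this, norm_mul, h2, norm_pow, one_mul]
  · refine ⟨x, ?_, fun hx => ⟨hx, by simpa [hx] using hxy⟩⟩
    by_cases hx : x = 0
    · have hy : y = 0 := by simpa [hx] using hxy
      simp [hx, hy]
    have h1 : ‖y / x‖ ≤ 1 := by
      rw [norm_div]; exact div_le_one_of_le₀ hxy (norm_nonneg _)
    obtain ⟨w, hw⟩ : ∃ w : ℤ_[p], (w : ℚ_[p]) = y / x := ⟨⟨y / x, h1⟩, rfl⟩
    have h2 := key 1 w (Or.inl rfl)
    rw [PadicInt.norm_def] at h2
    push_cast at h2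
    rw [hw] at h2
    have : x ^ 2 + τ * x * y + ν * y ^ 2
        = (1 ^ 2 + τ * 1 * (y / x) + ν * (y / x) ^ 2) * x ^ 2 := by field_simp
    rw [this, norm_mul, h2, norm_pow, one_mul]

theorem valuation_eq_of_norm_eq {x y : ℚ_[p]} (hx : x ≠ 0) (hy : y ≠ 0) (h : ‖x‖ = ‖y‖) :
    x.valuation = y.valuation := by
  rw [Padic.norm_eq_zpow_neg_valuation hx, Padic.norm_eq_zpow_neg_valuation hy] at h
  have hp : (1 : ℝ) < p := by exact_mod_cast (Fact.out : p.Prime).one_lt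
  have := zpow_right_injective₀ (by linarith) hp.ne' h
  simpa using this

namespace UnramifiedPair

variable {B : Type} [Ring B] [Algebra ℚ_[p] B] {s : ℚ_[p]}

/-- In an algebra with zero divisors `s` has even valuation. -/
theorem even_valuation (P : UnramifiedPair p B s) {e f : B} (he : e ≠ 0) (hf : f ≠ 0)
    (hef : e * f = 0) : Even s.valuation := by
  obtain ⟨x, y, u, v, rfl⟩ := P.span e
  set τ := (P.τ : ℚ_[p])
  set ν := (P.ν : ℚ_[p])
  -- Multiplying by the conjugate gives the reduced norm `N(x + yz) - s N(u + vz)`. It vanishes on a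
  -- zero divisor, and both norms have even valuation, so `s` does too.
  have hmul : ((x + y * τ) • 1 - y • P.z - (u • 1 + v • P.z) * P.γ) *
      (x • 1 + y • P.z + (u • 1 + v • P.z) * P.γ) =
      ((x ^ 2 + τ * x * y + ν * y ^ 2) - s * (u ^ 2 + τ * u * v + ν * v ^ 2)) • (1 : B) := by
    have e1 : P.γ * (P.z * P.γ) = τ • (s • (1 : B)) - s • P.z := by
      rw [← mul_assoc, P.γ_z, sub_mul, smul_mul_assoc, P.γ_sq, mul_assoc, P.γ_sq, mul_smul_comm,
        mul_one]
    have e3 : P.z * (P.z * P.γ) = τ • (P.z * P.γ) - ν • P.γ := by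
      rw [← mul_assoc, P.z_sq]; simp [sub_mul, τ, ν]
    simp only [mul_add, mul_sub, add_mul, sub_mul, smul_mul_assoc, mul_smul_comm, one_mul, mul_one,
      mul_assoc, e1, e3, P.γ_z, P.γ_sq, P.z_sq]
    module
  have h0 : (x ^ 2 + τ * x * y + ν * y ^ 2) - s * (u ^ 2 + τ * u * v + ν * v ^ 2) = 0 := by
    by_contra hne
    apply hf
    refine (smul_eq_zero.mp ?_).resolve_left hne
    rw [← smul_one_mul, ← hmul, mul_assoc, hef, mul_zero]
  obtain ⟨t, ht, ht0⟩ := norm_binary_form P.anisotropic x y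
  obtain ⟨r, hr, hr0⟩ := norm_binary_form P.anisotropic u v
  have hn : ‖t‖ ^ 2 = ‖s‖ * ‖r‖ ^ 2 := by
    rw [← ht, ← hr, ← norm_mul, sub_eq_zero.mp h0]
  have hs : 0 < ‖s‖ := norm_pos_iff.mpr P.s_ne
  have hr1 : r ≠ 0 := by
    intro hr1
    have ht1 : t = 0 := by simpa [hr1] using hn
    obtain ⟨rfl, rfl⟩ := ht0 ht1
    obtain ⟨rfl, rfl⟩ := hr0 hr1
    simp at he
  have ht1 : t ≠ 0 := by
    intro ht1
    rw [ht1] at hn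
    simp [hr1, P.s_ne] at hn
  have h1 : ‖s‖ = ‖(t / r) ^ 2‖ := by
    rw [norm_pow, norm_div, div_pow, hn, mul_div_assoc, div_self (by positivity), mul_one]
  rw [valuation_eq_of_norm_eq P.s_ne (pow_ne_zero _ (div_ne_zero ht1 hr1)) h1, Padic.valuation_pow]
  simp

end UnramifiedPair

end

theorem norm_lt_one_iff_toZMod {p : ℕ} [Fact p.Prime] (t : ℤ_[p]) :
    ‖t‖ < 1 ↔ PadicInt.toZMod t = 0 := by
  rw [← RingHom.mem_ker, PadicInt.ker_toZMod, PadicInt.mem_nonunits.symm]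
  rfl

/-- The form `x² + τ x y + ν y²` attached to an element `ζ ∉ ℚ_p` with `ζ² = τ ζ - ν` and
`ζ ^ p = τ - ζ` is anisotropic modulo `p`. -/
theorem anisotropic_of_frobenius {p : ℕ} [Fact p.Prime] {L : Type*} [Field L] [Algebra ℚ_[p] L]
    {τ ν : ℤ_[p]} {ζ : L} (hζ : ∀ x : ℚ_[p], algebraMap ℚ_[p] L x ≠ ζ)
    (hsq : ζ ^ 2 = algebraMap ℚ_[p] L τ * ζ - algebraMap ℚ_[p] L ν)
    (hfrob : ζ ^ p = algebraMap ℚ_[p] L τ - ζ) (x y : ℤ_[p])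
    (hxy : ‖x ^ 2 + τ * x * y + ν * y ^ 2‖ < 1) : ‖x‖ < 1 ∧ ‖y‖ < 1 := by
  open Polynomial in
  have hp : p.Prime := Fact.out
  set m : ℤ_[p][X] := X ^ 2 - C τ * X + C ν with hm
  set h : ℤ_[p][X] := X ^ p + X - C τ with hh
  have hmonic : m.Monic := by rw [hm]; monicity!
  have hmdeg : m.natDegree = 2 := by rw [hm]; compute_degree!
  let ι : ℤ_[p] →+* L := (algebraMap ℚ_[p] L).comp (algebraMap ℤ_[p] ℚ_[p])
  have hmz : m.eval₂ ι ζ = 0 := by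
    simp [hm, eval₂_add, eval₂_sub, ι, hsq]
  have hhz : h.eval₂ ι ζ = 0 := by
    simp [hh, eval₂_add, eval₂_sub, ι, hfrob]
  -- The remainder of `h` modulo `m` is linear over `ℤ_p` and vanishes at `ζ ∉ ℚ_p`, so it is zero.
  have hdvd : m ∣ h := by
    rw [← modByMonic_eq_zero_iff_dvd hmonic]
    have hdeg : (h %ₘ m).natDegree < 2 := by
      rw [← hmdeg]; exact natDegree_modByMonic_lt _ hmonic (by intro h1; simp [h1] at hmdeg)
    obtain ⟨A, B, hAB⟩ := exists_eq_X_add_C_of_natDegree_le_one (Nat.lt_succ_iff.mp hdeg)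
    have hz : (h %ₘ m).eval₂ ι ζ = 0 := by
      have := congrArg (eval₂ ι ζ) (modByMonic_add_div h m)
      rwa [eval₂_add, eval₂_mul, hmz, zero_mul, add_zero, hhz] at this
    rw [hAB] at hz ⊢
    simp only [eval₂_add, eval₂_mul, eval₂_C, eval₂_X] at hz
    have hA : A = 0 := by
      by_contra hA
      have hA' : (A : ℚ_[p]) ≠ 0 := by simpa using hA
      apply hζ (-(B : ℚ_[p]) / A)
      have hA'' : algebraMap ℚ_[p] L A ≠ 0 := by simpa using hA'
      rw [map_div₀, map_neg, div_eq_iff hA'']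
      simp only [ι, RingHom.comp_apply, PadicInt.algebraMap_apply] at hz
      linear_combination -hz
    have hB : B = 0 := by
      simpa [hA, ι] using hz
    simp [hA, hB]
  obtain ⟨g, hg⟩ := hdvd
  -- At a root `r` of `m` modulo `p` one has `h(r) = 2r - τ = m'(r)` because `r^p = r`. Writing `h =
  -- m g`, this value is `0`, so `h'(r) = m'(r) g(r) = 0`; but `h' ≡ 1` modulo `p`.
  have hroot : ∀ r : ℤ_[p], ¬ ‖r ^ 2 - τ * r + ν‖ < 1 := by
    intro r hr
    rw [norm_lt_one_iff_toZMod] at hr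
    have hm0 : PadicInt.toZMod (m.eval r) = 0 := by
      rw [← hr]; simp [hm]
    have h1 := congrArg (fun q => PadicInt.toZMod (q.eval r)) hg
    have h2 := congrArg (fun q => PadicInt.toZMod (q.derivative.eval r)) hg
    simp only [eval_mul, map_mul, hm0, zero_mul, derivative_mul, eval_add, map_add, add_zero] at h1 h2
    have h3 : PadicInt.toZMod (r + r - τ) = 0 := by
      rw [← h1]; simp [hh, ZMod.pow_card]
    have h4 : PadicInt.toZMod (m.derivative.eval r) = 0 := by
      rw [← h3]; simp [hm]; ring
    rw [h4, zero_mul] at h2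
    simp [hh, derivative_X_pow] at h2
  have hunit : ∀ t : ℤ_[p], ‖t‖ < 1 ∨ IsUnit t := fun t => by
    rw [PadicInt.isUnit_iff]
    exact (PadicInt.norm_le_one t).lt_or_eq
  have hy : ‖y‖ < 1 := by
    refine (hunit y).resolve_right fun hy => ?_
    obtain ⟨w, hw⟩ := hy.exists_left_inv
    apply hroot (-x * w)
    have : (-x * w) ^ 2 - τ * (-x * w) + ν = (x ^ 2 + τ * x * y + ν * y ^ 2) * w ^ 2 := by
      linear_combination (-τ * x * w - ν * (1 + w * y)) * hw
    rw [this, norm_mul]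
    exact mul_lt_one_of_nonneg_of_lt_one_left (norm_nonneg _) hxy (PadicInt.norm_le_one _)
  refine ⟨(hunit x).resolve_right fun hx => ?_, hy⟩
  have hx1 := PadicInt.isUnit_iff.mp hx
  have h1 : ‖τ * x * y + ν * y ^ 2‖ < 1 := by
    have : τ * x * y + ν * y ^ 2 = (τ * x + ν * y) * y := by ring
    rw [this, norm_mul]
    exact mul_lt_one_of_nonneg_of_lt_one_right (PadicInt.norm_le_one _) (norm_nonneg _) hy
  have h2 : ‖x ^ 2‖ < 1 := by
    have : x ^ 2 = (x ^ 2 + τ * x * y + ν * y ^ 2) + -(τ * x * y + ν * y ^ 2) := by ring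
    rw [this]
    exact PadicInt.norm_lt_one_add hxy (by rwa [norm_neg])
  rw [norm_pow, hx1] at h2
  norm_num at h2

section

variable {p : ℕ} [Fact p.Prime] {a b c : ℚ_[p]}

theorem eq_zero_of_anisotropic {τ ν : ℤ_[p]}
    (haniso : ∀ x y : ℤ_[p], ‖x ^ 2 + τ * x * y + ν * y ^ 2‖ < 1 → ‖x‖ < 1 ∧ ‖y‖ < 1)
    {x y : ℚ_[p]} (h : x ^ 2 + τ * x * y + ν * y ^ 2 = 0) : x = 0 ∧ y = 0 := by
  obtain ⟨t, ht, ht0⟩ := norm_binary_form haniso x y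
  rw [h, norm_zero] at ht
  exact ht0 (by simpa using ht.symm)

section

variable {B : Type} [Ring B] [Algebra ℚ_[p] B] [Nontrivial B] {s : ℚ_[p]} {τ ν : ℤ_[p]} {z γ : B}

theorem not_scalar_of_anisotropic (hz : z * z = (τ : ℚ_[p]) • z - (ν : ℚ_[p]) • 1)
    (haniso : ∀ x y : ℤ_[p], ‖x ^ 2 + τ * x * y + ν * y ^ 2‖ < 1 → ‖x‖ < 1 ∧ ‖y‖ < 1)
    (t : ℚ_[p]) : z ≠ t • 1 := by
  rintro rfl
  have h0 : (t ^ 2 - τ * t + ν) • (1 : B) = 0 := by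
    simp only [mul_smul_comm, mul_one] at hz
    have : (t ^ 2 - τ * t + ν) • (1 : B)
        = t • t • 1 - ((τ : ℚ_[p]) • t • 1 - (ν : ℚ_[p]) • 1) := by module
    rw [this, hz, sub_self]
  have := eq_zero_of_anisotropic haniso (x := -t) (y := 1) (by
    linear_combination (smul_eq_zero.mp h0).resolve_right one_ne_zero)
  exact one_ne_zero this.2

/-- If `γ` and `z` commuted, then `2zγ = τγ`; as `γ` is invertible, `z = τ/2` would be a scalar. -/
theorem not_commute_of_anisotropic (hs : s ≠ 0)
    (hz : z * z = (τ : ℚ_[p]) • z - (ν : ℚ_[p]) • 1) (hγz : γ * z = (τ : ℚ_[p]) • γ - z * γ)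
    (hγ : γ * γ = s • 1)
    (haniso : ∀ x y : ℤ_[p], ‖x ^ 2 + τ * x * y + ν * y ^ 2‖ < 1 → ‖x‖ < 1 ∧ ‖y‖ < 1) :
    γ * z ≠ z * γ := by
  intro h
  have h1 : (τ : ℚ_[p]) • γ = (2 : ℚ_[p]) • (z * γ) := by
    rw [two_smul]; nth_rewrite 1 [← h]; rw [hγz]; abel
  have h2 := congrArg (fun w => w * γ) h1
  simp only [smul_mul_assoc, mul_assoc, hγ, mul_smul_comm, mul_one] at h2
  apply not_scalar_of_anisotropic hz haniso (τ / 2)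
  have h3 : z = ((2 * s)⁻¹ : ℚ_[p]) • ((2 : ℚ_[p]) • s • z) := by
    rw [smul_smul (2 : ℚ_[p]) s, inv_smul_smul₀ (mul_ne_zero two_ne_zero hs)]
  rw [h3, ← h2, smul_smul, smul_smul]
  congr 1
  field_simp

end

/-- The pair `(z, γ)` generates the quaternion algebra `Cl a b c`. -/
def UnramifiedPair.ofCl {s : ℚ_[p]} {τ ν : ℤ_[p]} {z γ : Cl a b c} (hs : s ≠ 0)
    (hz : z * z = (τ : ℚ_[p]) • z - (ν : ℚ_[p]) • 1) (hγz : γ * z = (τ : ℚ_[p]) • γ - z * γ)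
    (hγ : γ * γ = s • 1)
    (haniso : ∀ x y : ℤ_[p], ‖x ^ 2 + τ * x * y + ν * y ^ 2‖ < 1 → ‖x‖ < 1 ∧ ‖y‖ < 1) :
    UnramifiedPair p (Cl a b c) s where
  τ := τ
  ν := ν
  z := z
  γ := γ
  s_ne := hs
  z_sq := hz
  γ_z := hγz
  γ_sq := hγ
  anisotropic := haniso
  span := by
    have hnscalar := not_scalar_of_anisotropic hz haniso
    have hncomm := not_commute_of_anisotropic hs hz hγz hγ haniso
    let f : Cl a b c →ₗ[ℚ_[p]] Cl a b c :=
      { toFun := fun e => e 0 • 1 + e 1 • z + (e 2 • 1 + e 3 • z) * γ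
        map_add' := fun x y => by
          simp only [Cl.add_apply, add_smul, add_mul]; abel
        map_smul' := fun r x => by
          simp only [Cl.smul_apply, mul_smul, smul_add, add_mul, smul_mul_assoc, RingHom.id_apply] }
    -- In a linear relation, multiply by the conjugate of `e₂ + e₃ z`. If its norm `N` is nonzero,
    -- `γ` lies in the commutative algebra generated by `z`, which is excluded; so `e₂ = e₃ = 0`,
    -- and `z` not being a scalar finishes.
    have hf : Function.Injective f := by
      rw [injective_iff_map_eq_zero]
      intro e he
      have he' : e 0 • 1 + e 1 • z + (e 2 • 1 + e 3 • z) * γ = 0 := he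
      have hN : e 2 ^ 2 + τ * e 2 * e 3 + ν * e 3 ^ 2 = 0 := by
        by_contra hN
        apply hncomm
        have h1 := congrArg (fun w => ((e 2 + e 3 * τ) • 1 - e 3 • z) * w) he'
        have h2 : ((e 2 + e 3 * τ) • 1 - e 3 • z) * (e 0 • 1 + e 1 • z + (e 2 • 1 + e 3 • z) * γ)
            = ((e 2 + e 3 * τ) * e 0 + ν * e 3 * e 1) • 1 +
              (e 2 * e 1 - e 3 * e 0) • z +
              (e 2 ^ 2 + τ * e 2 * e 3 + ν * e 3 ^ 2) • γ := by
          have e3 : z * (z * γ) = (τ : ℚ_[p]) • (z * γ) - (ν : ℚ_[p]) • γ := by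
            rw [← mul_assoc, hz]; simp [sub_mul]
          simp only [mul_add, add_mul, sub_mul, smul_mul_assoc, mul_smul_comm, one_mul,
            mul_one, e3, hz]
          module
        rw [h2] at h1
        simp only [mul_zero] at h1
        set r := ((e 2 + e 3 * τ) * e 0 + ν * e 3 * e 1)
        set r' := (e 2 * e 1 - e 3 * e 0)
        set N := (e 2 ^ 2 + τ * e 2 * e 3 + ν * e 3 ^ 2)
        have h3 : γ = N⁻¹ • (-(r • 1) - r' • z) := by
          rw [eq_inv_smul_iff₀ hN, eq_sub_iff_add_eq, eq_neg_iff_add_eq_zero, ← h1]; abel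
        rw [h3]
        simp [sub_mul, mul_sub]
      obtain ⟨h2, h3⟩ := eq_zero_of_anisotropic haniso hN
      simp only [h2, h3, zero_smul, add_zero, zero_mul] at he'
      have h1 : e 1 = 0 := by
        by_contra h1
        apply hnscalar (-(e 1)⁻¹ * e 0)
        rw [mul_smul, neg_smul, ← smul_neg, eq_inv_smul_iff₀ h1]
        exact eq_neg_of_add_eq_zero_right he'
      simp only [h1, zero_smul, add_zero] at he'
      have h0 : e 0 = 0 := (smul_eq_zero.mp he').resolve_right one_ne_zero
      ext <;> simpa
    intro e
    obtain ⟨w, hw⟩ := LinearMap.injective_iff_surjective.mp hf e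
    exact ⟨w 0, w 1, w 2, w 3, hw.symm⟩

/-- A computation of the local invariant comes from an unramified pair. -/
theorem IsPadicInv.exists_unramifiedPair {q : AddCircle (1 : ℚ)}
    (h : IsPadicInv p (Cl a b c) q) : ∃ s : ℚ_[p], Nonempty (UnramifiedPair p (Cl a b c) s) ∧
      q = (((s.valuation : ℚ) / 2 : ℚ) : AddCircle (1 : ℚ)) := by
  obtain ⟨n, φ, γ, hn, hγ, hq⟩ := h
  have hp : p.Prime := Fact.out
  have hn2 : n = 2 := by
    rw [Cl.finrank_eq] at hn
    nlinarith
  subst hn2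
  have hlt : p - 1 < p ^ 2 - 1 := by
    have := hp.one_lt
    have : p < p ^ 2 := by nlinarith
    omega
  have : NeZero (p ^ 2 - 1) := ⟨by omega⟩
  have : NeZero ((p ^ 2 - 1 : ℕ) : ℚ_[p]) := ⟨by exact_mod_cast NeZero.ne (p ^ 2 - 1)⟩
  set ζ := IsCyclotomicExtension.zeta (p ^ 2 - 1) ℚ_[p] (CyclotomicField (p ^ 2 - 1) ℚ_[p])
  have hζ : IsPrimitiveRoot ζ (p ^ 2 - 1) := IsCyclotomicExtension.zeta_spec _ _ _
  have hφ : Function.Injective φ := φ.toRingHom.injective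
  have hconj := hγ ζ hζ.pow_eq_one
  set z := φ ζ with hzdef
  have hγz : (γ : Cl a b c) * z = φ (ζ ^ p) * γ := by
    rw [← hconj]; simp
  have hne : ζ ^ p ≠ ζ := by
    intro heq
    have h0 : ζ ≠ 0 := hζ.ne_zero (NeZero.ne _)
    have h1 : ζ ^ (p - 1) = 1 := by
      apply mul_right_cancel₀ h0
      rw [← pow_succ, Nat.sub_add_cancel hp.one_lt.le, heq, one_mul]
    have h2 := Nat.le_of_dvd (by have := hp.one_lt; omega) ((hζ.pow_eq_one_iff_dvd _).mp h1)
    omega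
  have hnscalar : ∀ x : ℚ_[p], algebraMap ℚ_[p] _ x ≠ ζ := by
    intro x hx
    apply hne
    apply hφ
    rw [← hconj, hzdef, ← hx, AlgHom.commutes, ← Algebra.commutes, mul_assoc, Units.mul_inv, mul_one]
  set τ' := Cl.trd z
  set ν' := Cl.nrd z
  have hz2 : z * z = τ' • z - ν' • 1 := by
    rw [Cl.mul_self_eq, Algebra.algebraMap_eq_smul_one]
  have hζ2 : ζ ^ 2 = algebraMap _ _ τ' * ζ - algebraMap _ _ ν' := by
    apply hφ
    rw [map_sub, map_mul, AlgHom.commutes, AlgHom.commutes, map_pow, pow_two, ← hzdef, hz2,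
      Algebra.smul_def, Algebra.smul_def, mul_one]
  have hζp2 : (ζ ^ p) ^ 2 = algebraMap _ _ τ' * ζ ^ p - algebraMap _ _ ν' := by
    apply hφ
    rw [map_sub, map_mul, AlgHom.commutes, AlgHom.commutes, map_pow, ← hconj, pow_two]
    calc (γ : Cl a b c) * z * (γ⁻¹ : (Cl a b c)ˣ) * (γ * z * (γ⁻¹ : (Cl a b c)ˣ))
        = γ * (z * z) * (γ⁻¹ : (Cl a b c)ˣ) := by
          simp only [mul_assoc, Units.inv_mul_cancel_left]
      _ = _ := by
          rw [hz2, ← Algebra.smul_def, ← mul_one (algebraMap ℚ_[p] (Cl a b c) ν'),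
            ← Algebra.smul_def]
          simp [mul_sub, sub_mul]
  -- Conjugation by `γ` preserves the quadratic equation of `ζ`, so `ζ^p ≠ ζ` is its other root.
  have hfrob : ζ ^ p = algebraMap _ _ τ' - ζ := by
    have : (ζ ^ p - ζ) * (ζ ^ p + ζ - algebraMap _ _ τ') = 0 := by
      linear_combination hζp2 - hζ2
    have := (mul_eq_zero.mp this).resolve_left (sub_ne_zero.mpr hne)
    linear_combination this
  have hint : ∀ x : ℚ_[p], IsIntegral ℤ_[p] (algebraMap ℚ_[p] (CyclotomicField (p ^ 2 - 1) ℚ_[p]) x) →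
      ∃ y : ℤ_[p], (y : ℚ_[p]) = x := by
    intro x hx
    rw [isIntegral_algebraMap_iff (FaithfulSMul.algebraMap_injective _ _)] at hx
    exact IsIntegrallyClosed.isIntegral_iff.mp hx
  -- Trace and norm of a root of unity are integral, hence lie in the integrally closed ring `ℤ_p`.
  have hζint : IsIntegral ℤ_[p] ζ := by
    apply IsIntegral.of_pow (n := p ^ 2 - 1) (by omega)
    rw [hζ.pow_eq_one]; exact isIntegral_one
  obtain ⟨τ, hτ⟩ := hint τ' (by
    have : algebraMap _ _ τ' = ζ ^ p + ζ := by rw [hfrob]; ring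
    rw [this]
    exact (hζint.pow p).add hζint)
  obtain ⟨ν, hν⟩ := hint ν' (by
    have : algebraMap _ _ ν' = ζ ^ p * ζ := by rw [hfrob]; linear_combination hζ2
    rw [this]
    exact (hζint.pow p).mul hζint)
  have hγz' : (γ : Cl a b c) * z = τ' • (γ : Cl a b c) - z * γ := by
    rw [hγz, hfrob, map_sub, AlgHom.commutes, ← hzdef, sub_mul, Algebra.smul_def]
  have hncomm : (γ : Cl a b c) * z ≠ z * γ := by
    rw [hγz]
    intro h
    exact hne (hφ (γ.isUnit.mul_right_cancel h))
  have hcomm2 : (γ * γ : Cl a b c) * z = z * (γ * γ) := by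
    rw [mul_assoc, hγz', mul_sub, mul_smul_comm, ← mul_assoc, hγz', sub_mul, smul_mul_assoc,
      sub_sub_cancel, mul_assoc]
  -- As `γ²` commutes with `z` and `γ² = trd(γ) γ - nrd(γ)`, a nonzero trace would make `γ` itself
  -- commute with `z`.
  have htr : Cl.trd (γ : Cl a b c) = 0 := by
    by_contra htr
    apply hncomm
    rw [Cl.mul_self_eq, Algebra.algebraMap_eq_smul_one] at hcomm2
    simp only [sub_mul, mul_sub, smul_mul_assoc, mul_smul_comm, one_mul, mul_one,
      sub_left_inj] at hcomm2
    exact smul_right_injective _ htr hcomm2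
  have hγ2 : (γ * γ : Cl a b c) = (-Cl.nrd (γ : Cl a b c)) • 1 := by
    rw [Cl.mul_self_eq, htr, Algebra.algebraMap_eq_smul_one, zero_smul, zero_sub, neg_smul]
  have hnrd : Cl.nrd (γ : Cl a b c) ≠ 0 := by
    intro h0
    rw [h0, neg_zero, zero_smul] at hγ2
    have := (γ * γ).ne_zero
    exact this hγ2
  refine ⟨-Cl.nrd (γ : Cl a b c), ⟨UnramifiedPair.ofCl (τ := τ) (ν := ν) (neg_ne_zero.mpr hnrd)
    (by rw [hτ, hν]; exact hz2) (by rw [hτ]; exact hγz') hγ2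
    (anisotropic_of_frobenius hnscalar (by rw [hτ, hν]; exact hζ2) (by rw [hτ]; exact hfrob))⟩, ?_⟩
  rw [hq, Cl.norm_eq, Padic.valuation_pow,
    valuation_eq_of_norm_eq (neg_ne_zero.mpr hnrd) hnrd (norm_neg _)]
  congr 1
  push_cast
  ring

theorem even_valuation_div_two {s : ℤ} (h : Even s) :
    (((s : ℚ) / 2 : ℚ) : AddCircle (1 : ℚ)) = 0 := by
  obtain ⟨r, rfl⟩ := h
  rw [AddCircle.coe_eq_zero_iff]
  exact ⟨r, by push_cast; simp⟩

theorem odd_valuation_div_two {s : ℤ} (h : Odd s) :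
    (((s : ℚ) / 2 : ℚ) : AddCircle (1 : ℚ)) = ((1 / 2 : ℚ) : AddCircle (1 : ℚ)) := by
  obtain ⟨r, rfl⟩ := h
  rw [← sub_eq_zero, ← AddCircle.coe_sub, AddCircle.coe_eq_zero_iff]
  exact ⟨r, by push_cast; simp; ring⟩

/-- The invariant of a quaternion algebra with zero divisors is `0`. -/
theorem IsPadicInv.eq_zero {q : AddCircle (1 : ℚ)} (h : IsPadicInv p (Cl a b c) q)
    {e f : Cl a b c} (he : e ≠ 0) (hf : f ≠ 0) (hef : e * f = 0) : q = 0 := by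
  obtain ⟨s, ⟨P⟩, rfl⟩ := h.exists_unramifiedPair
  exact even_valuation_div_two (P.even_valuation he hf hef)

end

/-! ### Hensel's lemma and splitting at odd primes -/

section

/-- The cofactor is the conjugate `trd e - e`, since `e (trd e - e) = nrd e`. -/
theorem Cl.exists_mul_eq_zero {K : Type*} [Field K] [NeZero (2 : K)] {a b c : K} {e : Cl a b c}
    (he : e ≠ 0) (hn : Cl.nrd e = 0) : ∃ f : Cl a b c, f ≠ 0 ∧ e * f = 0 := by
  refine ⟨Cl.trd e • 1 - e, fun h => he ?_, ?_⟩
  · have h1 : e = Cl.trd e • 1 := (sub_eq_zero.mp h).symm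
    have h2 : Cl.trd e = 2 * Cl.trd e := by
      conv_lhs => rw [h1]
      simp [Cl.trd]
    have h3 : Cl.trd e = 0 := by linear_combination -h2
    rw [h1, h3, zero_smul]
  · rw [mul_sub, Cl.mul_self_eq, hn]
    simp

section Hensel

variable {p : ℕ} [Fact p.Prime]

open Polynomial in
theorem exists_sq_eq_of_norm_lt {u x : ℤ_[p]} (h : ‖x ^ 2 - u‖ < ‖2 * x‖ ^ 2) :
    ∃ v : ℤ_[p], v ^ 2 = u := by
  obtain ⟨v, hv, -⟩ := hensels_lemma (F := X ^ 2 - C u) (a := x)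
    (by simpa [one_add_one_eq_two] using h)
  exact ⟨v, by simpa [sub_eq_zero] using hv⟩

theorem isUnit_iff_toZMod_ne_zero (u : ℤ_[p]) : IsUnit u ↔ PadicInt.toZMod u ≠ 0 := by
  rw [Ne, ← norm_lt_one_iff_toZMod, ← PadicInt.not_isUnit_iff, not_not]

theorem isUnit_two (hp : p ≠ 2) : IsUnit (2 : ℤ_[p]) := by
  rw [PadicInt.isUnit_iff]
  have : ‖((2 : ℕ) : ℤ_[p])‖ = 1 := by
    rw [PadicInt.norm_natCast_eq_one_iff]
    exact (Nat.coprime_primes Fact.out Nat.prime_two).mpr hp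
  simpa using this

theorem toZMod_surjective (x : ZMod p) : ∃ y : ℤ_[p], PadicInt.toZMod y = x :=
  ZMod.ringHom_surjective PadicInt.toZMod x

theorem exists_sq_eq_of_toZMod (hp : p ≠ 2) {u : ℤ_[p]} (hu : PadicInt.toZMod u ≠ 0)
    (h : IsSquare (PadicInt.toZMod u)) : ∃ v : ℤ_[p], v ^ 2 = u := by
  obtain ⟨r, hr⟩ := h
  obtain ⟨x, rfl⟩ := toZMod_surjective r
  have hx : IsUnit x := (isUnit_iff_toZMod_ne_zero x).mpr fun h0 => hu (by rw [hr, h0, zero_mul])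
  apply exists_sq_eq_of_norm_lt (x := x)
  rw [PadicInt.isUnit_iff.mp ((isUnit_two hp).mul hx), one_pow, norm_lt_one_iff_toZMod]
  simp [hr, pow_two]

/-- A solution modulo `p` comes from counting values of two quadratic polynomials. It is lifted in
whichever of the two variables is nonzero modulo `p`; as `u` is a unit, they are not both zero. -/
theorem exists_sq_sub_mul_sq (hp : p ≠ 2) {u δ : ℤ_[p]} (hu : IsUnit u) (hδ : IsUnit δ) :
    ∃ x y : ℤ_[p], x ^ 2 - δ * y ^ 2 = u := by
  open Polynomial in
  rw [isUnit_iff_toZMod_ne_zero] at hu hδ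
  obtain ⟨x', y', hxy⟩ := FiniteField.exists_root_sum_quadratic (R := ZMod p)
    (f := X ^ 2 - C (PadicInt.toZMod u)) (g := C (-PadicInt.toZMod δ) * X ^ 2)
    (degree_X_pow_sub_C (by norm_num) _)
    (by rw [degree_C_mul_X_pow _ (neg_ne_zero.mpr hδ)]; rfl)
    (by rw [ZMod.card]; exact Nat.odd_iff.mp ((Fact.out : p.Prime).odd_of_ne_two hp))
  simp only [eval_sub, eval_pow, eval_X, eval_C, eval_mul] at hxy
  obtain ⟨x, rfl⟩ := toZMod_surjective x'
  obtain ⟨y, rfl⟩ := toZMod_surjective y'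
  by_cases hx : PadicInt.toZMod x = 0
  · obtain ⟨w, hw⟩ := ((isUnit_iff_toZMod_ne_zero δ).mpr hδ).exists_right_inv
    have hw' : PadicInt.toZMod δ * PadicInt.toZMod w = 1 := by rw [← map_mul, hw, map_one]
    have e : PadicInt.toZMod ((x ^ 2 - u) * w) = PadicInt.toZMod y ^ 2 := by
      simp only [map_mul, map_sub, map_pow]
      linear_combination PadicInt.toZMod w * hxy + PadicInt.toZMod y ^ 2 * hw'
    obtain ⟨v, hv⟩ := exists_sq_eq_of_toZMod hp (u := (x ^ 2 - u) * w)
      (by rw [e]; rintro h0; rw [h0, hx] at hxy; apply hu; linear_combination -hxy)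
      ⟨PadicInt.toZMod y, by rw [e, pow_two]⟩
    exact ⟨x, v, by rw [hv]; linear_combination (u - x ^ 2) * hw⟩
  · have e : PadicInt.toZMod (u + δ * y ^ 2) = PadicInt.toZMod x ^ 2 := by
      simp only [map_mul, map_add, map_pow]
      linear_combination -hxy
    obtain ⟨v, hv⟩ := exists_sq_eq_of_toZMod hp (u := u + δ * y ^ 2)
      (by rw [e]; exact pow_ne_zero 2 hx) ⟨PadicInt.toZMod x, by rw [e, pow_two]⟩
    exact ⟨v, y, by rw [hv]; ring⟩

theorem exists_sq_eq_of_two_adic {u t : ℤ_[2]} (h : u = 1 + 8 * t) : ∃ v : ℤ_[2], v ^ 2 = u := by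
  apply exists_sq_eq_of_norm_lt (x := 1)
  have h8 : (1 : ℤ_[2]) ^ 2 - u = ((2 : ℕ) : ℤ_[2]) ^ 3 * -t := by rw [h]; push_cast; ring
  have h2 : (2 : ℤ_[2]) * 1 = ((2 : ℕ) : ℤ_[2]) := by push_cast; ring
  rw [h8, h2, norm_mul, norm_pow, PadicInt.norm_p]
  have := PadicInt.norm_le_one (-t)
  norm_num
  norm_num at this
  linarith

end Hensel

/-- At an odd prime, the invariant of `Cl a b c` vanishes if `b² - a c` is a unit `δ` times a
square and `a` is a unit or `δ` is a square modulo `p`. -/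
theorem IsPadicInv.eq_zero_of_odd {p : ℕ} [Fact p.Prime] (hp : p ≠ 2) {a b c δ ℓ : ℤ_[p]}
    (hℓ : ℓ ≠ 0) (hδ : PadicInt.toZMod δ ≠ 0) (hd : b ^ 2 - a * c = δ * ℓ ^ 2)
    (h : PadicInt.toZMod a = 0 → IsSquare (PadicInt.toZMod δ)) {q : AddCircle (1 : ℚ)}
    (hq : IsPadicInv p (Cl (a : ℚ_[p]) (b : ℚ_[p]) (c : ℚ_[p])) q) : q = 0 := by
  have hd' : (b : ℚ_[p]) ^ 2 - a * c = δ * ℓ ^ 2 := by exact_mod_cast congrArg _ hd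
  suffices ∃ e : Cl (a : ℚ_[p]) (b : ℚ_[p]) (c : ℚ_[p]), e ≠ 0 ∧ Cl.nrd e = 0 by
    obtain ⟨e, he, hn⟩ := this
    obtain ⟨f, hf, hef⟩ := Cl.exists_mul_eq_zero he hn
    exact hq.eq_zero he hf hef
  by_cases ha : PadicInt.toZMod a = 0
  · obtain ⟨r, hr⟩ := exists_sq_eq_of_toZMod hp hδ (h ha)
    -- With `δ = r²`, the element `jw - b` squares to `(rℓ)²`, so `jw - b - rℓ` has norm zero.
    refine ⟨Cl.mk (-b - r * ℓ) 0 0 1, fun h0 => ?_, ?_⟩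
    · have := congrFun h0 3
      simp [-Cl.mk_three] at this
      exact one_ne_zero this
    · have hr' : (r : ℚ_[p]) ^ 2 = δ := by exact_mod_cast congrArg _ hr
      simp [Cl.nrd]
      linear_combination ℓ ^ 2 * hr' - hd'
  · obtain ⟨x, y, hxy⟩ := exists_sq_sub_mul_sq hp ((isUnit_iff_toZMod_ne_zero a).mpr ha)
      ((isUnit_iff_toZMod_ne_zero δ).mpr hδ)
    have hxy' : (x : ℚ_[p]) ^ 2 - δ * y ^ 2 = a := by exact_mod_cast congrArg _ hxy
    have hℓ' : (ℓ : ℚ_[p]) ≠ 0 := by simpa using hℓ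
    -- This is `x + y i + j` with `i = (jw - b)/ℓ`, of norm `x² - δ y² - a = 0`.
    refine ⟨Cl.mk (x - y * b / ℓ) 1 0 (y / ℓ), fun h0 => ?_, ?_⟩
    · have := congrFun h0 1
      simp [-Cl.mk_one] at this
      exact one_ne_zero this
    · simp [Cl.nrd]
      field_simp
      linear_combination ℓ ^ 2 * hxy' - y ^ 2 * hd'

end

/-! ### The invariant over the 2-adic numbers -/

section

theorem norm_one_sub_add_lt_one (x y : ℤ_[2])
    (h : ‖x ^ 2 + ((-1 : ℤ_[2]) : ℤ_[2]) * x * y + (1 : ℤ_[2]) * y ^ 2‖ < 1) :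
    ‖x‖ < 1 ∧ ‖y‖ < 1 := by
  rw [norm_lt_one_iff_toZMod] at h
  rw [norm_lt_one_iff_toZMod, norm_lt_one_iff_toZMod]
  simp only [map_add, map_mul, map_pow, map_neg, map_one] at h
  revert h
  generalize PadicInt.toZMod x = x'
  generalize PadicInt.toZMod y = y'
  revert x' y'
  decide

open Polynomial in
theorem minpoly_primitive_cube_root {ζ : CyclotomicField (2 ^ 2 - 1) ℚ_[2]}
    (hζ : ζ ^ 2 + ζ + 1 = 0) : minpoly ℚ_[2] ζ = X ^ 2 + X + 1 := by
  have hdeg : (X ^ 2 + X + 1 : ℚ_[2][X]).natDegree = 2 := by compute_degree!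
  have hmonic : (X ^ 2 + X + 1 : ℚ_[2][X]).Monic := by monicity!
  refine (minpoly.eq_of_irreducible_of_monic ?_ (by simpa using hζ) hmonic).symm
  rw [hmonic.irreducible_iff_roots_eq_zero_of_degree_le_three hdeg.ge (by rw [hdeg]; norm_num),
    Multiset.eq_zero_iff_forall_notMem]
  intro r hr
  have hr' : r ^ 2 + r + 1 = 0 := by simpa using (mem_roots'.mp hr).2
  have := eq_zero_of_anisotropic norm_one_sub_add_lt_one (x := -r) (y := 1) (by
    push_cast; linear_combination hr')
  exact one_ne_zero this.2

variable {a b c : ℚ_[2]}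

/-- Over `ℚ₂` two anticommuting elements `θ`, `γ` with `θ² = -3` determine the invariant. -/
theorem exists_isPadicInv_two {θ γ : Cl a b c} {s : ℚ_[2]} (hs : s ≠ 0) (hθ : θ * θ = (-3 : ℚ_[2]) • 1)
    (hθγ : γ * θ = -(θ * γ)) (hγ : γ * γ = s • 1) :
    Nonempty (UnramifiedPair 2 (Cl a b c) s) ∧ ∃ q, IsPadicInv 2 (Cl a b c) q := by
  -- A primitive cube root of unity, since `θ² = -3`. It generates the unramified quadratic
  -- extension of `ℚ₂`, and conjugation by `γ` is the Frobenius `z ↦ z²`.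
  set z : Cl a b c := (2⁻¹ : ℚ_[2]) • (θ - 1) with hz
  have hz2 : z * z = -z - 1 := by
    rw [hz]
    simp only [smul_mul_assoc, mul_smul_comm, mul_sub, sub_mul, one_mul, mul_one, hθ]
    module
  have hγz : γ * z = -γ - z * γ := by
    rw [hz]
    simp only [smul_mul_assoc, mul_smul_comm, mul_sub, sub_mul, one_mul, mul_one, hθγ]
    module
  refine ⟨⟨UnramifiedPair.ofCl (τ := -1) (ν := 1) (z := z) hs ?_ ?_ hγ
    norm_one_sub_add_lt_one⟩, ?_⟩
  · rw [hz2]; push_cast; module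
  · rw [hγz]; push_cast; module
  have : NeZero (2 ^ 2 - 1 : ℕ) := ⟨by norm_num⟩
  have : NeZero ((2 ^ 2 - 1 : ℕ) : ℚ_[2]) := ⟨by norm_num⟩
  set ζ := IsCyclotomicExtension.zeta (2 ^ 2 - 1) ℚ_[2] (CyclotomicField (2 ^ 2 - 1) ℚ_[2])
  have hζ : IsPrimitiveRoot ζ (2 ^ 2 - 1) := IsCyclotomicExtension.zeta_spec _ _ _
  have hζ3 : ζ ^ 3 = 1 := hζ.pow_eq_one
  have hζ1 : ζ ≠ 1 := hζ.ne_one (by norm_num)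
  have hζ2 : ζ ^ 2 + ζ + 1 = 0 := by
    have : (ζ - 1) * (ζ ^ 2 + ζ + 1) = 0 := by linear_combination hζ3
    exact (mul_eq_zero.mp this).resolve_left (sub_ne_zero.mpr hζ1)
  let pb := hζ.powerBasis ℚ_[2]
  have hgen : pb.gen = ζ := hζ.powerBasis_gen ℚ_[2]
  have hmin : Polynomial.aeval z (minpoly ℚ_[2] pb.gen) = 0 := by
    rw [hgen, minpoly_primitive_cube_root hζ2]
    simp only [map_add, map_pow, Polynomial.aeval_X, map_one]
    rw [pow_two, hz2]
    abel
  let φ := pb.lift z hmin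
  have hφ : φ ζ = z := by
    have := pb.lift_gen z hmin
    rwa [hgen] at this
  let u : (Cl a b c)ˣ := ⟨γ, s⁻¹ • γ, by rw [mul_smul_comm, hγ, inv_smul_smul₀ hs],
    by rw [smul_mul_assoc, hγ, inv_smul_smul₀ hs]⟩
  have hconj : (u : Cl a b c) * z * (u⁻¹ : (Cl a b c)ˣ) = z ^ 2 := by
    rw [Units.mul_inv_eq_iff_eq_mul, pow_two, hz2]
    change γ * z = (-z - 1) * γ
    rw [hγz, sub_mul, one_mul, neg_mul]
    abel
  refine ⟨_, 2, φ, u, by rw [Cl.finrank_eq]; norm_num, fun ξ hξ => ?_, rfl⟩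
  obtain ⟨i, -, rfl⟩ := hζ.eq_pow_of_pow_eq_one hξ
  rw [map_pow, ← pow_mul, map_pow, hφ, mul_comm i 2, pow_mul, ← hconj, Units.conj_pow]

/-- The invariant over `ℚ₂` is `1/2` if there is an unramified pair of odd valuation. -/
theorem IsPadicInv.eq_half {q : AddCircle (1 : ℚ)} (h : IsPadicInv 2 (Cl a b c) q) {s : ℚ_[2]}
    (P : UnramifiedPair 2 (Cl a b c) s) (hs : Odd s.valuation) :
    q = ((1 / 2 : ℚ) : AddCircle (1 : ℚ)) := by
  obtain ⟨r, ⟨Q⟩, rfl⟩ := h.exists_unramifiedPair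
  apply odd_valuation_div_two
  by_contra hr
  rw [Int.not_odd_iff_even] at hr
  -- The odd pair `P` makes the algebra a division algebra. Assuming `v(r)` even for a second pair
  -- `Q`, zero divisors are constructed below.
  have hnz : ∀ e f : Cl a b c, e * f = 0 → e = 0 ∨ f = 0 := by
    intro e f hef
    by_contra! hne
    exact Int.not_even_iff_odd.mpr hs (P.even_valuation hne.1 hne.2 hef)
  obtain ⟨m, hm⟩ := hr
  set t : ℚ_[2] := (2 : ℚ_[2]) ^ m with ht
  have ht0 : t ≠ 0 := zpow_ne_zero _ two_ne_zero
  have hv2 : ‖t‖ ^ 2 = ‖r‖ := by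
    rw [Padic.norm_eq_zpow_neg_valuation Q.s_ne, hm, ht, norm_zpow]
    have := Padic.norm_p (p := 2)
    push_cast at this
    rw [this, inv_zpow', ← zpow_natCast, ← zpow_mul]
    push_cast
    ring_nf
  obtain ⟨u, hu⟩ : ∃ u : ℤ_[2], (u : ℚ_[2]) = r / t ^ 2 := by
    refine ⟨⟨r / t ^ 2, ?_⟩, rfl⟩
    rw [norm_div, norm_pow, hv2, div_self (norm_ne_zero_iff.mpr Q.s_ne)]
  have hu1 : PadicInt.toZMod u ≠ 0 := by
    rw [← isUnit_iff_toZMod_ne_zero, PadicInt.isUnit_iff, PadicInt.norm_def, hu, norm_div,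
      norm_pow, hv2, div_self (norm_ne_zero_iff.mpr Q.s_ne)]
  -- The only anisotropic form `x² + τxy + νy²` over the field with two elements has `τ = ν = 1`.
  have hτ : PadicInt.toZMod Q.τ ≠ 0 ∧ PadicInt.toZMod Q.ν ≠ 0 := by
    have h1 := Q.anisotropic 1 1
    have h2 := Q.anisotropic 0 1
    simp only [norm_lt_one_iff_toZMod, map_add, map_mul, map_pow, map_one, map_zero] at h1 h2
    revert h1 h2
    generalize PadicInt.toZMod Q.τ = x'
    generalize PadicInt.toZMod Q.ν = y'
    revert x' y'
    decide
  -- The unit `u = r/t²` is a norm: modulo 2 the polynomial `X² + τX + (ν - u)` has the simple root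
  -- `0`, as `τ` is a unit and `ν ≡ u`.
  obtain ⟨x, hx⟩ : ∃ x : ℤ_[2], x ^ 2 + Q.τ * x + Q.ν = u := by
    open Polynomial in
    obtain ⟨v, hv, -⟩ := hensels_lemma (F := X ^ 2 + C Q.τ * X + C (Q.ν - u)) (a := (0 : ℤ_[2])) (by
      have h1 : ‖Q.τ‖ = 1 := by
        rw [← PadicInt.isUnit_iff, isUnit_iff_toZMod_ne_zero]; exact hτ.1
      have h2 : ‖Q.ν - u‖ < 1 := by
        rw [norm_lt_one_iff_toZMod, map_sub]
        have := hτ.2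
        revert this hu1
        generalize PadicInt.toZMod Q.ν = x'
        generalize PadicInt.toZMod u = y'
        revert x' y'
        decide
      simp only [map_add, map_sub, map_mul, map_pow, aeval_X, aeval_C,
        derivative_mul, derivative_X_pow, derivative_C, derivative_X]
      simpa [h1] using h2)
    exact ⟨v, by simp at hv; linear_combination hv⟩
  have hx' : (x : ℚ_[2]) ^ 2 + Q.τ * x + Q.ν = r / t ^ 2 := by
    rw [← hu]; exact_mod_cast congrArg _ hx
  -- The product is `t² N(x + z) - γ² = t² u - r = 0`; the mixed terms cancel because `γ` conjugates
  -- `z`.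
  have hα : (t • ((x + Q.τ : ℚ_[2]) • 1 - Q.z) - Q.γ) * (t • ((x : ℚ_[2]) • 1 + Q.z) + Q.γ) = 0 := by
    have h1 : (t • ((x + Q.τ : ℚ_[2]) • 1 - Q.z) - Q.γ) * (t • ((x : ℚ_[2]) • 1 + Q.z) + Q.γ) =
        (t ^ 2 * ((x : ℚ_[2]) ^ 2 + Q.τ * x + Q.ν) - r) • 1 := by
      simp only [mul_add, sub_mul, smul_mul_assoc, mul_smul_comm, one_mul,
        mul_one, Q.γ_z, Q.γ_sq, Q.z_sq]
      module
    rw [h1, hx', mul_div_cancel₀ _ (pow_ne_zero 2 ht0), sub_self, zero_smul]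
  have hnc := not_commute_of_anisotropic Q.s_ne Q.z_sq Q.γ_z Q.γ_sq Q.anisotropic
  apply hnc
  rcases hnz _ _ hα with h0 | h0
  · have : Q.γ = t • ((x + Q.τ : ℚ_[2]) • 1 - Q.z) := (sub_eq_zero.mp h0).symm
    rw [this]; simp [mul_sub, sub_mul]
  · have : Q.γ = -(t • ((x : ℚ_[2]) • 1 + Q.z)) := eq_neg_of_add_eq_zero_right h0
    rw [this]; simp [mul_add, add_mul]

end

/-! ### Recognising the division algebra over the 2-adic numbers -/

section

/-- `B` contains a pair of anticommuting elements `θ`, `γ` with `θ² = -3` and `γ²` a scalar of odd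
valuation, so that it is the quaternion division algebra over `ℚ₂`. -/
def HasRamifiedPair (B : Type) [Ring B] [Algebra ℚ_[2] B] : Prop :=
  ∃ (θ γ : B) (s : ℚ_[2]), s ≠ 0 ∧ θ * θ = (-3 : ℚ_[2]) • 1 ∧ γ * θ = -(θ * γ) ∧
    γ * γ = s • 1 ∧ Odd s.valuation

section RamifiedPair

variable {B : Type} [Ring B] [Algebra ℚ_[2] B]

theorem valuation_two : (2 : ℚ_[2]).valuation = 1 := by
  have := Padic.valuation_p (p := 2)
  exact_mod_cast this

theorem HasRamifiedPair.of_hamilton {i j : B} (hi : i * i = -1) (hj : j * j = -1)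
    (hji : j * i = -(i * j)) : HasRamifiedPair B := by
  have h1 : i * (j * i) = j := by rw [hji, mul_neg, ← mul_assoc, hi]; simp
  have h2 : j * (i * j) = i := by rw [← mul_assoc, hji, neg_mul, mul_assoc, hj]; simp
  have h3 : i * (i * j) = -j := by rw [← mul_assoc, hi]; simp
  have h4 : i * j * i = j := by rw [mul_assoc, h1]
  have h5 : i * j * j = -i := by rw [mul_assoc, hj]; simp
  have h6 : i * j * (i * j) = -1 := by rw [← mul_assoc, h4, hj]
  -- In Hamilton's quaternions `i + j + ij` squares to `-3`, anticommutes with `i - j`, and `(i -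
  -- j)² = -2` has odd valuation.
  refine ⟨i + j + i * j, i - j, -2, by norm_num, ?_, ?_, ?_, ?_⟩
  · simp only [mul_add, add_mul, hi, hj, hji, h2, h3, h4, h5, h6]
    module
  · simp only [mul_add, add_mul, mul_sub, sub_mul, hi, hj, hji, h2, h3, h4, h5]
    module
  · simp only [mul_sub, sub_mul, hi, hj, hji]
    module
  · rw [valuation_eq_of_norm_eq (by norm_num) two_ne_zero (norm_neg (2 : ℚ_[2])), valuation_two]
    exact odd_one

/-- If `-a` is a sum of two squares then `(-1, a) = (-1, -1)`: the element `(r j + t ij)/a` squares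
to `(r² + t²)/a = -1` and anticommutes with `i`. -/
theorem HasRamifiedPair.of_neg_one {i j : B} {a r t : ℚ_[2]} (ha : a ≠ 0)
    (hi : i * i = (-1 : ℚ_[2]) • 1) (hj : j * j = a • 1) (hji : j * i = -(i * j))
    (hrt : r ^ 2 + t ^ 2 = -a) : HasRamifiedPair B := by
  have h1 : j * (i * j) = -(a • i) := by
    rw [← mul_assoc, hji, neg_mul, mul_assoc, hj, mul_smul_comm, mul_one]
  have h3 : i * (i * j) = -j := by rw [← mul_assoc, hi]; simp
  have hs : (a⁻¹ * r) ^ 2 * a + (a⁻¹ * t) ^ 2 * a = -1 := by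
    field_simp; linear_combination hrt
  refine HasRamifiedPair.of_hamilton (i := i) (j := (a⁻¹ * r) • j + (a⁻¹ * t) • (i * j))
    (by rw [hi]; module) ?_ ?_
  · have : (-1 : B) = ((a⁻¹ * r) ^ 2 * a + (a⁻¹ * t) ^ 2 * a) • 1 := by rw [hs]; module
    rw [this]
    simp only [mul_add, add_mul, smul_mul_assoc, mul_smul_comm, mul_assoc, hi, hj, h1, mul_neg, mul_one]
    module
  · simp only [mul_add, add_mul, smul_mul_assoc, mul_smul_comm, mul_assoc, hji, h3, mul_neg]
    module

/-- If `-a = u²`, then `j/u` and `(i + ij/u)/2` both square to `-1` and anticommute, so the algebra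
contains Hamilton's quaternions. -/
theorem HasRamifiedPair.of_neg_two {i j : B} {a u : ℚ_[2]} (ha : a ≠ 0)
    (hi : i * i = (-2 : ℚ_[2]) • 1) (hj : j * j = a • 1) (hji : j * i = -(i * j))
    (hu : u ^ 2 = -a) : HasRamifiedPair B := by
  have hu0 : u ≠ 0 := by rintro rfl; apply ha; linear_combination hu
  have h1 : j * (i * j) = -(a • i) := by
    rw [← mul_assoc, hji, neg_mul, mul_assoc, hj, mul_smul_comm, mul_one]
  have h3 : i * (i * j) = (-2 : ℚ_[2]) • j := by rw [← mul_assoc, hi]; simp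
  have h6 : i * (j * (i * j)) = (2 * a) • 1 := by
    rw [h1, mul_neg, mul_smul_comm, hi]; module
  have h7 : i * (j * i) = (2 : ℚ_[2]) • j := by rw [hji, mul_neg, h3]; module
  have hs : (u⁻¹) ^ 2 * a = -1 := by field_simp; linear_combination hu
  have hs' : (2⁻¹ : ℚ_[2]) ^ 2 * (-2) + (2⁻¹ * u⁻¹) ^ 2 * (2 * a) = -1 := by
    linear_combination 2⁻¹ * hs
  refine HasRamifiedPair.of_hamilton (i := (2⁻¹ : ℚ_[2]) • i + (2⁻¹ * u⁻¹) • (i * j))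
    (j := u⁻¹ • j) ?_ ?_ ?_
  · have : (-1 : B) = ((2⁻¹ : ℚ_[2]) ^ 2 * (-2) + (2⁻¹ * u⁻¹) ^ 2 * (2 * a)) • 1 := by
      rw [hs']; module
    rw [this]
    simp only [mul_add, add_mul, smul_mul_assoc, mul_smul_comm, mul_assoc, hi, h3, h6, h7]
    module
  · have : (-1 : B) = ((u⁻¹) ^ 2 * a) • 1 := by rw [hs]; module
    rw [this]
    simp only [smul_mul_assoc, mul_smul_comm, hj]
    module
  · simp only [mul_add, add_mul, smul_mul_assoc, mul_smul_comm, mul_assoc, hji, h1, hj, mul_one]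
    module

/-- With `θ = w (j + ij/2)` one gets `θ² = w² (2e - e) = -3`, and `γ = i` has `γ² = 2`. -/
theorem HasRamifiedPair.of_two {i j : B} {e w : ℚ_[2]}
    (hi : i * i = (2 : ℚ_[2]) • 1) (hj : j * j = (2 * e) • 1) (hji : j * i = -(i * j))
    (hw : w ^ 2 * e = -3) : HasRamifiedPair B := by
  have h1 : j * (i * j) = -((2 * e) • i) := by
    rw [← mul_assoc, hji, neg_mul, mul_assoc, hj, mul_smul_comm, mul_one]
  have h3 : i * (i * j) = (2 : ℚ_[2]) • j := by rw [← mul_assoc, hi]; simp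
  refine ⟨w • j + (w * 2⁻¹) • (i * j), i, 2, two_ne_zero, ?_, ?_, hi, ?_⟩
  · rw [← hw]
    simp only [mul_add, add_mul, smul_mul_assoc, mul_smul_comm, mul_assoc, hi, hj, h1, mul_neg, mul_one]
    module
  · simp only [mul_add, add_mul, smul_mul_assoc, mul_smul_comm, mul_assoc, hji, h3, mul_neg]
    module
  · rw [valuation_two]; exact odd_one

end RamifiedPair

namespace Cl

variable {K : Type*} [Field K] {a b c : K}

theorem j_mul_j : (mk 0 1 0 0 : Cl a b c) * mk 0 1 0 0 = a • 1 := by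
  ext <;> simp

theorem i_mul_i {δ ℓ : K} (hℓ : ℓ ≠ 0) (h : b ^ 2 - a * c = δ * ℓ ^ 2) :
    (ℓ⁻¹ • mk (-b) 0 0 1 : Cl a b c) * (ℓ⁻¹ • mk (-b) 0 0 1) = δ • 1 := by
  have hδ : δ = ℓ⁻¹ ^ 2 * (b ^ 2 - a * c) := by rw [h]; field_simp
  rw [hδ]
  ext <;> simp
  all_goals ring

theorem j_mul_i {ℓ : K} : (mk 0 1 0 0 : Cl a b c) * (ℓ⁻¹ • mk (-b) 0 0 1) =
    -((ℓ⁻¹ • mk (-b) 0 0 1) * mk 0 1 0 0) := by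
  rw [mul_smul_comm, smul_mul_assoc, ← smul_neg]
  congr 1
  ext <;> simp
  all_goals ring

end Cl

/-! ### Pairing with the Clifford algebra of a form on the surface -/

section Pairing

variable {F : MvPolynomial (Fin 3) ℤ}

/-- The class in `ℚ[U]` of a polynomial with integral coefficients. -/
def coordMk (F A : MvPolynomial (Fin 3) ℤ) : CoordRing F :=
  Ideal.Quotient.mk _ (MvPolynomial.map (Int.castRingHom ℚ) A)

theorem evalHom_coordMk {T : Type} [CommRing T] [Algebra ℚ T] (P : Points F T)
    (A : MvPolynomial (Fin 3) ℤ) :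
    (P.evalHom : CoordRing F →+* T) (coordMk F A) = MvPolynomial.aeval P.1 A := by
  change MvPolynomial.aeval P.1 (MvPolynomial.map (Int.castRingHom ℚ) A) = _
  rw [MvPolynomial.aeval_def, MvPolynomial.eval₂_map,
    RingHom.ext_int ((algebraMap ℚ T).comp (Int.castRingHom ℚ)) (algebraMap ℤ T),
    ← MvPolynomial.aeval_def]

theorem aeval_map_point {S T : Type} [CommRing S] [CommRing T] (f : S →+* T) (P : Points F S)
    (A : MvPolynomial (Fin 3) ℤ) :
    MvPolynomial.aeval (P.map f).1 A = f (MvPolynomial.aeval P.1 A) := by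
  change MvPolynomial.aeval (fun i => f (P.1 i)) A = _
  rw [MvPolynomial.map_aeval, MvPolynomial.aeval_def, ← MvPolynomial.coe_eval₂Hom,
    RingHom.ext_int (algebraMap ℤ T) (f.comp (algebraMap ℤ S))]

theorem disc_eq {A B C G : MvPolynomial (Fin 3) ℤ} {d : ℤ} (h : B ^ 2 - A * C = MvPolynomial.C d + G * F)
    {T : Type} [CommRing T] (P : Points F T) :
    MvPolynomial.aeval P.1 B ^ 2 - MvPolynomial.aeval P.1 A * MvPolynomial.aeval P.1 C = (d : T) := by
  have := congrArg (MvPolynomial.aeval P.1) h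
  simpa [P.2] using this

theorem isAzumaya_coord {A B C G : MvPolynomial (Fin 3) ℤ} {d : ℤ} (hd : d ≠ 0)
    (h : B ^ 2 - A * C = MvPolynomial.C d + G * F) :
    IsAzumaya (CoordRing F) (Cl (coordMk F A) (coordMk F B) (coordMk F C)) := by
  apply Cl.isAzumaya
  have h1 : coordMk F B ^ 2 - coordMk F A * coordMk F C = algebraMap ℚ (CoordRing F) d := by
    have h2 := congrArg (coordMk F) h
    simp only [coordMk, map_add, map_sub, map_mul, map_pow, MvPolynomial.map_C] at h2 ⊢
    have h3 : (Ideal.Quotient.mk (Ideal.span {MvPolynomial.map (Int.castRingHom ℚ) F}))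
        (MvPolynomial.map (Int.castRingHom ℚ) F) = 0 :=
      Ideal.Quotient.eq_zero_iff_mem.mpr (Ideal.mem_span_singleton_self _)
    rw [h2, h3, mul_zero, add_zero]
    rfl
  rw [h1]
  have : (2 : CoordRing F) * algebraMap ℚ (CoordRing F) d = algebraMap ℚ (CoordRing F) (2 * d) := by
    rw [map_mul, map_ofNat]
  rw [this]
  exact (IsUnit.mk0 _ (mul_ne_zero two_ne_zero (by exact_mod_cast hd))).map _

/-- The algebra `Cl A B C` with `B² - A C = δ ℓ²` on `U` obstructs an adelic point if it is
unramified at the point outside `2` and ramified at `2`. -/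
theorem notMem_brauerManinSet (P : AdelicPoints F) {A B C G : MvPolynomial (Fin 3) ℤ} {δ ℓ : ℤ}
    (hℓ : ℓ ≠ 0) (hδ : δ ∣ 2) (h : B ^ 2 - A * C = MvPolynomial.C (δ * ℓ ^ 2) + G * F)
    (hreal : 0 < MvPolynomial.aeval P.1.1 A)
    (hodd : ∀ p : Nat.Primes, (p : ℕ) ≠ 2 → PadicInt.toZMod (MvPolynomial.aeval (P.2 p).1 A) = 0 →
      IsSquare (δ : ZMod p))
    (htwo : HasRamifiedPair (Cl ((MvPolynomial.aeval (P.2 ⟨2, Nat.prime_two⟩).1 A : ℤ_[2]) : ℚ_[2])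
      ((MvPolynomial.aeval (P.2 ⟨2, Nat.prime_two⟩).1 B : ℤ_[2]) : ℚ_[2])
      ((MvPolynomial.aeval (P.2 ⟨2, Nat.prime_two⟩).1 C : ℤ_[2]) : ℚ_[2]))) :
    P ∉ brauerManinSet F := by
  intro hP
  have hδ0 : δ ≠ 0 := by rintro rfl; norm_num at hδ
  have hd0 : δ * ℓ ^ 2 ≠ 0 := mul_ne_zero hδ0 (pow_ne_zero 2 hℓ)
  have hpair := hP _ (isAzumaya_coord hd0 h)
  have hR : realInv (P.1.fibre (Cl (coordMk F A) (coordMk F B) (coordMk F C))) = 0 := by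
    apply realInv_eq_zero
    · rwa [evalHom_coordMk]
    · rw [evalHom_coordMk, evalHom_coordMk, evalHom_coordMk, disc_eq h]
      exact_mod_cast hd0
  have hp : ∀ p : Nat.Primes, Nonempty
      ((((P.2 p).map (algebraMap ℤ_[p] ℚ_[p])).fibre (Cl (coordMk F A) (coordMk F B) (coordMk F C)))
      ≃ₐ[ℚ_[p]] Cl ((MvPolynomial.aeval (P.2 p).1 A : ℤ_[p]) : ℚ_[p])
        ((MvPolynomial.aeval (P.2 p).1 B : ℤ_[p]) : ℚ_[p])
        ((MvPolynomial.aeval (P.2 p).1 C : ℤ_[p]) : ℚ_[p])) := by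
    intro p
    have e := Cl.baseChangeEquiv (((P.2 p).map (algebraMap ℤ_[p] ℚ_[p])).evalHom :
      CoordRing F →+* ℚ_[p]) (coordMk F A) (coordMk F B) (coordMk F C)
    rw [evalHom_coordMk, evalHom_coordMk, evalHom_coordMk, aeval_map_point, aeval_map_point,
      aeval_map_point] at e
    exact ⟨e⟩
  have h2 : padicInv ((⟨2, Nat.prime_two⟩ : Nat.Primes) : ℕ)
      (((P.2 ⟨2, Nat.prime_two⟩).map (algebraMap ℤ_[2] ℚ_[2])).fibre
      (Cl (coordMk F A) (coordMk F B) (coordMk F C))) = ((1 / 2 : ℚ) : AddCircle (1 : ℚ)) := by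
    obtain ⟨e⟩ := hp ⟨2, Nat.prime_two⟩
    obtain ⟨θ, γ, s, hs, hθ, hγθ, hγ, hodd⟩ := htwo
    obtain ⟨⟨U⟩, hex⟩ := exists_isPadicInv_two hs hθ hγθ hγ
    exact padicInv_eq e hex fun q hq => hq.eq_half U hodd
  have hne : ∀ p : Nat.Primes, p ≠ ⟨2, Nat.prime_two⟩ →
      padicInv p (((P.2 p).map (algebraMap ℤ_[p] ℚ_[p])).fibre
      (Cl (coordMk F A) (coordMk F B) (coordMk F C))) = 0 := by
    intro p hp2
    have hp2' : (p : ℕ) ≠ 2 := fun h => hp2 (Subtype.ext h)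
    obtain ⟨e⟩ := hp p
    refine padicInv_eq_zero e fun q hq => ?_
    refine IsPadicInv.eq_zero_of_odd hp2' (δ := (δ : ℤ_[p])) (ℓ := (ℓ : ℤ_[p]))
      (by exact_mod_cast hℓ) ?_ ?_ ?_ hq
    -- As `δ ∣ 2`, it is a unit at every odd prime.
    · rw [map_intCast]
      intro h0
      rw [ZMod.intCast_zmod_eq_zero_iff_dvd] at h0
      have : (p : ℕ) ∣ 2 := by exact_mod_cast h0.trans hδ
      exact hp2' ((Nat.prime_dvd_prime_iff_eq p.2 Nat.prime_two).mp this)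
    · rw [disc_eq h]; push_cast; ring
    · intro h0; rw [map_intCast]; exact hodd p hp2' h0
  -- Only the term at 2 survives, and `1/2` is not an integer.
  rw [pairing, hR, zero_add, finsum_eq_single _ _ hne, h2] at hpair
  rw [AddCircle.coe_eq_zero_iff] at hpair
  obtain ⟨n, hn⟩ := hpair
  have : (2 * n : ℚ) = 1 := by
    rw [zsmul_eq_mul, mul_one] at hn; rw [hn]; norm_num
  have : 2 * n = 1 := by exact_mod_cast this
  omega

end Pairing

end

/-! ### Local solubility -/

theorem isSquare_or_isSquare_neg {K : Type*} [Field K] [Fintype K] {a : K}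
    (h : ¬ IsSquare (-1 : K)) : IsSquare a ∨ IsSquare (-a) := by
  classical
  by_cases ha : a = 0
  · left; rw [ha]; exact IsSquare.zero
  by_contra! hc
  have h1 := quadraticChar_neg_one_iff_not_isSquare.mpr h
  have h2 := quadraticChar_neg_one_iff_not_isSquare.mpr hc.1
  have h3 := quadraticChar_neg_one_iff_not_isSquare.mpr hc.2
  rw [← neg_one_mul, map_mul, h1, h2] at h3
  norm_num at h3

/-- Every nonzero element of a prime field with at least five elements is a product of three
elements of the form `1 - s²`. -/
theorem exists_prod_one_sub_sq {p : ℕ} [Fact p.Prime] (hp : 5 ≤ p) {n : ZMod p} (hn : n ≠ 0) :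
    ∃ r s t : ZMod p, (1 - r ^ 2) * (1 - s ^ 2) * (1 - t ^ 2) = n := by
  classical
  open Polynomial in
  by_contra! hno
  have h2 : (2 : ZMod p) ≠ 0 := by
    intro h0
    have : ((2 : ℕ) : ZMod p) = 0 := by exact_mod_cast h0
    rw [ZMod.natCast_eq_zero_iff] at this
    have := Nat.le_of_dvd (by norm_num) this
    omega
  have h3 : (3 : ZMod p) ≠ 0 := by
    intro h0
    have : ((3 : ℕ) : ZMod p) = 0 := by exact_mod_cast h0
    rw [ZMod.natCast_eq_zero_iff] at this
    have := Nat.le_of_dvd (by norm_num) this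
    omega
  -- Let `S` be the set of nonzero values of `1 - s²`; it has at least `(p - 1)/2` elements and
  -- contains `1`. If `n` is no product of three of them, `S` and `n/S` are disjoint, hence
  -- partition the nonzero elements. Then `S` turns out to be a multiplicative group that is
  -- everything, a contradiction.
  set S : Finset (ZMod p) := (Finset.univ.image fun s : ZMod p => 1 - s ^ 2).erase 0 with hS
  have hmem : ∀ x, x ∈ S ↔ x ≠ 0 ∧ ∃ s, 1 - s ^ 2 = x := fun x => by simp [hS]
  have hcard : p ≤ 2 * S.card + 1 := by
    have hdeg : (1 - X ^ 2 : (ZMod p)[X]).natDegree = 2 := by compute_degree!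
    have h1 := FiniteField.card_image_polynomial_eval (p := (1 - X ^ 2 : (ZMod p)[X]))
      (natDegree_pos_iff_degree_pos.mp (by rw [hdeg]; norm_num))
    rw [hdeg, ZMod.card] at h1
    simp only [eval_sub, eval_one, eval_pow, eval_X] at h1
    have h4 := Finset.card_erase_add_one (s := Finset.univ.image fun s : ZMod p => 1 - s ^ 2)
      (a := 0) (Finset.mem_image.mpr ⟨1, Finset.mem_univ _, by norm_num⟩)
    have h5 := (Fact.out : p.Prime).odd_of_ne_two (by omega)
    obtain ⟨m, hm⟩ := h5
    rw [← hS] at h4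
    omega
  have hone : (1 : ZMod p) ∈ S := (hmem 1).mpr ⟨one_ne_zero, 0, by ring⟩
  have hprod : ∀ x ∈ S, ∀ y ∈ S, ∀ z ∈ S, x * y * z ≠ n := by
    intro x hx y hy z hz
    obtain ⟨-, r, rfl⟩ := (hmem x).mp hx
    obtain ⟨-, s, rfl⟩ := (hmem y).mp hy
    obtain ⟨-, t, rfl⟩ := (hmem z).mp hz
    exact hno r s t
  have hcompl : ∀ x, x ≠ 0 → x ∉ S → n / x ∈ S := by
    intro x hx hxS
    set T := S.image fun g => n / g
    have hT : T.card = S.card := Finset.card_image_of_injective _ fun g g' h => by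
      simpa [div_eq_mul_inv, hn] using h
    have hdisj : Disjoint S T := by
      rw [Finset.disjoint_right]
      intro y hy hyS
      obtain ⟨g, hg, rfl⟩ := Finset.mem_image.mp hy
      apply hprod _ hyS _ hg 1 hone
      have := ((hmem g).mp hg).1
      field_simp
    have hsub : S ∪ T ⊆ Finset.univ.erase 0 := by
      intro y hy
      rw [Finset.mem_erase]
      refine ⟨?_, Finset.mem_univ _⟩
      rcases Finset.mem_union.mp hy with h | h
      · exact ((hmem y).mp h).1
      · obtain ⟨g, hg, rfl⟩ := Finset.mem_image.mp h
        exact div_ne_zero hn ((hmem g).mp hg).1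
    have heq : S ∪ T = Finset.univ.erase 0 := by
      apply Finset.eq_of_subset_of_card_le hsub
      rw [Finset.card_union_of_disjoint hdisj, hT, Finset.card_erase_of_mem (Finset.mem_univ _),
        Finset.card_univ, ZMod.card]
      omega
    have hxT : x ∈ S ∪ T := by rw [heq]; simp [hx]
    obtain ⟨g, hg, rfl⟩ := Finset.mem_image.mp ((Finset.mem_union.mp hxT).resolve_left hxS)
    rwa [div_div_cancel₀ hn]
  -- If `xy ∉ S` then `n/(xy) ∈ S`, and `x · y · n/(xy) = n`.
  have hmul : ∀ x ∈ S, ∀ y ∈ S, x * y ∈ S := by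
    intro x hx y hy
    have hx0 := ((hmem x).mp hx).1
    have hy0 := ((hmem y).mp hy).1
    by_contra hxy
    have := hcompl _ (mul_ne_zero hx0 hy0) hxy
    exact hprod _ hx _ hy _ this (by field_simp)
  have hinv : ∀ x ∈ S, x⁻¹ ∈ S := by
    intro x hx
    have hx0 := ((hmem x).mp hx).1
    have hpow : ∀ k : ℕ, x ^ k ∈ S := fun k => by
      induction k with
      | zero => simpa using hone
      | succ k ih => rw [pow_succ]; exact hmul _ ih _ hx
    have : x⁻¹ = x ^ (p - 2) := by
      refine inv_eq_of_mul_eq_one_right ?_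
      rw [← pow_succ']
      have := ZMod.pow_card_sub_one_eq_one hx0
      rwa [show p - 2 + 1 = p - 1 by omega]
    rw [this]
    exact hpow _
  -- For `x ∉ S` both `n/x` and `n x` lie in `S`, and their quotient is `x²`.
  have hsq : ∀ x, x ≠ 0 → x ^ 2 ∈ S := by
    intro x hx
    by_cases hxS : x ∈ S
    · rw [pow_two]; exact hmul _ hxS _ hxS
    · have h1 := hcompl x hx hxS
      have h4 : x⁻¹ ∉ S := fun h => hxS (by simpa using hinv _ h)
      have h5 := hcompl _ (inv_ne_zero hx) h4
      have := hmul _ h5 _ (hinv _ h1)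
      have e : n / x⁻¹ * (n / x)⁻¹ = x ^ 2 := by field_simp
      rwa [e] at this
  have hm3 : (-3 : ZMod p) ∈ S := (hmem _).mpr ⟨neg_ne_zero.mpr h3, 2, by norm_num⟩
  have h34 : (1 - (2⁻¹) ^ 2 : ZMod p) ∈ S := (hmem _).mpr ⟨by
    have : (1 - (2⁻¹) ^ 2 : ZMod p) = 3 * (2⁻¹) ^ 2 := by
      field_simp; norm_num
    rw [this]; exact mul_ne_zero h3 (pow_ne_zero 2 (inv_ne_zero h2)), 2⁻¹, rfl⟩
  -- `-3 = 1 - 2²` and `3 = 2² (1 - 1/4)` are both in `S`.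
  have hm1 : (-1 : ZMod p) ∈ S := by
    have := hmul _ hm3 _ (hinv _ (hmul _ (hsq 2 h2) _ h34))
    have e : (-3 : ZMod p) * (2 ^ 2 * (1 - (2⁻¹) ^ 2))⁻¹ = -1 := by
      have : (2 ^ 2 * (1 - (2⁻¹) ^ 2) : ZMod p) = 3 := by field_simp; norm_num
      rw [this]; field_simp
    rwa [e] at this
  -- Since `(1 - s²) - 1 = -s²` with `-1` and squares in `S`, the set `S ∪ {0}` is stable under
  -- subtracting `1`, hence is the whole field.
  have hpred : ∀ x, (x ∈ S ∨ x = 0) → (x - 1 ∈ S ∨ x - 1 = 0) := by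
    rintro x (hx | rfl)
    · obtain ⟨-, s, rfl⟩ := (hmem x).mp hx
      by_cases hs : s = 0
      · right; rw [hs]; ring
      · left
        have := hmul _ hm1 _ (hsq s hs)
        convert this using 1; ring
    · left; simpa using hm1
  have hall : ∀ k : ℕ, (-(k : ZMod p)) ∈ S ∨ (-(k : ZMod p)) = 0 := by
    intro k
    induction k with
    | zero => right; simp
    | succ k ih =>
      have := hpred _ ih
      rwa [show (-(k : ZMod p)) - 1 = -((k + 1 : ℕ) : ZMod p) by push_cast; ring] at this
  have hnS : n ∈ S := by
    have := hall (-n).val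
    rw [ZMod.natCast_zmod_val, neg_neg] at this
    exact this.resolve_right hn
  exact hprod _ hnS _ hone _ hone (by ring)

theorem exists_mul_sq_eq {p : ℕ} [Fact p.Prime] (hp : p ≠ 2) {U V : ℤ_[p]}
    (hU : PadicInt.toZMod U ≠ 0) (hV : PadicInt.toZMod V ≠ 0)
    (h : ∃ x : ZMod p, x ^ 2 * PadicInt.toZMod U = PadicInt.toZMod V) :
    ∃ x : ℤ_[p], x ^ 2 * U = V := by
  obtain ⟨x, hx⟩ := h
  obtain ⟨W, hW⟩ := ((isUnit_iff_toZMod_ne_zero U).mpr hU).exists_right_inv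
  have hW' : PadicInt.toZMod U * PadicInt.toZMod W = 1 := by rw [← map_mul, hW, map_one]
  have e : PadicInt.toZMod (V * W) = x ^ 2 := by
    rw [map_mul, ← hx, mul_assoc, hW', mul_one]
  obtain ⟨v, hv⟩ := exists_sq_eq_of_toZMod hp (u := V * W)
    (by rw [map_mul]; exact mul_ne_zero hV (right_ne_zero_of_mul_eq_one hW'))
    ⟨x, by rw [e, pow_two]⟩
  exact ⟨v, by rw [hv]; linear_combination V * hW⟩

theorem exists_mul_sq_eq_two {U V t w : ℤ_[2]} (hU : U * w = 1) (h : U * V = 1 + 8 * t) :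
    ∃ x : ℤ_[2], x ^ 2 * U = V := by
  obtain ⟨v, hv⟩ := exists_sq_eq_of_two_adic h
  refine ⟨v * w, ?_⟩
  linear_combination w ^ 2 * U * hv + V * (w * U + 1) * hU

theorem exists_inv_of_odd (n : ℤ) (hn : Odd n) : ∃ w : ℤ_[2], (n : ℤ_[2]) * w = 1 := by
  have : IsUnit (n : ℤ_[2]) := by
    rw [isUnit_iff_toZMod_ne_zero, map_intCast, Ne, ZMod.intCast_zmod_eq_zero_iff_dvd]
    intro h
    exact Int.not_even_iff_odd.mpr hn (even_iff_two_dvd.mpr (by exact_mod_cast h))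
  exact this.exists_right_inv

/-- Every nonzero element of `ℤ/p`, and `0` if `-1` is a square, is a sum of two squares the first
of which is nonzero. -/
theorem exists_sq_add_sq {p : ℕ} [Fact p.Prime] {n : ZMod p} (h : n ≠ 0 ∨ IsSquare (-1 : ZMod p)) :
    ∃ x y : ZMod p, x ≠ 0 ∧ x ^ 2 + y ^ 2 = n := by
  by_cases hn : n = 0
  · obtain ⟨i, hi⟩ := h.resolve_left (not_not_intro hn)
    exact ⟨1, i, one_ne_zero, by rw [hn]; linear_combination -hi⟩
  · obtain ⟨x, y, hxy⟩ := ZMod.sq_add_sq p n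
    by_cases hx : x = 0
    · refine ⟨y, x, fun hy => hn ?_, by rw [← hxy]; ring⟩
      rw [← hxy, hx, hy]; ring
    · exact ⟨x, y, hx, hxy⟩

section

theorem aeval_F₁ {S : Type} [CommRing S] (k : ℤ) (v : Fin 3 → S) :
    MvPolynomial.aeval v (F₁ k) =
      v 0 ^ 2 + v 1 ^ 2 + v 2 ^ 2 - 4 * (v 0 ^ 2 * v 1 ^ 2 * v 2 ^ 2) - k := by
  simp [F₁, map_ofNat]

theorem aeval_F₂ {S : Type} [CommRing S] (k : ℤ) (v : Fin 3 → S) :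
    MvPolynomial.aeval v (F₂ k) =
      v 0 ^ 2 + v 1 ^ 2 + v 2 ^ 2
        - 4 * (v 0 ^ 2 * v 1 ^ 2 + v 1 ^ 2 * v 2 ^ 2 + v 2 ^ 2 * v 0 ^ 2)
        + 16 * (v 0 ^ 2 * v 1 ^ 2 * v 2 ^ 2) - k := by
  simp [F₂, map_ofNat]

theorem aeval_F₃ {S : Type} [CommRing S] (k : ℤ) (v : Fin 3 → S) :
    MvPolynomial.aeval v (F₃ k) =
      v 0 ^ 2 + v 1 ^ 2 + v 2 ^ 2
        + 4 * (v 0 ^ 2 * v 1 ^ 2 + v 1 ^ 2 * v 2 ^ 2 + v 2 ^ 2 * v 0 ^ 2)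
        - 16 * (v 0 ^ 2 * v 1 ^ 2 * v 2 ^ 2) - k := by
  simp [F₃, map_ofNat]

section

variable {S : Type} [CommRing S] {k : ℤ}

/-- The equation is linear in `x²`. All local points are found by fixing `y, z` and extracting a
square root, here and for the other two families. -/
theorem nonempty_points_F₁ {x y z : S} (h : x ^ 2 * (1 - 4 * (y ^ 2 * z ^ 2)) = k - y ^ 2 - z ^ 2) :
    Nonempty (Points (F₁ k) S) :=
  ⟨⟨![x, y, z], by rw [aeval_F₁]; simp; linear_combination h⟩⟩

theorem nonempty_points_F₂ {x y z : S}
    (h : x ^ 2 * ((1 - 4 * y ^ 2) * (1 - 4 * z ^ 2)) = k - y ^ 2 - z ^ 2 + 4 * (y ^ 2 * z ^ 2)) :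
    Nonempty (Points (F₂ k) S) :=
  ⟨⟨![x, y, z], by rw [aeval_F₂]; simp; linear_combination h⟩⟩

theorem nonempty_points_F₃ {x y z : S}
    (h : x ^ 2 * (1 + 4 * y ^ 2 + 4 * z ^ 2 - 16 * (y ^ 2 * z ^ 2)) =
      k - y ^ 2 - z ^ 2 - 4 * (y ^ 2 * z ^ 2)) :
    Nonempty (Points (F₃ k) S) :=
  ⟨⟨![x, y, z], by rw [aeval_F₃]; simp; linear_combination h⟩⟩

end

theorem nonempty_adelicPoints {F : MvPolynomial (Fin 3) ℤ} (hR : Nonempty (Points F ℝ))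
    (h2 : Nonempty (Points F ℤ_[2]))
    (hp : ∀ (p : ℕ) [Fact p.Prime], p ≠ 2 → Nonempty (Points F ℤ_[p])) :
    Nonempty (AdelicPoints F) := by
  have : ∀ p : Nat.Primes, Nonempty (Points F ℤ_[p]) := by
    rintro ⟨p, hpp⟩
    by_cases h : p = 2
    · subst h; exact h2
    · have := Fact.mk hpp
      exact hp p h
  obtain ⟨P⟩ := hR
  exact ⟨P, fun p => (this p).some⟩

section Real

variable {k : ℤ}

theorem nonempty_real_F₁ : Nonempty (Points (F₁ k) ℝ) := by
  rcases le_total 0 k with hk | hk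
  · have hk' : (0 : ℝ) ≤ k := by exact_mod_cast hk
    exact nonempty_points_F₁ (x := √k) (y := 0) (z := 0) (by rw [Real.sq_sqrt hk']; ring)
  · have hk' : (k : ℝ) ≤ 0 := by exact_mod_cast hk
    exact nonempty_points_F₁ (x := √((2 - k) / 3)) (y := 1) (z := 1)
      (by rw [Real.sq_sqrt (by linarith)]; ring)

theorem nonempty_real_F₂ (hk : k ≤ 1) : Nonempty (Points (F₂ k) ℝ) := by
  have hk' : (k : ℝ) ≤ 1 := by exact_mod_cast hk
  exact nonempty_points_F₂ (x := √((1 - k) / 3)) (y := 1) (z := 0)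
    (by rw [Real.sq_sqrt (by linarith)]; ring)

theorem nonempty_real_F₃ (hk : 0 ≤ k) : Nonempty (Points (F₃ k) ℝ) := by
  have hk' : (0 : ℝ) ≤ k := by exact_mod_cast hk
  exact nonempty_points_F₃ (x := √k) (y := 0) (z := 0) (by rw [Real.sq_sqrt hk']; ring)

end Real

section TwoAdic

variable {k : ℤ}

/-- The equation reads `x² U = V` with `U` a unit. In each residue class of `k`, here and in the
other families, `y, z` are chosen to give `U V ≡ 1 mod 8`, so that `V/U` is a 2-adic square. -/
theorem nonempty_two_F₁ (hk : k % 4 = 1) : Nonempty (Points (F₁ k) ℤ_[2]) := by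
  rcases (by omega : k % 8 = 1 ∨ k % 8 = 5) with h | h
  · obtain ⟨t, ht⟩ : ∃ t, k = 1 + 8 * t := ⟨k / 8, by omega⟩
    obtain ⟨x, hx⟩ := exists_mul_sq_eq_two (U := 1) (V := (k : ℤ_[2])) (w := 1) (t := (t : ℤ_[2]))
      (by ring) (by rw [ht]; push_cast; ring)
    exact nonempty_points_F₁ (x := x) (y := 0) (z := 0) (by linear_combination hx)
  · obtain ⟨t, ht⟩ : ∃ t, k = 5 + 8 * t := ⟨k / 8, by omega⟩
    obtain ⟨x, hx⟩ := exists_mul_sq_eq_two (U := 1) (V := (k : ℤ_[2]) - 4) (w := 1)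
      (t := (t : ℤ_[2])) (by ring) (by rw [ht]; push_cast; ring)
    exact nonempty_points_F₁ (x := x) (y := 2) (z := 0) (by linear_combination hx)

theorem nonempty_two_F₂ (hk : k % 8 = 7) : Nonempty (Points (F₂ k) ℤ_[2]) := by
  obtain ⟨t, ht⟩ : ∃ t, k = 7 + 8 * t := ⟨k / 8, by omega⟩
  obtain ⟨w, hw⟩ := exists_inv_of_odd 9 (by decide)
  obtain ⟨x, hx⟩ := exists_mul_sq_eq_two (U := 9) (V := (k : ℤ_[2]) + 2) (w := w)
    (t := 10 + 9 * (t : ℤ_[2])) (by exact_mod_cast hw) (by rw [ht]; push_cast; ring)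
  exact nonempty_points_F₂ (x := x) (y := 1) (z := 1) (by linear_combination hx)

theorem nonempty_two_F₃ (hk : k % 8 = 1 ∨ k % 4 = 2) : Nonempty (Points (F₃ k) ℤ_[2]) := by
  rcases (by omega : k % 8 = 1 ∨ k % 8 = 6 ∨ k % 8 = 2) with h | h | h
  · obtain ⟨t, ht⟩ : ∃ t, k = 1 + 8 * t := ⟨k / 8, by omega⟩
    obtain ⟨x, hx⟩ := exists_mul_sq_eq_two (U := 1) (V := (k : ℤ_[2])) (w := 1) (t := (t : ℤ_[2]))
      (by ring) (by rw [ht]; push_cast; ring)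
    exact nonempty_points_F₃ (x := x) (y := 0) (z := 0) (by linear_combination hx)
  · obtain ⟨t, ht⟩ : ∃ t, k = 6 + 8 * t := ⟨k / 8, by omega⟩
    obtain ⟨w, hw⟩ := exists_inv_of_odd 5 (by decide)
    obtain ⟨x, hx⟩ := exists_mul_sq_eq_two (U := 5) (V := (k : ℤ_[2]) - 1) (w := w)
      (t := 3 + 5 * (t : ℤ_[2])) (by exact_mod_cast hw) (by rw [ht]; push_cast; ring)
    exact nonempty_points_F₃ (x := x) (y := 1) (z := 0) (by linear_combination hx)
  · obtain ⟨t, ht⟩ : ∃ t, k = 2 + 8 * t := ⟨k / 8, by omega⟩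
    obtain ⟨w, hw⟩ := exists_inv_of_odd (-43) (by decide)
    obtain ⟨x, hx⟩ := exists_mul_sq_eq_two (U := -43) (V := (k : ℤ_[2]) - 21) (w := w)
      (t := 102 - 43 * (t : ℤ_[2])) (by exact_mod_cast hw) (by rw [ht]; push_cast; ring)
    exact nonempty_points_F₃ (x := x) (y := 1) (z := 2) (by linear_combination hx)

end TwoAdic

section Odd

variable {p : ℕ} [Fact p.Prime] {k : ℤ}

theorem ofNat_ne_zero_of_prime (hp : p ≠ 2) : (2 : ZMod p) ≠ 0 := by
  intro h0
  have : ((2 : ℕ) : ZMod p) = 0 := by exact_mod_cast h0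
  rw [ZMod.natCast_eq_zero_iff] at this
  exact hp ((Nat.prime_dvd_prime_iff_eq Fact.out Nat.prime_two).mp this)

theorem three_ne_zero_of_prime (hp : p ≠ 3) : (3 : ZMod p) ≠ 0 := by
  intro h0
  have : ((3 : ℕ) : ZMod p) = 0 := by exact_mod_cast h0
  rw [ZMod.natCast_eq_zero_iff] at this
  exact hp ((Nat.prime_dvd_prime_iff_eq Fact.out Nat.prime_three).mp this)

theorem five_ne_zero_of_prime (hp : p ≠ 5) : (5 : ZMod p) ≠ 0 := by
  intro h0
  have : ((5 : ℕ) : ZMod p) = 0 := by exact_mod_cast h0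
  rw [ZMod.natCast_eq_zero_iff] at this
  exact hp ((Nat.prime_dvd_prime_iff_eq Fact.out Nat.prime_five).mp this)

/-- With `x` and the coefficient of `x²` nonzero modulo `p`, the residue point lifts by Hensel's
lemma in `x` for arbitrary lifts of `y, z`. -/
theorem nonempty_odd_F₁_of_residue (hp : p ≠ 2) {x y z : ZMod p}
    (hU : 1 - 4 * (y ^ 2 * z ^ 2) ≠ 0) (hx : x ≠ 0)
    (h : x ^ 2 * (1 - 4 * (y ^ 2 * z ^ 2)) = k - y ^ 2 - z ^ 2) :
    Nonempty (Points (F₁ k) ℤ_[p]) := by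
  obtain ⟨y, rfl⟩ := toZMod_surjective y
  obtain ⟨z, rfl⟩ := toZMod_surjective z
  have e1 : PadicInt.toZMod (1 - 4 * (y ^ 2 * z ^ 2)) =
      1 - 4 * (PadicInt.toZMod y ^ 2 * PadicInt.toZMod z ^ 2) := by simp [map_ofNat]
  have e2 : PadicInt.toZMod ((k : ℤ_[p]) - y ^ 2 - z ^ 2) =
      (k : ZMod p) - PadicInt.toZMod y ^ 2 - PadicInt.toZMod z ^ 2 := by simp
  obtain ⟨v, hv⟩ := exists_mul_sq_eq hp (by rwa [e1])
    (by rw [e2, ← h]; exact mul_ne_zero (pow_ne_zero 2 hx) hU) ⟨x, by rw [e1, e2, h]⟩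
  exact nonempty_points_F₁ hv

theorem nonempty_odd_F₂_of_residue (hp : p ≠ 2) {x y z : ZMod p}
    (hU : (1 - 4 * y ^ 2) * (1 - 4 * z ^ 2) ≠ 0) (hx : x ≠ 0)
    (h : x ^ 2 * ((1 - 4 * y ^ 2) * (1 - 4 * z ^ 2)) = k - y ^ 2 - z ^ 2 + 4 * (y ^ 2 * z ^ 2)) :
    Nonempty (Points (F₂ k) ℤ_[p]) := by
  obtain ⟨y, rfl⟩ := toZMod_surjective y
  obtain ⟨z, rfl⟩ := toZMod_surjective z
  have e1 : PadicInt.toZMod ((1 - 4 * y ^ 2) * (1 - 4 * z ^ 2)) =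
      (1 - 4 * PadicInt.toZMod y ^ 2) * (1 - 4 * PadicInt.toZMod z ^ 2) := by simp [map_ofNat]
  have e2 : PadicInt.toZMod ((k : ℤ_[p]) - y ^ 2 - z ^ 2 + 4 * (y ^ 2 * z ^ 2)) =
      (k : ZMod p) - PadicInt.toZMod y ^ 2 - PadicInt.toZMod z ^ 2
        + 4 * (PadicInt.toZMod y ^ 2 * PadicInt.toZMod z ^ 2) := by simp [map_ofNat]
  obtain ⟨v, hv⟩ := exists_mul_sq_eq hp (by rwa [e1])
    (by rw [e2, ← h]; exact mul_ne_zero (pow_ne_zero 2 hx) hU) ⟨x, by rw [e1, e2, h]⟩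
  exact nonempty_points_F₂ hv

theorem nonempty_odd_F₃_of_residue (hp : p ≠ 2) {x y z : ZMod p}
    (hU : 1 + 4 * y ^ 2 + 4 * z ^ 2 - 16 * (y ^ 2 * z ^ 2) ≠ 0) (hx : x ≠ 0)
    (h : x ^ 2 * (1 + 4 * y ^ 2 + 4 * z ^ 2 - 16 * (y ^ 2 * z ^ 2)) =
      k - y ^ 2 - z ^ 2 - 4 * (y ^ 2 * z ^ 2)) :
    Nonempty (Points (F₃ k) ℤ_[p]) := by
  obtain ⟨y, rfl⟩ := toZMod_surjective y
  obtain ⟨z, rfl⟩ := toZMod_surjective z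
  have e1 : PadicInt.toZMod (1 + 4 * y ^ 2 + 4 * z ^ 2 - 16 * (y ^ 2 * z ^ 2)) =
      1 + 4 * PadicInt.toZMod y ^ 2 + 4 * PadicInt.toZMod z ^ 2
        - 16 * (PadicInt.toZMod y ^ 2 * PadicInt.toZMod z ^ 2) := by simp [map_ofNat]
  have e2 : PadicInt.toZMod ((k : ℤ_[p]) - y ^ 2 - z ^ 2 - 4 * (y ^ 2 * z ^ 2)) =
      (k : ZMod p) - PadicInt.toZMod y ^ 2 - PadicInt.toZMod z ^ 2
        - 4 * (PadicInt.toZMod y ^ 2 * PadicInt.toZMod z ^ 2) := by simp [map_ofNat]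
  obtain ⟨v, hv⟩ := exists_mul_sq_eq hp (by rwa [e1])
    (by rw [e2, ← h]; exact mul_ne_zero (pow_ne_zero 2 hx) hU) ⟨x, by rw [e1, e2, h]⟩
  exact nonempty_points_F₃ hv

/-- With `z = 0` the equation is `x² + y² = k`. This fails only if `p ∣ k` and `-1` is not a square;
then `y = z = 1` asks for `x² = 2/3` and `y = z = 1/2` for `x² = -2/3`, one of which is a square.
The condition on `k` modulo 3 excludes `p = 3` here. -/
theorem nonempty_odd_F₁ (hp : p ≠ 2) (hk : k % 3 ≠ 0) : Nonempty (Points (F₁ k) ℤ_[p]) := by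
  have h2 := ofNat_ne_zero_of_prime hp
  by_cases h : (k : ZMod p) ≠ 0 ∨ IsSquare (-1 : ZMod p)
  · obtain ⟨x, y, hx, hxy⟩ := exists_sq_add_sq h
    exact nonempty_odd_F₁_of_residue hp (x := x) (y := y) (z := 0) (by norm_num) hx
      (by linear_combination hxy)
  · push Not at h
    obtain ⟨hk0, hm1⟩ := h
    have h3 : (3 : ZMod p) ≠ 0 := by
      apply three_ne_zero_of_prime
      rintro rfl
      rw [ZMod.intCast_zmod_eq_zero_iff_dvd] at hk0
      omega
    rcases isSquare_or_isSquare_neg (a := (2 / 3 : ZMod p)) hm1 with ⟨x, hx⟩ | ⟨x, hx⟩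
    · have hx0 : x ≠ 0 := by rintro rfl; simp [h2, h3] at hx
      refine nonempty_odd_F₁_of_residue hp (x := x) (y := 1) (z := 1) (fun h0 => h3 ?_) hx0 ?_
      · linear_combination -h0
      · field_simp at hx
        rw [hk0]; linear_combination hx
    · have hx0 : x ≠ 0 := by rintro rfl; simp [h2, h3] at hx
      refine nonempty_odd_F₁_of_residue hp (x := x) (y := 2⁻¹) (z := 2⁻¹) (fun h0 => h3 ?_) hx0 ?_
      · field_simp at h0
        have h4 : (2 : ZMod p) ^ 2 * 3 = 0 := by linear_combination h0
        exact (mul_eq_zero.mp h4).resolve_left (pow_ne_zero 2 h2)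
      · field_simp at hx
        rw [hk0]; field_simp; linear_combination -4 * hx

/-- At `y = 1/2` the coefficient of `x²` becomes the constant `2`, leaving `x² + z² = (4k - 1)/8`.
If `4k = 1`, the point `(1/2, 0, 0)` serves. -/
theorem nonempty_odd_F₃ (hp : p ≠ 2) : Nonempty (Points (F₃ k) ℤ_[p]) := by
  have h2 := ofNat_ne_zero_of_prime hp
  by_cases h : 4 * (k : ZMod p) = 1
  · refine nonempty_odd_F₃_of_residue hp (x := 2⁻¹) (y := 0) (z := 0) (by norm_num)
      (inv_ne_zero h2) ?_
    field_simp; linear_combination -h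
  · obtain ⟨x, z, hx, hxz⟩ := exists_sq_add_sq (p := p) (n := (4 * k - 1) / 2 ^ 3)
      (Or.inl (div_ne_zero (sub_ne_zero.mpr h) (pow_ne_zero 3 h2)))
    have hU : 1 + 4 * (2⁻¹ : ZMod p) ^ 2 + 4 * z ^ 2 - 16 * ((2⁻¹) ^ 2 * z ^ 2) = 2 := by
      field_simp; ring
    refine nonempty_odd_F₃_of_residue hp (x := x) (y := 2⁻¹) (z := z) (by rwa [hU]) hx ?_
    rw [hU]
    field_simp at hxz ⊢
    linear_combination hxz

/-- The equation factors as `(1 - 4x²)(1 - 4y²)(1 - 4z²) = 1 - 4k`, so `exists_prod_one_sub_sq`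
applies for general `p`. The primes 3 and 5 are settled by the congruences on `k`: `9 ∣ k` allows
all coordinates to be divided by 3, and `k ≡ 2²` modulo 5. -/
theorem nonempty_odd_F₂ (hp : p ≠ 2) (hk3 : k % 9 = 0) (hk5 : k % 5 = 4) :
    Nonempty (Points (F₂ k) ℤ_[p]) := by
  have h2 := ofNat_ne_zero_of_prime hp
  by_cases hp3 : p = 3
  · subst hp3
    obtain ⟨κ, rfl⟩ : ∃ κ, k = 9 * κ := ⟨k / 9, by omega⟩
    obtain ⟨y, z, hyz⟩ : ∃ y z : ℤ, (κ - y ^ 2 - z ^ 2) % 3 = 1 := by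
      rcases (by omega : κ % 3 = 0 ∨ κ % 3 = 1 ∨ κ % 3 = 2) with h | h | h
      · exact ⟨1, 1, by omega⟩
      · exact ⟨0, 0, by omega⟩
      · exact ⟨1, 0, by omega⟩
    have hz3 : (3 : ZMod 3) = 0 := rfl
    have e1 : PadicInt.toZMod ((1 - 36 * (y : ℤ_[3]) ^ 2) * (1 - 36 * (z : ℤ_[3]) ^ 2)) = 1 := by
      simp only [map_mul, map_sub, map_one, map_pow, map_intCast, map_ofNat]
      linear_combination (12 * (36 * (y : ZMod 3) ^ 2 * z ^ 2 - y ^ 2 - z ^ 2)) * hz3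
    have e2 : PadicInt.toZMod ((κ : ℤ_[3]) - (y : ℤ_[3]) ^ 2 - (z : ℤ_[3]) ^ 2
        + 36 * ((y : ℤ_[3]) ^ 2 * (z : ℤ_[3]) ^ 2)) = 1 := by
      obtain ⟨m, hm⟩ : ∃ m, κ - y ^ 2 - z ^ 2 = 1 + 3 * m := ⟨(κ - y ^ 2 - z ^ 2) / 3, by omega⟩
      have hm' : (κ : ZMod 3) - y ^ 2 - z ^ 2 = 1 + 3 * m := by exact_mod_cast congrArg _ hm
      simp only [map_mul, map_add, map_sub, map_pow, map_intCast, map_ofNat]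
      linear_combination hm' + (m + 12 * ((y : ZMod 3) ^ 2 * z ^ 2)) * hz3
    obtain ⟨x, hx⟩ := exists_mul_sq_eq hp (by rw [e1]; exact one_ne_zero)
      (by rw [e2]; exact one_ne_zero) ⟨1, by rw [e1, e2]; ring⟩
    exact nonempty_points_F₂ (x := 3 * x) (y := 3 * y) (z := 3 * z)
      (by push_cast; linear_combination 9 * hx)
  by_cases hp5 : p = 5
  · subst hp5
    obtain ⟨m, hm⟩ : ∃ m, k = 4 + 5 * m := ⟨k / 5, by omega⟩
    refine nonempty_odd_F₂_of_residue hp (x := 2) (y := 0) (z := 0) (by norm_num) h2 ?_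
    have hz5 : (5 : ZMod 5) = 0 := rfl
    rw [hm]; push_cast
    linear_combination -(m : ZMod 5) * hz5
  have h3 := three_ne_zero_of_prime hp3
  have h5 := five_ne_zero_of_prime hp5
  by_cases hk0 : (k : ZMod p) = 0
  -- The two nontrivial factors are `-9/16` and `-16/9`, with product `1`.
  · refine nonempty_odd_F₂_of_residue hp (x := 5 / 2 ^ 3) (y := 5 / (2 * 3)) (z := 0) ?_
      (div_ne_zero h5 (pow_ne_zero 3 h2)) ?_
    · have : (1 - 4 * (5 / (2 * 3)) ^ 2) * (1 - 4 * 0 ^ 2) = -(2 ^ 4 / 3 ^ 2 : ZMod p) := by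
        field_simp; ring
      rw [this]
      exact neg_ne_zero.mpr (div_ne_zero (pow_ne_zero _ h2) (pow_ne_zero _ h3))
    · rw [hk0]; field_simp; ring
  by_cases hk1 : 4 * (k : ZMod p) = 1
  · refine nonempty_odd_F₂_of_residue hp (x := 2⁻¹) (y := 0) (z := 0) (by norm_num)
      (inv_ne_zero h2) ?_
    field_simp; linear_combination -hk1
  have hp5' : 5 ≤ p := by
    have := (Fact.out : p.Prime).two_le
    by_contra! hlt
    interval_cases p
    · exact hp rfl
    · exact hp3 rfl
    · exact absurd (Fact.out : Nat.Prime 4) (by norm_num)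
  have hn : 1 - 4 * (k : ZMod p) ≠ 0 := fun h0 => hk1 (by linear_combination -h0)
  obtain ⟨r, s, t, hrst⟩ := exists_prod_one_sub_sq hp5' hn
  have key : ∀ r s t : ZMod p, r ≠ 0 → (1 - r ^ 2) * (1 - s ^ 2) * (1 - t ^ 2) = 1 - 4 * k →
      Nonempty (Points (F₂ k) ℤ_[p]) := by
    intro r s t hr h
    have e : (1 - 4 * (s / 2) ^ 2) * (1 - 4 * (t / 2) ^ 2) = (1 - s ^ 2) * (1 - t ^ 2) := by
      field_simp; ring
    refine nonempty_odd_F₂_of_residue hp (x := r / 2) (y := s / 2) (z := t / 2) ?_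
      (div_ne_zero hr h2) ?_
    · rw [e]
      intro h0
      apply hn
      rw [← h, mul_assoc, h0, mul_zero]
    · field_simp
      linear_combination -16 * h
  by_cases hr : r = 0
  · by_cases hs : s = 0
    · by_cases ht : t = 0
      · exfalso
        rw [hr, hs, ht] at hrst
        have : 2 * (2 * (k : ZMod p)) = 0 := by linear_combination hrst
        exact hk0 ((mul_eq_zero.mp ((mul_eq_zero.mp this).resolve_left h2)).resolve_left h2)
      · exact key t r s ht (by rw [← hrst]; ring)
    · exact key s r t hs (by rw [← hrst]; ring)
  · exact key r s t hr hrst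

end Odd

theorem soluble_F₁ {k : ℤ} (h4 : k % 4 = 1) (h3 : k % 3 ≠ 0) : Nonempty (AdelicPoints (F₁ k)) :=
  nonempty_adelicPoints nonempty_real_F₁ (nonempty_two_F₁ h4) fun _ _ hp => nonempty_odd_F₁ hp h3

theorem soluble_F₂ {k : ℤ} (h1 : k ≤ 1) (h8 : k % 8 = 7) (h9 : k % 9 = 0) (h5 : k % 5 = 4) :
    Nonempty (AdelicPoints (F₂ k)) :=
  nonempty_adelicPoints (nonempty_real_F₂ h1) (nonempty_two_F₂ h8)
    fun _ _ hp => nonempty_odd_F₂ hp h9 h5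

theorem soluble_F₃ {k : ℤ} (h0 : 0 ≤ k) (h : k % 8 = 1 ∨ k % 4 = 2) :
    Nonempty (AdelicPoints (F₃ k)) :=
  nonempty_adelicPoints (nonempty_real_F₃ h0) (nonempty_two_F₃ h) fun _ _ hp => nonempty_odd_F₃ hp

end

/-! ### The obstruction in the three families -/

section

section TwoAdic

theorem one_add_two_mul_ne_zero (t : ℤ_[2]) : 1 + 2 * t ≠ 0 := by
  intro h
  have := congrArg (PadicInt.toZMod (p := 2)) h
  have h2 : (2 : ZMod 2) = 0 := rfl
  simp [map_ofNat, h2] at this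

theorem exists_eq_two_mul {x : ℤ_[2]} (hx : PadicInt.toZMod x = 0) : ∃ t, x = 2 * t := by
  have : x ∈ RingHom.ker (PadicInt.toZMod (p := 2)) := hx
  rw [PadicInt.ker_toZMod, PadicInt.maximalIdeal_eq_span_p, Ideal.mem_span_singleton'] at this
  obtain ⟨t, ht⟩ := this
  exact ⟨t, by rw [← ht]; push_cast; ring⟩

theorem exists_eq_one_add_two_mul {x : ℤ_[2]} (hx : PadicInt.toZMod x ≠ 0) :
    ∃ t, x = 1 + 2 * t := by
  have h : PadicInt.toZMod (x - 1) = 0 := by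
    rw [map_sub, map_one]
    generalize PadicInt.toZMod x = y at hx
    revert y; decide
  obtain ⟨t, ht⟩ := exists_eq_two_mul h
  exact ⟨t, by linear_combination ht⟩

theorem one_add_eight_mul_ne_zero (t : ℤ_[2]) : 1 + 8 * t ≠ 0 := by
  have := one_add_two_mul_ne_zero (4 * t)
  rwa [show (1 : ℤ_[2]) + 2 * (4 * t) = 1 + 8 * t by ring] at this

end TwoAdic

theorem toZMod_aeval_sq {F A B C G : MvPolynomial (Fin 3) ℤ} {d : ℤ}
    (h : B ^ 2 - A * C = MvPolynomial.C d + G * F) {p : ℕ} [Fact p.Prime] (R : Points F ℤ_[p])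
    (hA : PadicInt.toZMod (MvPolynomial.aeval R.1 A) = 0) :
    PadicInt.toZMod (MvPolynomial.aeval R.1 B) ^ 2 = (d : ZMod p) := by
  have := congrArg PadicInt.toZMod (disc_eq h R)
  rwa [map_sub, map_mul, hA, zero_mul, sub_zero, map_intCast, map_pow] at this

theorem notMem_brauerManinSet_of_two_adic {F : MvPolynomial (Fin 3) ℤ} (P : AdelicPoints F)
    {Q : Points F ℤ_[2]} (hQ : P.2 ⟨2, Nat.prime_two⟩ = Q) {A B C G : MvPolynomial (Fin 3) ℤ}
    {δ ℓ : ℤ} (hℓ : ℓ ≠ 0) (hδ : δ ∣ 2)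
    (h : B ^ 2 - A * C = MvPolynomial.C (δ * ℓ ^ 2) + G * F)
    (hreal : 0 < MvPolynomial.aeval P.1.1 A)
    (hodd : ∀ (p : ℕ) [Fact p.Prime] (R : Points F ℤ_[p]), p ≠ 2 →
      PadicInt.toZMod (MvPolynomial.aeval R.1 A) = 0 → IsSquare (δ : ZMod p))
    (htwo : HasRamifiedPair (Cl ((MvPolynomial.aeval Q.1 A : ℤ_[2]) : ℚ_[2])
      ((MvPolynomial.aeval Q.1 B : ℤ_[2]) : ℚ_[2]) ((MvPolynomial.aeval Q.1 C : ℤ_[2]) : ℚ_[2]))) :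
    P ∉ brauerManinSet F :=
  notMem_brauerManinSet P hℓ hδ h hreal (fun p hp hA => hodd p (P.2 p) hp hA)
    (by subst hQ; exact htwo)

section FirstFamily

variable {k ℓ : ℤ} {i j l : Fin 3}

-- The algebra is `(4x²y² - 1, -2)` with `x` the even coordinate; `hF` allows any permutation. Over
-- `ℝ`, `x² + y² + z²(1 - 4x²y²) = k < 0` forces `4x²y² > 1`. At 2, `4x²y² - 1 ≡ -1 mod 8` is minus
-- a square.
open MvPolynomial in
theorem notMem_brauerManinSet_F₁ (hk : k = -1 - 2 * ℓ ^ 2) (hℓ : ℓ ≠ 0)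
    (hF : F₁ k = X i ^ 2 + X j ^ 2 + X l ^ 2 - 4 * (X i ^ 2 * X j ^ 2 * X l ^ 2) - C k)
    (P : AdelicPoints (F₁ k)) {Q : Points (F₁ k) ℤ_[2]}
    (hQ : P.2 ⟨2, Nat.prime_two⟩ = Q) (hP : PadicInt.toZMod (Q.1 i) = 0) :
    P ∉ brauerManinSet (F₁ k) := by
  have hdisc : (2 * X i * X j ^ 2 + X i) ^ 2 -
      (4 * X i ^ 2 * X j ^ 2 - 1) * (X j ^ 2 + X l ^ 2 + 1) = C (-2 * ℓ ^ 2) + 1 * F₁ k := by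
    rw [hF, hk]; simp only [map_sub, map_mul, map_neg, map_one, map_pow, map_ofNat]; ring
  refine notMem_brauerManinSet_of_two_adic P hQ hℓ (by norm_num) hdisc ?_ ?_ ?_
  · have h := congrArg (aeval P.1.1) hF
    rw [P.1.2] at h
    simp only [map_sub, map_mul, map_add, map_one, map_pow, map_ofNat, aeval_X, aeval_C] at h ⊢
    have hk' : ((algebraMap ℤ ℝ) k) < 0 := by
      rw [eq_intCast]; exact_mod_cast (by rw [hk]; nlinarith [sq_nonneg ℓ] : k < 0)
    by_contra! hle
    nlinarith [sq_nonneg (P.1.1 i), sq_nonneg (P.1.1 j),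
      mul_nonneg (sq_nonneg (P.1.1 l)) (sub_nonneg.mpr hle)]
  · intro p _ R hp hA
    have h := toZMod_aeval_sq hdisc R hA
    simp only [map_sub, map_mul, map_add, map_one, map_pow, map_ofNat, aeval_X] at h hA
    push_cast at h ⊢
    set x := PadicInt.toZMod (R.1 i)
    set y := PadicInt.toZMod (R.1 j)
    -- If `p ∣ ℓ`, then `B = x(2y² + 1)` vanishes while `x` does not, so `-2 = (2y)²`. Otherwise `-2
    -- = (B/ℓ)²`.
    by_cases hl : (ℓ : ZMod p) = 0
    · rw [hl] at h
      have hx : x ≠ 0 := by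
        intro hx; rw [hx] at hA
        apply one_ne_zero (α := ZMod p); linear_combination -hA
      have h1 : x * (2 * y ^ 2 + 1) = 0 := pow_eq_zero_iff two_ne_zero |>.mp
        (by linear_combination h)
      exact ⟨2 * y, by linear_combination -2 * (mul_eq_zero.mp h1).resolve_left hx⟩
    · exact ⟨x * (2 * y ^ 2 + 1) / ℓ, by field_simp; linear_combination -h⟩
  · obtain ⟨t, ht⟩ := exists_eq_two_mul hP
    have hA : -(aeval Q.1 (4 * X i ^ 2 * X j ^ 2 - 1 : MvPolynomial _ ℤ)) =
        1 + 8 * (-2 * t ^ 2 * Q.1 j ^ 2) := by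
      simp only [map_sub, map_mul, map_one, map_pow, map_ofNat, aeval_X]
      rw [ht]; ring
    obtain ⟨u, hu⟩ := exists_sq_eq_of_two_adic hA
    have hne := one_add_eight_mul_ne_zero (-2 * t ^ 2 * Q.1 j ^ 2)
    rw [← hA, neg_ne_zero] at hne
    refine HasRamifiedPair.of_neg_two (u := (u : ℚ_[2])) ?_
      (Cl.i_mul_i (δ := -2) (ℓ := (ℓ : ℚ_[2])) (by exact_mod_cast hℓ) ?_) Cl.j_mul_j
      Cl.j_mul_i (by exact_mod_cast congrArg ((↑) : ℤ_[2] → ℚ_[2]) hu)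
    · exact fun h => hne (Subtype.ext h)
    · exact_mod_cast congrArg ((↑) : ℤ_[2] → ℚ_[2]) (disc_eq hdisc Q)

/-- Some coordinate is even at 2: with all three odd the left side is `3` modulo 4, whereas `k ≡ 1`.
-/
theorem brauerManinSet_F₁_eq_empty (hk : k = -1 - 2 * ℓ ^ 2) (hℓ : Odd ℓ) :
    brauerManinSet (F₁ k) = ∅ := by
  refine Set.eq_empty_of_forall_notMem fun P => ?_
  obtain ⟨Q, hQ⟩ : ∃ Q : Points (F₁ k) ℤ_[2], P.2 ⟨2, Nat.prime_two⟩ = Q := ⟨_, rfl⟩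
  have hℓ0 : ℓ ≠ 0 := by rintro rfl; simp at hℓ
  by_cases h0 : PadicInt.toZMod (Q.1 0) = 0
  · exact notMem_brauerManinSet_F₁ (i := 0) (j := 1) (l := 2) hk hℓ0 (by simp only [F₁]) P hQ h0
  by_cases h1 : PadicInt.toZMod (Q.1 1) = 0
  · exact notMem_brauerManinSet_F₁ (i := 1) (j := 2) (l := 0) hk hℓ0 (by simp only [F₁]; ring) P hQ h1
  by_cases h2 : PadicInt.toZMod (Q.1 2) = 0
  · exact notMem_brauerManinSet_F₁ (i := 2) (j := 0) (l := 1) hk hℓ0 (by simp only [F₁]; ring) P hQ h2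
  exfalso
  obtain ⟨x, hx⟩ := exists_eq_one_add_two_mul h0
  obtain ⟨y, hy⟩ := exists_eq_one_add_two_mul h1
  obtain ⟨z, hz⟩ := exists_eq_one_add_two_mul h2
  have h := Q.2
  rw [aeval_F₁, hx, hy, hz, congrArg (Int.cast : ℤ → ℤ_[2]) hk] at h
  obtain ⟨m, rfl⟩ := hℓ
  push_cast at h
  refine one_add_two_mul_ne_zero (1 + (x + x ^ 2 + y + y ^ 2 + z + z ^ 2)
    - (1 + 2 * x) ^ 2 * (1 + 2 * y) ^ 2 * (1 + 2 * z) ^ 2 + 2 * (m ^ 2 + m))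
    (mul_left_cancel₀ (two_ne_zero (α := ℤ_[2])) ?_)
  linear_combination h

end FirstFamily

section SecondFamily

variable {k n : ℤ} {i j l : Fin 3}

-- The algebra is `(4x² - 1, -1)`, where `x` is a coordinate with `4x² > 1` at the real place. At an
-- odd prime dividing `A`, `(2n)² ≡ -1`. At 2, `1 - 4x²` is `1` or `5` modulo 8, hence a sum of two
-- squares.
open MvPolynomial in
theorem notMem_brauerManinSet_F₂ (hk : k = -n ^ 2)
    (hF : F₂ k = X i ^ 2 + X j ^ 2 + X l ^ 2
      - 4 * (X i ^ 2 * X j ^ 2 + X j ^ 2 * X l ^ 2 + X l ^ 2 * X i ^ 2)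
      + 16 * (X i ^ 2 * X j ^ 2 * X l ^ 2) - C k)
    (P : AdelicPoints (F₂ k)) {Q : Points (F₂ k) ℤ_[2]}
    (hQ : P.2 ⟨2, Nat.prime_two⟩ = Q) (hP : 1 < 4 * P.1.1 i ^ 2) :
    P ∉ brauerManinSet (F₂ k) := by
  have hdisc : (C (2 * n)) ^ 2 -
      (4 * X i ^ 2 - 1) * (-((4 * X j ^ 2 - 1) * (4 * X l ^ 2 - 1))) =
        C (-1 * 1 ^ 2) + 4 * F₂ k := by
    rw [hF, hk]; simp only [map_mul, map_neg, map_one, map_pow, map_ofNat]; ring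
  refine notMem_brauerManinSet_of_two_adic P hQ one_ne_zero (by norm_num) hdisc ?_ ?_ ?_
  · simp only [map_sub, map_mul, map_one, map_pow, map_ofNat, aeval_X]
    linarith
  · intro p _ R hp hA
    have h := toZMod_aeval_sq hdisc R hA
    rw [aeval_C, eq_intCast, map_intCast] at h
    exact ⟨((2 * n : ℤ) : ZMod p), by rw [← pow_two, h]; norm_num⟩
  · set x := Q.1 i with hx
    have hA : aeval Q.1 (4 * X i ^ 2 - 1 : MvPolynomial _ ℤ) =
        4 * x ^ 2 - 1 := by
      simp only [map_sub, map_mul, map_one, map_pow, map_ofNat, aeval_X, hx]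
    have hsum : 4 * x ^ 2 - 1 ≠ 0 ∧
        ∃ r t : ℚ_[2], r ^ 2 + t ^ 2 = -((4 * x ^ 2 - 1 : ℤ_[2]) : ℚ_[2]) := by
      by_cases h0 : PadicInt.toZMod x = 0
      · obtain ⟨t, ht⟩ := exists_eq_two_mul h0
        have e : -(4 * x ^ 2 - 1) = 1 + 8 * (-2 * t ^ 2) := by rw [ht]; ring
        obtain ⟨u, hu⟩ := exists_sq_eq_of_two_adic e
        refine ⟨fun h => one_add_eight_mul_ne_zero (-2 * t ^ 2) (by rw [← e, h, neg_zero]),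
          (u : ℚ_[2]), 0, ?_⟩
        have : (u : ℚ_[2]) ^ 2 = -((4 * x ^ 2 - 1 : ℤ_[2]) : ℚ_[2]) := by exact_mod_cast congrArg ((↑) : ℤ_[2] → ℚ_[2]) hu
        rw [this]; ring
      · obtain ⟨t, ht⟩ := exists_eq_one_add_two_mul h0
        have e : 5 * -(4 * x ^ 2 - 1) = 1 + 8 * (-2 - 10 * (t * (t + 1))) := by rw [ht]; ring
        obtain ⟨u, hu⟩ := exists_sq_eq_of_two_adic e
        refine ⟨fun h => one_add_eight_mul_ne_zero (-2 - 10 * (t * (t + 1)))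
          (by rw [← e, h]; ring), 2 * (u : ℚ_[2]) / 5, (u : ℚ_[2]) / 5, ?_⟩
        have : (u : ℚ_[2]) ^ 2 = 5 * -((4 * x ^ 2 - 1 : ℤ_[2]) : ℚ_[2]) := by exact_mod_cast congrArg ((↑) : ℤ_[2] → ℚ_[2]) hu
        linear_combination (1 / 5) * this
    obtain ⟨hne, r, t, hrt⟩ := hsum
    rw [← hA] at hne hrt
    refine HasRamifiedPair.of_neg_one (r := r) (t := t) ?_
      (Cl.i_mul_i (δ := -1) (ℓ := 1) one_ne_zero ?_) Cl.j_mul_j Cl.j_mul_i hrt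
    · exact fun h => hne (Subtype.ext h)
    · exact_mod_cast congrArg ((↑) : ℤ_[2] → ℚ_[2]) (disc_eq hdisc Q)

/-- A real point has a coordinate with `4x² > 1`: otherwise `∏ (1 - 4x²) ≤ 1`, but this product is
`1 - 4k = 1 + 4n² > 1`. -/
theorem brauerManinSet_F₂_eq_empty (hk : k = -n ^ 2) (hn : n ≠ 0) :
    brauerManinSet (F₂ k) = ∅ := by
  refine Set.eq_empty_of_forall_notMem fun P => ?_
  by_cases h0 : 1 < 4 * P.1.1 0 ^ 2
  · exact notMem_brauerManinSet_F₂ (i := 0) (j := 1) (l := 2) hk (by simp only [F₂]) P rfl h0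
  by_cases h1 : 1 < 4 * P.1.1 1 ^ 2
  · exact notMem_brauerManinSet_F₂ (i := 1) (j := 2) (l := 0) hk (by simp only [F₂]; ring) P rfl h1
  by_cases h2 : 1 < 4 * P.1.1 2 ^ 2
  · exact notMem_brauerManinSet_F₂ (i := 2) (j := 0) (l := 1) hk (by simp only [F₂]; ring) P rfl h2
  exfalso
  have h := P.1.2
  rw [aeval_F₂, congrArg (Int.cast : ℤ → ℝ) hk] at h
  push_cast at h
  have hn' : (0 : ℝ) < (n : ℝ) ^ 2 := by positivity
  have e : ∀ x : ℝ, ¬ 1 < 4 * x ^ 2 → 0 ≤ 1 - 4 * x ^ 2 ∧ 1 - 4 * x ^ 2 ≤ 1 :=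
    fun x hx => ⟨by linarith, by nlinarith [sq_nonneg x]⟩
  obtain ⟨a0, a1⟩ := e _ h0
  obtain ⟨b0, b1⟩ := e _ h1
  obtain ⟨c0, c1⟩ := e _ h2
  have hab := mul_le_one₀ (mul_le_one₀ a1 b0 b1) c0 c1
  nlinarith

end SecondFamily

section ThirdFamily

variable {k ℓ u v : ℤ} {i j l : Fin 3}

-- The algebra is `(2(4z² + 1), 2)` with `z` the odd coordinate. At 2, `4z² + 1 ≡ 5 mod 8`, so
-- `-3(4z² + 1)` is a square.
open MvPolynomial in
theorem notMem_brauerManinSet_F₃ (hk : 4 * k + 1 = ℓ ^ 2) (hℓ : ℓ ≠ 0)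
    (huv : IsCoprime u v) (hℓuv : ℓ = u ^ 2 + 2 * v ^ 2)
    (hF : F₃ k = X i ^ 2 + X j ^ 2 + X l ^ 2
      + 4 * (X i ^ 2 * X j ^ 2 + X j ^ 2 * X l ^ 2 + X l ^ 2 * X i ^ 2)
      - 16 * (X i ^ 2 * X j ^ 2 * X l ^ 2) - C k)
    (P : AdelicPoints (F₃ k)) {Q : Points (F₃ k) ℤ_[2]}
    (hQ : P.2 ⟨2, Nat.prime_two⟩ = Q) (hP : PadicInt.toZMod (Q.1 l) ≠ 0) :
    P ∉ brauerManinSet (F₃ k) := by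
  have hdisc : (8 * X i * X j) ^ 2 - 2 * (4 * X l ^ 2 + 1) *
      (16 * X i ^ 2 * X j ^ 2 - 4 * X i ^ 2 - 4 * X j ^ 2 - 1) = C (2 * ℓ ^ 2) + 8 * F₃ k := by
    rw [hF, ← hk]
    simp only [map_mul, map_add, map_one, map_ofNat]; ring
  refine notMem_brauerManinSet_of_two_adic P hQ hℓ (by norm_num) hdisc ?_ ?_ ?_
  · simp only [map_mul, map_add, map_one, map_pow, map_ofNat, aeval_X]
    positivity
  · intro p _ R hp hA
    have h := toZMod_aeval_sq hdisc R hA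
    simp only [map_mul, map_add, map_one, map_pow, map_ofNat, aeval_X] at h hA
    push_cast at h ⊢
    set x := PadicInt.toZMod (R.1 i)
    set y := PadicInt.toZMod (R.1 j)
    set z := PadicInt.toZMod (R.1 l)
    have h2 : (2 : ZMod p) ≠ 0 := ofNat_ne_zero_of_prime hp
    -- If `p ∣ ℓ = u² + 2v²`, coprimality makes `v` a unit and `-2` a square, while `4z² ≡ -1` makes
    -- `-1` a square; so `2` is one. This is why `ℓ` is taken of this form.
    by_cases hl : (ℓ : ZMod p) = 0
    · have hz := (mul_eq_zero.mp hA).resolve_left h2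
      have hl' : (u : ZMod p) ^ 2 + 2 * (v : ZMod p) ^ 2 = 0 := by
        rw [← hl, hℓuv]; push_cast; ring
      have hv : (v : ZMod p) ≠ 0 := by
        intro hv
        rw [hv] at hl'
        have hu : (u : ZMod p) = 0 := pow_eq_zero_iff two_ne_zero |>.mp (by linear_combination hl')
        obtain ⟨a, b, hab⟩ := huv
        have := congrArg (Int.cast : ℤ → ZMod p) hab
        push_cast at this
        rw [hu, hv] at this
        simp at this
      exact ⟨2 * z * u / v, by
        field_simp; linear_combination (-2 * z ^ 2) * hl' + (v : ZMod p) ^ 2 * hz⟩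
    · exact ⟨8 * x * y / ℓ, by field_simp; linear_combination -h⟩
  · set z := Q.1 l with hz
    obtain ⟨t, ht⟩ := exists_eq_one_add_two_mul hP
    have e : -3 * (4 * z ^ 2 + 1) = 1 + 8 * (-2 - 6 * (t * (t + 1))) := by rw [ht]; ring
    obtain ⟨w, hw⟩ := exists_sq_eq_of_two_adic e
    have hne := one_add_eight_mul_ne_zero (-2 - 6 * (t * (t + 1)))
    rw [← e] at hne
    have hne' : ((4 * z ^ 2 + 1 : ℤ_[2]) : ℚ_[2]) ≠ 0 :=
      fun h => right_ne_zero_of_mul hne (Subtype.ext h)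
    have hA : ((aeval Q.1 (2 * (4 * X l ^ 2 + 1) : MvPolynomial _ ℤ) :
        ℤ_[2]) : ℚ_[2]) = 2 * ((4 * z ^ 2 + 1 : ℤ_[2]) : ℚ_[2]) := by
      simp only [map_add, map_mul, map_one, map_pow, map_ofNat, aeval_X]
      push_cast; rfl
    refine HasRamifiedPair.of_two (e := ((4 * z ^ 2 + 1 : ℤ_[2]) : ℚ_[2]))
      (w := (w : ℚ_[2]) / ((4 * z ^ 2 + 1 : ℤ_[2]) : ℚ_[2]))
      (Cl.i_mul_i (δ := 2) (ℓ := (ℓ : ℚ_[2])) (by exact_mod_cast hℓ) ?_)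
      (by rw [← hA]; exact Cl.j_mul_j) Cl.j_mul_i ?_
    · exact_mod_cast congrArg ((↑) : ℤ_[2] → ℚ_[2]) (disc_eq hdisc Q)
    · have hw' : (w : ℚ_[2]) ^ 2 = -3 * ((4 * z ^ 2 + 1 : ℤ_[2]) : ℚ_[2]) := by exact_mod_cast congrArg ((↑) : ℤ_[2] → ℚ_[2]) hw
      generalize ((4 * z ^ 2 + 1 : ℤ_[2]) : ℚ_[2]) = c at hne' hw' ⊢
      field_simp
      linear_combination hw'

/-- Some coordinate is odd at 2, since with all three even the left side is divisible by 4. -/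
theorem brauerManinSet_F₃_eq_empty (hk : 4 * k + 1 = ℓ ^ 2) (hk2 : k % 4 = 2)
    (huv : IsCoprime u v) (hℓuv : ℓ = u ^ 2 + 2 * v ^ 2) :
    brauerManinSet (F₃ k) = ∅ := by
  refine Set.eq_empty_of_forall_notMem fun P => ?_
  obtain ⟨Q, hQ⟩ : ∃ Q : Points (F₃ k) ℤ_[2], P.2 ⟨2, Nat.prime_two⟩ = Q := ⟨_, rfl⟩
  have hℓ0 : ℓ ≠ 0 := by rintro rfl; omega
  by_cases h0 : PadicInt.toZMod (Q.1 0) ≠ 0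
  · exact notMem_brauerManinSet_F₃ (i := 1) (j := 2) (l := 0) hk hℓ0 huv hℓuv
      (by simp only [F₃]; ring) P hQ h0
  by_cases h1 : PadicInt.toZMod (Q.1 1) ≠ 0
  · exact notMem_brauerManinSet_F₃ (i := 2) (j := 0) (l := 1) hk hℓ0 huv hℓuv
      (by simp only [F₃]; ring) P hQ h1
  by_cases h2 : PadicInt.toZMod (Q.1 2) ≠ 0
  · exact notMem_brauerManinSet_F₃ (i := 0) (j := 1) (l := 2) hk hℓ0 huv hℓuv
      (by simp only [F₃]) P hQ h2
  exfalso
  push Not at h0 h1 h2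
  obtain ⟨x, hx⟩ := exists_eq_two_mul h0
  obtain ⟨y, hy⟩ := exists_eq_two_mul h1
  obtain ⟨z, hz⟩ := exists_eq_two_mul h2
  have h := Q.2
  obtain ⟨m, hm⟩ : ∃ m, k = 2 * (1 + 2 * m) := ⟨(k - 2) / 4, by omega⟩
  rw [aeval_F₃, hx, hy, hz, congrArg (Int.cast : ℤ → ℤ_[2]) hm] at h
  push_cast at h
  have h2 : (2 : ℤ_[2]) ≠ 0 := two_ne_zero
  refine one_add_two_mul_ne_zero (m - (x ^ 2 + y ^ 2 + z ^ 2
    + 16 * (x ^ 2 * y ^ 2 + y ^ 2 * z ^ 2 + z ^ 2 * x ^ 2) - 256 * (x ^ 2 * y ^ 2 * z ^ 2)))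
    (mul_left_cancel₀ h2 ?_)
  linear_combination -h

end ThirdFamily

end

/-! ### Counting the values of u² + 2v² -/

section Combinatorics

open Finset

/-- The Cauchy–Schwarz bound for the size of an image in terms of the number of collisions. -/
theorem card_sq_le_card_image_mul {α β : Type*} [DecidableEq α] [DecidableEq β] (s : Finset α) (f : α → β) :
    #s ^ 2 ≤ #(s.image f) * #((s ×ˢ s).filter fun x => f x.1 = f x.2) := by
  have h1 : #s = ∑ b ∈ s.image f, #(s.filter fun a => f a = b) := card_eq_sum_card_image f s
  have h2 : #((s ×ˢ s).filter fun x => f x.1 = f x.2) =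
      ∑ b ∈ s.image f, #(s.filter fun a => f a = b) ^ 2 := by
    rw [card_eq_sum_card_fiberwise (f := fun x : α × α => f x.1) (t := s.image f)]
    · refine sum_congr rfl fun b _ => ?_
      rw [pow_two, ← card_product]
      congr 1
      ext ⟨x, y⟩
      simp only [mem_filter, mem_product]
      constructor
      · rintro ⟨⟨⟨hx, hy⟩, hxy⟩, hb⟩
        exact ⟨⟨hx, hb⟩, hy, by rw [← hxy, hb]⟩
      · rintro ⟨⟨hx, hb⟩, hy, hb'⟩
        exact ⟨⟨⟨hx, hy⟩, by rw [hb, hb']⟩, hb⟩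
    · intro x hx
      simp only [coe_filter, Set.mem_ofPred_eq, mem_product] at hx
      exact mem_coe.mpr (mem_image_of_mem f hx.1.1)
  rw [h2, h1]
  exact sq_sum_le_card_mul_sum_sq

/-- The multiplicative energy of `{1, …, X}` is at most `2 X² ∑_{g ≤ X} 1 / g`. -/
theorem card_mul_eq_mul_le (X : ℕ) :
    (#(((Icc 1 X ×ˢ Icc 1 X) ×ˢ (Icc 1 X ×ˢ Icc 1 X)).filter
      fun x => x.1.1 * x.1.2 = x.2.1 * x.2.2) : ℚ) ≤ 2 * X ^ 2 * harmonic X := by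
  set S := ((Icc 1 X ×ˢ Icc 1 X) ×ˢ (Icc 1 X ×ˢ Icc 1 X)).filter
    fun x => x.1.1 * x.1.2 = x.2.1 * x.2.2 with hS
  set U : Finset (Σ _ : ℕ, ℕ × (ℕ × ℕ)) :=
    (Icc 1 X).sigma fun g => Icc 1 g ×ˢ (Icc 1 (X / g) ×ˢ Icc 1 (X / g)) with hU
  have hUcard : (#U : ℚ) ≤ X ^ 2 * harmonic X := by
    rw [hU, card_sigma, harmonic_eq_sum_Icc, mul_sum]
    push_cast
    refine sum_le_sum fun g hg => ?_
    rw [mem_Icc] at hg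
    have hg0 : (0 : ℚ) < g := by exact_mod_cast hg.1
    simp only [card_product, Nat.card_Icc, Nat.add_sub_cancel]
    push_cast
    have h1 : ((X / g : ℕ) : ℚ) ≤ X / g := Nat.cast_div_le
    calc (g : ℚ) * (((X / g : ℕ) : ℚ) * ((X / g : ℕ) : ℚ)) ≤ g * ((X / g) * (X / g)) := by gcongr
      _ = X ^ 2 * (g : ℚ)⁻¹ := by field_simp
  -- Solutions of `ab = cd` are `a = gm, c = gn, b = nt, d = mt` with `m, n` coprime. The two maps
  -- separate `t ≤ g` from `g ≤ t`; the larger of the two bounds `m` and `n` by `X` divided by it,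
  -- giving `g (X/g)²` quadruples for each value `g` of the larger one.
  let f₁ : (Σ _ : ℕ, ℕ × (ℕ × ℕ)) → (ℕ × ℕ) × (ℕ × ℕ) := fun x =>
    ((x.1 * x.2.2.1, x.2.2.2 * x.2.1), (x.1 * x.2.2.2, x.2.2.1 * x.2.1))
  let f₂ : (Σ _ : ℕ, ℕ × (ℕ × ℕ)) → (ℕ × ℕ) × (ℕ × ℕ) := fun x =>
    ((x.2.1 * x.2.2.1, x.2.2.2 * x.1), (x.2.1 * x.2.2.2, x.2.2.1 * x.1))
  have hsub : S ⊆ U.image f₁ ∪ U.image f₂ := by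
    rintro ⟨⟨a, b⟩, c, d⟩ hx
    simp only [hS, mem_filter, mem_product, mem_Icc] at hx
    obtain ⟨⟨⟨⟨ha, ha'⟩, hb, hb'⟩, ⟨hc, hc'⟩, hd, hd'⟩, h⟩ := hx
    obtain ⟨g, m, n, hg, hmn, rfl, rfl⟩ : ∃ g m n : ℕ, 0 < g ∧ Nat.Coprime m n ∧ a = g * m ∧ c = g * n := by
      obtain ⟨g, m, n, hg, hmn, h1, h2⟩ := Nat.exists_coprime' (Nat.gcd_pos_of_pos_left c ha)
      exact ⟨g, m, n, hg, hmn, by rw [h1, mul_comm], by rw [h2, mul_comm]⟩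
    have h' : m * b = n * d := by
      apply Nat.eq_of_mul_eq_mul_left hg
      linarith
    obtain ⟨t, rfl⟩ : n ∣ b := hmn.symm.dvd_of_dvd_mul_left ⟨d, h'⟩
    have hn : 0 < n := Nat.pos_of_ne_zero (by rintro rfl; simp at hc)
    obtain rfl : d = m * t := by
      apply Nat.eq_of_mul_eq_mul_left hn
      linarith
    have hm : 0 < m := Nat.pos_of_ne_zero (by rintro rfl; simp at ha)
    have ht : 0 < t := Nat.pos_of_ne_zero (by rintro rfl; simp at hd)
    rw [mem_union, mem_image, mem_image]
    rcases le_total t g with htg | htg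
    · left
      refine ⟨⟨g, t, m, n⟩, ?_, rfl⟩
      simp only [hU, mem_sigma, mem_product, mem_Icc]
      refine ⟨⟨hg, ?_⟩, ⟨ht, htg⟩, ⟨hm, ?_⟩, hn, ?_⟩
      · nlinarith
      · rw [Nat.le_div_iff_mul_le hg]; linarith
      · rw [Nat.le_div_iff_mul_le hg]; linarith
    · right
      refine ⟨⟨t, g, m, n⟩, ?_, rfl⟩
      simp only [hU, mem_sigma, mem_product, mem_Icc]
      refine ⟨⟨ht, ?_⟩, ⟨hg, htg⟩, ⟨hm, ?_⟩, hn, ?_⟩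
      · nlinarith
      · rw [Nat.le_div_iff_mul_le ht]; linarith
      · rw [Nat.le_div_iff_mul_le ht]; linarith
  have hle : #S ≤ #U + #U := (card_le_card hsub).trans ((card_union_le _ _).trans
    (add_le_add card_image_le card_image_le))
  have hle' : (#S : ℚ) ≤ #U + #U := by exact_mod_cast hle
  linarith

theorem lt_of_sq_add_two_mul_sq_eq {a b c d : ℕ} (h : a ^ 2 + 2 * b ^ 2 = c ^ 2 + 2 * d ^ 2)
    (hca : c < a) : b < d := by
  by_contra! hdb
  have h1 := Nat.pow_lt_pow_left hca two_ne_zero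
  have h2 := Nat.pow_le_pow_left hdb 2
  omega

/-- The number of collisions of the form `u² + 2v²` on `{1, …, Y}²`. -/
theorem card_collisions_le (Y : ℕ) :
    (#(((Icc 1 Y ×ˢ Icc 1 Y) ×ˢ (Icc 1 Y ×ˢ Icc 1 Y)).filter
      fun x => x.1.1 ^ 2 + 2 * x.1.2 ^ 2 = x.2.1 ^ 2 + 2 * x.2.2 ^ 2) : ℚ) ≤
      Y ^ 2 + 16 * Y ^ 2 * harmonic (2 * Y) := by
  set S := ((Icc 1 Y ×ˢ Icc 1 Y) ×ˢ (Icc 1 Y ×ˢ Icc 1 Y)).filter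
    fun x => x.1.1 ^ 2 + 2 * x.1.2 ^ 2 = x.2.1 ^ 2 + 2 * x.2.2 ^ 2 with hS
  set D := S.filter fun x => x.1.1 = x.2.1
  set S₁ := S.filter fun x => x.2.1 < x.1.1
  set S₂ := S.filter fun x => x.1.1 < x.2.1
  have hsub : S ⊆ D ∪ (S₁ ∪ S₂) := by
    intro x hx
    simp only [D, S₁, S₂, mem_union, mem_filter]
    rcases lt_trichotomy x.1.1 x.2.1 with h | h | h <;> tauto
  have hD : #D ≤ Y ^ 2 := by
    calc #D ≤ #(Icc 1 Y ×ˢ Icc 1 Y) := by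
          refine card_le_card_of_injOn Prod.fst ?_ ?_
          · intro x hx
            simp only [D, hS, coe_filter, mem_filter, mem_product, Set.mem_ofPred_eq] at hx
            exact mem_coe.mpr (mem_product.mpr hx.1.1.1)
          · rintro ⟨⟨a, b⟩, c, d⟩ hx ⟨⟨a', b'⟩, c', d'⟩ hy h
            simp only [D, hS, coe_filter, mem_filter, mem_product, Set.mem_ofPred_eq,
              Prod.mk.injEq] at hx hy h ⊢
            obtain ⟨rfl, rfl⟩ := h
            obtain ⟨⟨-, h1⟩, rfl⟩ := hx
            obtain ⟨⟨-, h2⟩, rfl⟩ := hy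
            refine ⟨⟨rfl, rfl⟩, rfl, ?_⟩
            exact Nat.pow_left_injective two_ne_zero (by simp only; linarith)
      _ = Y ^ 2 := by simp [pow_two]
  have h21 : #S₂ ≤ #S₁ := by
    refine card_le_card_of_injOn Prod.swap ?_ (Prod.swap_injective.injOn)
    rintro ⟨⟨a, b⟩, c, d⟩ hx
    simp only [S₁, S₂, hS, coe_filter, mem_filter, mem_product, Set.mem_ofPred_eq,
      Prod.swap_prod_mk] at hx ⊢
    exact ⟨⟨⟨hx.1.1.2, hx.1.1.1⟩, hx.1.2.symm⟩, hx.2⟩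
  have h1 : (#S₁ : ℚ) ≤ 2 * (2 * Y : ℕ) ^ 2 * harmonic (2 * Y) := by
    refine le_trans ?_ (card_mul_eq_mul_le (2 * Y))
    rw [Nat.cast_le]
    -- A collision off the diagonal factors as `(a - c)(a + c) = 2(d - b) · (d + b)`, a solution of
    -- the multiplicative equation in `{1, …, 2Y}`.
    refine card_le_card_of_injOn
      (fun x => ((x.1.1 - x.2.1, x.1.1 + x.2.1), (2 * (x.2.2 - x.1.2), x.2.2 + x.1.2))) ?_ ?_
    · rintro ⟨⟨a, b⟩, c, d⟩ hx
      simp only [S₁, hS, coe_filter, mem_filter, mem_product, Set.mem_ofPred_eq, mem_Icc] at hx ⊢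
      obtain ⟨⟨⟨⟨⟨ha, ha'⟩, hb, hb'⟩, ⟨hc, hc'⟩, hd, hd'⟩, h⟩, hac⟩ := hx
      have hbd := lt_of_sq_add_two_mul_sq_eq h hac
      obtain ⟨s, rfl⟩ := Nat.exists_eq_add_of_lt hac
      obtain ⟨r, rfl⟩ := Nat.exists_eq_add_of_lt hbd
      rw [show c + s + 1 - c = s + 1 by omega, show b + r + 1 - b = r + 1 by omega]
      refine ⟨⟨⟨⟨by omega, by omega⟩, by omega, by omega⟩, ⟨by omega, by omega⟩, by omega, by omega⟩, ?_⟩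
      linarith
    · rintro ⟨⟨a, b⟩, c, d⟩ hx ⟨⟨a', b'⟩, c', d'⟩ hy h
      simp only [S₁, hS, coe_filter, mem_filter, mem_product, Set.mem_ofPred_eq, mem_Icc,
        Prod.mk.injEq] at hx hy h ⊢
      have hbd := lt_of_sq_add_two_mul_sq_eq hx.1.2 hx.2
      have hbd' := lt_of_sq_add_two_mul_sq_eq hy.1.2 hy.2
      omega
  have hle : #S ≤ #D + (#S₁ + #S₂) := (card_le_card hsub).trans ((card_union_le _ _).trans
    (Nat.add_le_add_left (card_union_le _ _) _))
  have hle' : (#S : ℚ) ≤ #D + (#S₁ + #S₂) := by exact_mod_cast hle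
  have hD' : (#D : ℚ) ≤ Y ^ 2 := by exact_mod_cast hD
  have h21' : (#S₂ : ℚ) ≤ #S₁ := by exact_mod_cast h21
  push_cast at h1
  linarith

/-- The coprime pairs of odd numbers in `{1, …, 2N}`. -/
def oddCoprimePairs (N : ℕ) : Finset (ℕ × ℕ) :=
  (Icc 1 (2 * N) ×ˢ Icc 1 (2 * N)).filter fun x => Odd x.1 ∧ Odd x.2 ∧ Nat.Coprime x.1 x.2

/-- Telescoping: `1/(2e+1)² ≤ 1/(4e) - 1/(4(e+1))` for `e ≥ 2`, and `17/72 = 1/9 + 1/8`. -/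
theorem sum_inv_odd_sq_le (n : ℕ) :
    ∑ e ∈ Icc 1 n, (1 / (2 * e + 1) ^ 2 : ℚ) ≤ 17 / 72 := by
  have key : ∀ n : ℕ, 1 ≤ n →
      ∑ e ∈ Icc 1 n, (1 / (2 * e + 1) ^ 2 : ℚ) ≤ 17 / 72 - 1 / (4 * (n + 1)) := by
    intro n hn
    induction n, hn using Nat.le_induction with
    | base => norm_num
    | succ n hn ih =>
      rw [sum_Icc_succ_top (by omega)]
      have : (1 / (2 * ((n + 1 : ℕ) : ℚ) + 1) ^ 2 : ℚ) ≤
          1 / (4 * (n + 1)) - 1 / (4 * ((n + 1 : ℕ) + 1)) := by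
        push_cast
        rw [div_sub_div _ _ (by positivity) (by positivity), div_le_div_iff₀ (by positivity)
          (by positivity)]
        have : (0 : ℚ) ≤ n := by positivity
        nlinarith
      linarith
  rcases Nat.eq_zero_or_pos n with rfl | hn
  · norm_num
  · have h1 := key n hn
    have h2 : (0 : ℚ) ≤ 1 / (4 * (n + 1)) := by positivity
    linarith

/-- From the `N²` odd pairs remove those with gcd `2e + 1 ≥ 3`, at most `(2N/(2e+1))²` for each `e`.
What remains is at least `N² (1 - 4 · 17/72) = N²/18`. -/
theorem card_oddCoprimePairs_ge (N : ℕ) : (N : ℚ) ^ 2 / 18 ≤ #(oddCoprimePairs N) := by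
  set O := (range N).image fun a => 2 * a + 1 with hO
  have hOcard : #O = N := by
    rw [hO, card_image_of_injective _ fun a b h => by simpa using h, card_range]
  set T : ℕ → Finset (ℕ × ℕ) := fun e =>
    ((Icc 1 (2 * N / (2 * e + 1))).image fun m => (2 * e + 1) * m) ×ˢ
      ((Icc 1 (2 * N / (2 * e + 1))).image fun m => (2 * e + 1) * m) with hT
  have hsub : O ×ˢ O ⊆ oddCoprimePairs N ∪ (Icc 1 N).biUnion T := by
    rintro ⟨u, v⟩ hx
    simp only [hO, mem_product, mem_image, mem_range] at hx
    obtain ⟨⟨a, ha, hu⟩, b, hb, hv⟩ := hx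
    rw [mem_union]
    by_cases hc : Nat.Coprime u v
    · left
      simp only [oddCoprimePairs, mem_filter, mem_product, mem_Icc]
      exact ⟨⟨⟨by omega, by omega⟩, by omega, by omega⟩, ⟨a, hu.symm⟩, ⟨b, hv.symm⟩, hc⟩
    · right
      have hd0 : 0 < Nat.gcd u v := Nat.gcd_pos_of_pos_left _ (by omega)
      have hodd : Odd (Nat.gcd u v) := Odd.of_dvd_nat ⟨a, hu.symm⟩ (Nat.gcd_dvd_left u v)
      have hle : Nat.gcd u v ≤ u := Nat.le_of_dvd (by omega) (Nat.gcd_dvd_left u v)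
      obtain ⟨e, he⟩ := hodd
      have hmult : ∀ w, 1 ≤ w → w ≤ 2 * N → Nat.gcd u v ∣ w →
          w ∈ (Icc 1 (2 * N / (2 * e + 1))).image fun m => (2 * e + 1) * m := by
        rintro w hw hw' ⟨m, hm⟩
        rw [he] at hm
        rw [mem_image]
        refine ⟨m, mem_Icc.mpr ⟨Nat.pos_of_ne_zero ?_, ?_⟩, hm.symm⟩
        · rintro rfl; omega
        · rw [Nat.le_div_iff_mul_le (by omega)]; linarith
      rw [mem_biUnion]
      refine ⟨e, mem_Icc.mpr ⟨Nat.pos_of_ne_zero ?_, by omega⟩, mem_product.mpr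
        ⟨hmult u (by omega) (by omega) (Nat.gcd_dvd_left u v),
          hmult v (by omega) (by omega) (Nat.gcd_dvd_right u v)⟩⟩
      rintro rfl
      exact hc he
  have hTcard : ∀ e, (#(T e) : ℚ) ≤ 4 * N ^ 2 * (1 / (2 * e + 1) ^ 2) := by
    intro e
    have h1 : #(T e) ≤ (2 * N / (2 * e + 1)) * (2 * N / (2 * e + 1)) := by
      rw [hT, card_product]
      have := card_image_le (s := Icc 1 (2 * N / (2 * e + 1))) (f := fun m => (2 * e + 1) * m)
      rw [Nat.card_Icc, Nat.add_sub_cancel] at this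
      exact Nat.mul_le_mul this this
    have h2 : ((2 * N / (2 * e + 1) : ℕ) : ℚ) ≤ 2 * N / (2 * e + 1) := by
      have := Nat.cast_div_le (α := ℚ) (m := 2 * N) (n := 2 * e + 1)
      push_cast at this ⊢
      exact this
    calc (#(T e) : ℚ) ≤ ((2 * N / (2 * e + 1) : ℕ) : ℚ) * ((2 * N / (2 * e + 1) : ℕ) : ℚ) := by
          exact_mod_cast h1
      _ ≤ (2 * N / (2 * e + 1)) * (2 * N / (2 * e + 1)) := by gcongr
      _ = 4 * N ^ 2 * (1 / (2 * e + 1) ^ 2) := by field_simp; ring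
  have h := card_le_card hsub
  rw [card_product, hOcard] at h
  have h' : (N * N : ℚ) ≤ #(oddCoprimePairs N) + ∑ e ∈ Icc 1 N, (#(T e) : ℚ) := by
    exact_mod_cast h.trans ((card_union_le _ _).trans (Nat.add_le_add_left card_biUnion_le _))
  have hs : ∑ e ∈ Icc 1 N, (#(T e) : ℚ) ≤ 4 * N ^ 2 * (17 / 72) :=
    calc _ ≤ ∑ e ∈ Icc 1 N, 4 * N ^ 2 * (1 / (2 * e + 1) ^ 2 : ℚ) := sum_le_sum fun e _ => hTcard e
      _ = 4 * N ^ 2 * ∑ e ∈ Icc 1 N, (1 / (2 * e + 1) ^ 2 : ℚ) := by rw [mul_sum]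
      _ ≤ _ := by gcongr; exact sum_inv_odd_sq_le N
  linarith

/-- Many integers are of the form `u² + 2v²` with `u`, `v ≤ 2N` odd and coprime. -/
theorem card_image_oddCoprimePairs_ge {N : ℕ} (hN : 1 ≤ N) :
    (N : ℝ) ^ 2 / (22032 * (1 + Real.log (4 * N))) ≤
      #((oddCoprimePairs N).image fun x => x.1 ^ 2 + 2 * x.2 ^ 2) := by
  set I := (oddCoprimePairs N).image fun x => x.1 ^ 2 + 2 * x.2 ^ 2
  have h1 := card_sq_le_card_image_mul (oddCoprimePairs N) fun x => x.1 ^ 2 + 2 * x.2 ^ 2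
  have h2 : (#((oddCoprimePairs N ×ˢ oddCoprimePairs N).filter
      fun x => x.1.1 ^ 2 + 2 * x.1.2 ^ 2 = x.2.1 ^ 2 + 2 * x.2.2 ^ 2) : ℚ) ≤
      (2 * N : ℕ) ^ 2 + 16 * (2 * N : ℕ) ^ 2 * harmonic (2 * (2 * N)) := by
    refine le_trans ?_ (card_collisions_le (2 * N))
    rw [Nat.cast_le]
    exact card_le_card (filter_subset_filter _
      (product_subset_product (filter_subset _ _) (filter_subset _ _)))
  have h3 := card_oddCoprimePairs_ge N
  have hharm : (1 : ℚ) ≤ harmonic (2 * (2 * N)) := by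
    rw [harmonic_eq_sum_Icc]
    have := single_le_sum (s := Icc 1 (2 * (2 * N))) (f := fun i : ℕ => ((i : ℚ))⁻¹)
      (fun i _ => by positivity) (mem_Icc.mpr ⟨le_refl 1, by omega⟩)
    simpa using this
  have hN0 : (0 : ℚ) < N := by exact_mod_cast hN
  -- The constant `68` is `4 + 16 · 4`, from `card_collisions_le` at `Y = 2N`; then `22032 = 68 ·
  -- 18²`.
  have h4 : ((N : ℚ) ^ 2 / 18) ^ 2 ≤ #I * (68 * N ^ 2 * harmonic (2 * (2 * N))) := by
    calc ((N : ℚ) ^ 2 / 18) ^ 2 ≤ (#(oddCoprimePairs N) : ℚ) ^ 2 := by gcongr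
      _ ≤ #I * (#((oddCoprimePairs N ×ˢ oddCoprimePairs N).filter
          fun x => x.1.1 ^ 2 + 2 * x.1.2 ^ 2 = x.2.1 ^ 2 + 2 * x.2.2 ^ 2) : ℚ) := by
          exact_mod_cast h1
      _ ≤ #I * ((2 * N : ℕ) ^ 2 + 16 * (2 * N : ℕ) ^ 2 * harmonic (2 * (2 * N))) := by gcongr
      _ ≤ _ := by
          gcongr
          push_cast
          nlinarith
  have h5 : (N : ℚ) ^ 2 ≤ #I * (22032 * harmonic (2 * (2 * N))) := by
    have : (N : ℚ) ^ 2 * (N : ℚ) ^ 2 ≤ (N : ℚ) ^ 2 * (#I * (22032 * harmonic (2 * (2 * N)))) := by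
      linarith
    exact le_of_mul_le_mul_left this (by positivity)
  have h6 : (N : ℝ) ^ 2 ≤ #I * (22032 * (harmonic (2 * (2 * N)) : ℝ)) := by exact_mod_cast h5
  have h7 := harmonic_le_one_add_log (2 * (2 * N))
  have h8 : ((2 * (2 * N) : ℕ) : ℝ) = 4 * N := by push_cast; ring
  rw [h8] at h7
  have h9 : (0 : ℝ) < 1 + Real.log (4 * N) := by
    have : (1 : ℝ) ≤ harmonic (2 * (2 * N)) := by exact_mod_cast hharm
    linarith
  rw [div_le_iff₀ (by positivity)]
  refine h6.trans ?_
  gcongr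

end Combinatorics

/-! ### Counting the values of k -/

section

section Counting

variable {p : ℤ → Prop}

theorem finite_abs_le (p : ℤ → Prop) (M : ℝ) : {k : ℤ | |(k : ℝ)| ≤ M ∧ p k}.Finite := by
  refine (Set.finite_Icc (-⌊M⌋) ⌊M⌋).subset fun k hk => ?_
  obtain ⟨h1, h2⟩ := abs_le.mp hk.1
  exact ⟨by rw [neg_le, Int.le_floor]; push_cast; linarith, Int.le_floor.mpr h2⟩

theorem ncard_abs_le (p : ℤ → Prop) {M : ℝ} (hM : 1 ≤ M) :
    ({k : ℤ | |(k : ℝ)| ≤ M ∧ p k}.ncard : ℝ) ≤ 3 * M := by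
  have hsub : {k : ℤ | |(k : ℝ)| ≤ M ∧ p k} ⊆ Finset.Icc (-⌊M⌋) ⌊M⌋ := fun k hk => by
    obtain ⟨h1, h2⟩ := abs_le.mp hk.1
    exact Finset.mem_coe.mpr (Finset.mem_Icc.mpr
      ⟨by rw [neg_le, Int.le_floor]; push_cast; linarith, Int.le_floor.mpr h2⟩)
  have h := Set.ncard_le_ncard hsub (Finset.finite_toSet _)
  rw [Set.ncard_coe_finset, Int.card_Icc] at h
  have h0 : 0 ≤ ⌊M⌋ := Int.floor_nonneg.mpr (by linarith)
  have h1 : (({k : ℤ | |(k : ℝ)| ≤ M ∧ p k}.ncard : ℤ) : ℝ) ≤ ((2 * ⌊M⌋ + 1 : ℤ) : ℝ) := by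
    rw [Int.cast_le]; omega
  have h2 := Int.floor_le M
  push_cast at h1
  linarith

/-- If the integers with property `p` of size at most `C N ^ e` number at least `g N`, then those
of size at most `M` number at least `g N` for some `N` comparable to `(M / C) ^ (1 / e)`. -/
theorem exists_le_ncard {C : ℝ} (hC : 0 < C) {e : ℕ} (he : e ≠ 0) {g : ℕ → ℝ}
    (h : ∀ N : ℕ, 1 ≤ N → ∃ T : Finset ℤ, (∀ k ∈ T, p k ∧ |(k : ℝ)| ≤ C * (N : ℝ) ^ e) ∧ g N ≤ T.card)
    {M : ℝ} (hM : C ≤ M) :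
    ∃ N : ℕ, 1 ≤ N ∧ C * (N : ℝ) ^ e ≤ M ∧ M ≤ C * (2 * (N : ℝ)) ^ e ∧
      g N ≤ ({k : ℤ | |(k : ℝ)| ≤ M ∧ p k}.ncard : ℝ) := by
  set x : ℝ := (M / C) ^ ((e : ℝ)⁻¹)
  have h1 : 1 ≤ M / C := by rwa [one_le_div hC]
  have hx1 : 1 ≤ x := Real.one_le_rpow h1 (by positivity)
  have hxe : x ^ e = M / C := Real.rpow_inv_natCast_pow (by linarith) he
  have hN1 : 1 ≤ ⌊x⌋₊ := Nat.one_le_floor_iff x |>.mpr hx1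
  have hNx : (⌊x⌋₊ : ℝ) ≤ x := Nat.floor_le (by linarith)
  have hxN : x ≤ 2 * (⌊x⌋₊ : ℝ) := by
    have h2 := (Nat.lt_floor_add_one x).le
    have h3 : (1 : ℝ) ≤ ⌊x⌋₊ := by exact_mod_cast hN1
    linarith
  have hle : C * (⌊x⌋₊ : ℝ) ^ e ≤ M := by
    calc C * (⌊x⌋₊ : ℝ) ^ e ≤ C * x ^ e := by gcongr
      _ = M := by rw [hxe]; field_simp
  refine ⟨⌊x⌋₊, hN1, hle, ?_, ?_⟩
  · calc M = C * x ^ e := by rw [hxe]; field_simp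
      _ ≤ _ := by gcongr
  · obtain ⟨T, hT, hg⟩ := h _ hN1
    refine hg.trans ?_
    have hsub : (T : Set ℤ) ⊆ {k : ℤ | |(k : ℝ)| ≤ M ∧ p k} :=
      fun k hk => ⟨(hT k hk).2.trans hle, (hT k hk).1⟩
    have := Set.ncard_le_ncard hsub (finite_abs_le p M)
    rw [Set.ncard_coe_finset] at this
    exact_mod_cast this

theorem exists_finset_of_injective {C : ℝ} {e : ℕ} {f : ℕ → ℤ} (hf : Function.Injective f)
    (hp : ∀ t, p (f t)) (hle : ∀ t, |(f t : ℝ)| ≤ C * ((t : ℝ) + 1) ^ e) (hC : 0 ≤ C) (N : ℕ) :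
    ∃ T : Finset ℤ, (∀ k ∈ T, p k ∧ |(k : ℝ)| ≤ C * (N : ℝ) ^ e) ∧ (N : ℝ) ≤ T.card := by
  refine ⟨(Finset.range N).image f, fun k hk => ?_, ?_⟩
  · obtain ⟨t, ht, rfl⟩ := Finset.mem_image.mp hk
    refine ⟨hp t, (hle t).trans ?_⟩
    have : (t : ℝ) + 1 ≤ N := by exact_mod_cast Finset.mem_range.mp ht
    gcongr
  · rw [Finset.card_image_of_injective _ hf, Finset.card_range]

/-- A property satisfied by an injective sequence of linear growth has positive density. -/
theorem isTheta_ncard {C : ℝ} {f : ℕ → ℤ} (hf : Function.Injective f) (hp : ∀ t, p (f t))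
    (hC : 0 < C) (hle : ∀ t, |(f t : ℝ)| ≤ C * ((t : ℝ) + 1)) :
    (fun M : ℝ => ({k : ℤ | |(k : ℝ)| ≤ M ∧ p k}.ncard : ℝ)) =Θ[atTop] (fun M : ℝ => M) := by
  constructor
  · refine IsBigO.of_bound 3 ?_
    filter_upwards [eventually_ge_atTop 1] with M hM
    rw [Real.norm_of_nonneg (by positivity), Real.norm_of_nonneg (by linarith)]
    exact ncard_abs_le p hM
  · refine IsBigO.of_bound (2 * C) ?_
    filter_upwards [eventually_ge_atTop C] with M hM
    obtain ⟨N, -, -, h1, h2⟩ := exists_le_ncard hC one_ne_zero (fun N _ =>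
      exists_finset_of_injective (C := C) (e := 1) hf hp (fun t => by rw [pow_one]; exact hle t) hC.le N) hM
    rw [Real.norm_of_nonneg (by linarith), Real.norm_of_nonneg (by positivity)]
    calc M ≤ C * (2 * (N : ℝ)) ^ 1 := h1
      _ = 2 * C * N := by ring
      _ ≤ _ := by gcongr

/-- A property satisfied by an injective sequence of quadratic growth. -/
theorem rpow_half_div_log_isBigO_ncard {C : ℝ} {f : ℕ → ℤ} (hf : Function.Injective f)
    (hp : ∀ t, p (f t)) (hC : 0 < C) (hle : ∀ t, |(f t : ℝ)| ≤ C * ((t : ℝ) + 1) ^ 2) :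
    (fun M : ℝ => M ^ (1 / 2 : ℝ) / Real.log M) =O[atTop]
      (fun M : ℝ => ({k : ℤ | |(k : ℝ)| ≤ M ∧ p k}.ncard : ℝ)) := by
  refine IsBigO.of_bound (2 * √C) ?_
  filter_upwards [eventually_ge_atTop C, eventually_ge_atTop (Real.exp 1)] with M hM hMe
  obtain ⟨N, -, -, h1, h2⟩ := exists_le_ncard hC two_ne_zero (fun N _ =>
    exists_finset_of_injective hf hp hle hC.le N) hM
  have hM0 : 0 < M := hC.trans_le hM
  have hlog : 1 ≤ Real.log M := by rwa [Real.le_log_iff_exp_le hM0]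
  rw [← Real.sqrt_eq_rpow, Real.norm_of_nonneg (by positivity), Real.norm_of_nonneg (by positivity)]
  calc √M / Real.log M ≤ √M := div_le_self (Real.sqrt_nonneg _) hlog
    _ ≤ √(C * (2 * (N : ℝ)) ^ 2) := Real.sqrt_le_sqrt h1
    _ = 2 * √C * N := by
      rw [Real.sqrt_mul hC.le, Real.sqrt_sq (by positivity)]; ring
    _ ≤ _ := by gcongr

/-- A property satisfied by `(ℓ² - 1) / 4` whenever `ℓ = u² + 2v²` with `u`, `v` odd and
coprime. -/
theorem rpow_half_div_log_isBigO_ncard_of_form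
    (hp : ∀ (k : ℤ) (u v : ℕ), Odd u → Odd v → Nat.Coprime u v →
      4 * k + 1 = ((u : ℤ) ^ 2 + 2 * (v : ℤ) ^ 2) ^ 2 → p k) :
    (fun M : ℝ => M ^ (1 / 2 : ℝ) / Real.log M) =O[atTop]
      (fun M : ℝ => ({k : ℤ | |(k : ℝ)| ≤ M ∧ p k}.ncard : ℝ)) := by
  -- With `u, v ≤ 2N` one has `ℓ ≤ 12N²`, so `k = (ℓ² - 1)/4 ≤ 36N⁴`.
  have hT : ∀ N : ℕ, 1 ≤ N → ∃ T : Finset ℤ, (∀ k ∈ T, p k ∧ |(k : ℝ)| ≤ 36 * (N : ℝ) ^ 4) ∧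
      (N : ℝ) ^ 2 / (22032 * (1 + Real.log (4 * N))) ≤ T.card := by
    intro N hN
    set I := (oddCoprimePairs N).image fun x => x.1 ^ 2 + 2 * x.2 ^ 2 with hI
    have hIk : ∀ ℓ ∈ I, ∃ u v : ℕ, Odd u ∧ Odd v ∧ Nat.Coprime u v ∧ u ≤ 2 * N ∧ v ≤ 2 * N ∧
        ℓ = u ^ 2 + 2 * v ^ 2 ∧ 4 * (((ℓ : ℤ) ^ 2 - 1) / 4) + 1 = (ℓ : ℤ) ^ 2 := by
      intro ℓ hℓ
      obtain ⟨⟨u, v⟩, hx, rfl⟩ := Finset.mem_image.mp hℓ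
      simp only [oddCoprimePairs, Finset.mem_filter, Finset.mem_product, Finset.mem_Icc] at hx
      obtain ⟨⟨⟨-, hu⟩, -, hv⟩, hu1, hv1, huv⟩ := hx
      refine ⟨u, v, hu1, hv1, huv, hu, hv, rfl, ?_⟩
      obtain ⟨a, rfl⟩ := hu1
      have hodd : Odd (((2 * a + 1) ^ 2 + 2 * v ^ 2 : ℕ) : ℤ) := by
        rw [Int.odd_coe_nat]
        exact ⟨2 * a ^ 2 + 2 * a + v ^ 2, by ring⟩
      obtain ⟨m, hm⟩ := hodd
      rw [hm]
      have : (2 * m + 1) ^ 2 - 1 = 4 * (m * (m + 1)) := by ring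
      rw [this, Int.mul_ediv_cancel_left _ (by norm_num)]
      ring
    refine ⟨I.image fun ℓ : ℕ => ((ℓ : ℤ) ^ 2 - 1) / 4, fun k hk => ?_, ?_⟩
    · obtain ⟨ℓ, hℓ, rfl⟩ := Finset.mem_image.mp hk
      obtain ⟨u, v, hu, hv, huv, hu', hv', hℓe, hk4⟩ := hIk ℓ hℓ
      refine ⟨hp _ u v hu hv huv (by rw [hk4, hℓe]; push_cast; ring), ?_⟩
      set k := ((ℓ : ℤ) ^ 2 - 1) / 4
      have hk4' : 4 * (k : ℝ) + 1 = (ℓ : ℝ) ^ 2 := by exact_mod_cast hk4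
      have hℓN : (ℓ : ℝ) ≤ 12 * (N : ℝ) ^ 2 := by
        have h1 : (u : ℝ) ≤ 2 * N := by exact_mod_cast hu'
        have h2 : (v : ℝ) ≤ 2 * N := by exact_mod_cast hv'
        rw [hℓe]; push_cast
        calc (u : ℝ) ^ 2 + 2 * (v : ℝ) ^ 2 ≤ (2 * N) ^ 2 + 2 * (2 * N) ^ 2 := by gcongr
          _ = _ := by ring
      have hℓ1 : (1 : ℝ) ≤ ℓ := by
        have : 0 < v := hv.pos
        have h1 : 1 ≤ ℓ := by rw [hℓe]; nlinarith
        exact_mod_cast h1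
      have hsq : (ℓ : ℝ) ^ 2 ≤ (12 * (N : ℝ) ^ 2) ^ 2 := by gcongr
      rw [abs_of_nonneg (by nlinarith)]
      nlinarith
    · rw [Finset.card_image_of_injOn]
      · exact card_image_oddCoprimePairs_ge hN
      · intro ℓ hℓ ℓ' hℓ' h
        obtain ⟨-, -, -, -, -, -, -, -, h1⟩ := hIk ℓ hℓ
        obtain ⟨-, -, -, -, -, -, -, -, h2⟩ := hIk ℓ' hℓ'
        simp only at h
        rw [h, h2] at h1
        have : ℓ' ^ 2 = ℓ ^ 2 := by exact_mod_cast h1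
        exact (Nat.pow_left_injective two_ne_zero this).symm
  refine IsBigO.of_bound (24 * (2 * 22032)) ?_
  filter_upwards [eventually_ge_atTop 36, eventually_ge_atTop (Real.exp 1)] with M hM hMe
  obtain ⟨N, hN, h0, h1, h2⟩ := exists_le_ncard (by norm_num) four_ne_zero hT hM
  have hM0 : 0 < M := by linarith
  have hlog : 1 ≤ Real.log M := by rwa [Real.le_log_iff_exp_le hM0]
  have hN1 : (1 : ℝ) ≤ N := by exact_mod_cast hN
  have h4N : 4 * (N : ℝ) ≤ M := by
    have : (N : ℝ) ≤ (N : ℝ) ^ 4 := le_self_pow₀ hN1 (by norm_num)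
    linarith
  have hlogN : 1 + Real.log (4 * N) ≤ 2 * Real.log M := by
    have := Real.log_le_log (by linarith) h4N
    linarith
  have hlogN0 : 0 ≤ Real.log (4 * N) := Real.log_nonneg (by linarith)
  rw [← Real.sqrt_eq_rpow, Real.norm_of_nonneg (by positivity), Real.norm_of_nonneg (by positivity)]
  -- From `M ≤ 36 (2N)⁴ = 576 N⁴`.
  have hs : √M ≤ 24 * (N : ℝ) ^ 2 := by
    rw [Real.sqrt_le_left (by positivity)]
    linarith
  calc √M / Real.log M ≤ 24 * (N : ℝ) ^ 2 / Real.log M := by gcongr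
    _ = 24 * (2 * 22032) * ((N : ℝ) ^ 2 / (22032 * (2 * Real.log M))) := by field_simp
    _ ≤ 24 * (2 * 22032) * ((N : ℝ) ^ 2 / (22032 * (1 + Real.log (4 * N)))) := by gcongr
    _ ≤ _ := by gcongr

end Counting

section Families

theorem isTheta_countSoluble_F₁ :
    (fun M : ℝ => (countSoluble F₁ M : ℝ)) =Θ[atTop] (fun M : ℝ => M) := by
  refine isTheta_ncard (C := 12) (f := fun t => 1 + 12 * (t : ℤ)) (fun a b h => by simpa using h)
    (fun t => soluble_F₁ (by omega) (by omega)) (by norm_num) fun t => ?_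
  push_cast
  rw [abs_of_nonneg (by positivity)]
  linarith

theorem isTheta_countSoluble_F₂ :
    (fun M : ℝ => (countSoluble F₂ M : ℝ)) =Θ[atTop] (fun M : ℝ => M) := by
  -- The class of `-81` modulo `360 = 8 · 9 · 5` meets all three congruences of `soluble_F₂`.
  refine isTheta_ncard (C := 360) (f := fun t => -81 - 360 * (t : ℤ))
    (fun a b h => by simpa using h)
    (fun t => soluble_F₂ (by omega) (by omega) (by omega) (by omega)) (by norm_num) fun t => ?_
  push_cast
  have : (0 : ℝ) ≤ t := by positivity
  rw [abs_of_nonpos (by linarith)]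
  linarith

theorem isTheta_countSoluble_F₃ :
    (fun M : ℝ => (countSoluble F₃ M : ℝ)) =Θ[atTop] (fun M : ℝ => M) := by
  refine isTheta_ncard (C := 8) (f := fun t => 1 + 8 * (t : ℤ)) (fun a b h => by simpa using h)
    (fun t => soluble_F₃ (by omega) (by omega)) (by norm_num) fun t => ?_
  push_cast
  rw [abs_of_nonneg (by positivity)]
  linarith

theorem isBigO_countObstructed_F₁ :
    (fun M : ℝ => M ^ (1 / 2 : ℝ) / Real.log M) =O[atTop]
      (fun M : ℝ => (countObstructed F₁ M : ℝ)) := by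
  -- Here `ℓ = 6t + 3` is odd, as the obstruction requires, and divisible by 3, so that `k ≡ -1 mod
  -- 3` is locally soluble.
  refine rpow_half_div_log_isBigO_ncard (C := 73)
    (f := fun t => -1 - 2 * (6 * (t : ℤ) + 3) ^ 2) (fun a b h => ?_) (fun t => ⟨?_, ?_⟩)
    (by norm_num) fun t => ?_
  · have h' : (6 * (a : ℤ) + 3) ^ 2 = (6 * (b : ℤ) + 3) ^ 2 := by simp only at h; linarith
    have := (pow_left_inj₀ (by positivity) (by positivity) two_ne_zero).mp h'
    omega
  · have e : -1 - 2 * (6 * (t : ℤ) + 3) ^ 2 = -19 - 72 * (t * t + t : ℤ) := by ring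
    rw [e]
    exact soluble_F₁ (by omega) (by omega)
  · exact brauerManinSet_F₁_eq_empty rfl ⟨3 * t + 1, by ring⟩
  · push_cast
    have : (0 : ℝ) ≤ t := by positivity
    rw [abs_of_nonpos (by nlinarith)]
    nlinarith

theorem isBigO_countObstructed_F₂ :
    (fun M : ℝ => M ^ (1 / 2 : ℝ) / Real.log M) =O[atTop]
      (fun M : ℝ => (countObstructed F₂ M : ℝ)) := by
  -- Here `n = 30t + 21` is odd, divisible by 3 and `1` modulo 5, so `-n²` meets the congruences of
  -- `soluble_F₂`.
  refine rpow_half_div_log_isBigO_ncard (C := 900)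
    (f := fun t => -(30 * (t : ℤ) + 21) ^ 2) (fun a b h => ?_) (fun t => ⟨?_, ?_⟩)
    (by norm_num) fun t => ?_
  · have h' : (30 * (a : ℤ) + 21) ^ 2 = (30 * (b : ℤ) + 21) ^ 2 := by simp only at h; linarith
    have := (pow_left_inj₀ (by positivity) (by positivity) two_ne_zero).mp h'
    omega
  · obtain ⟨m, hm⟩ : ∃ m, (t * (5 * t + 7) : ℤ) = 2 * m := by
      have : Even (t * (5 * t + 7) : ℤ) := by
        rcases Int.even_or_odd (t : ℤ) with h | h
        · exact h.mul_right _
        · refine Even.mul_left ?_ _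
          obtain ⟨s, hs⟩ := h
          exact ⟨5 * s + 6, by rw [hs]; ring⟩
      obtain ⟨m, hm⟩ := this
      exact ⟨m, by rw [hm]; ring⟩
    have e : -(30 * (t : ℤ) + 21) ^ 2 = -441 - 360 * m := by linear_combination (-180) * hm
    have hm0 : 0 ≤ m := by
      have : (0 : ℤ) ≤ t * (5 * t + 7) := by positivity
      omega
    rw [e]
    exact soluble_F₂ (by omega) (by omega) (by omega) (by omega)
  · exact brauerManinSet_F₂_eq_empty rfl (by omega)
  · push_cast
    have : (0 : ℝ) ≤ t := by positivity
    rw [abs_of_nonpos (by nlinarith)]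
    nlinarith

theorem isBigO_countObstructed_F₃ :
    (fun M : ℝ => M ^ (1 / 2 : ℝ) / Real.log M) =O[atTop]
      (fun M : ℝ => (countObstructed F₃ M : ℝ)) := by
  refine rpow_half_div_log_isBigO_ncard_of_form fun k u v hu hv huv hk => ?_
  -- For `u, v` odd, `ℓ = u² + 2v² ≡ 3 mod 8`, hence `ℓ² ≡ 9 mod 16`.
  have hk2 : k % 4 = 2 := by
    obtain ⟨a, rfl⟩ := hu
    obtain ⟨b, rfl⟩ := hv
    push_cast at hk
    obtain ⟨a', ha'⟩ := Int.even_mul_succ_self (a : ℤ)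
    obtain ⟨b', hb'⟩ := Int.even_mul_succ_self (b : ℤ)
    have e : (2 * (a : ℤ) + 1) ^ 2 + 2 * (2 * (b : ℤ) + 1) ^ 2 = 3 + 8 * (a' + 2 * b') := by
      linear_combination 4 * ha' + 8 * hb'
    rw [e] at hk
    have : k = 2 + 4 * (3 * (a' + 2 * b') + 4 * (a' + 2 * b') ^ 2) := by linarith
    omega
  have hk0 : 0 ≤ k := by
    have : 0 ≤ 4 * k + 1 := by rw [hk]; positivity
    omega
  exact ⟨soluble_F₃ hk0 (Or.inr hk2),
    brauerManinSet_F₃_eq_empty hk hk2 (Nat.isCoprime_iff_coprime.mpr huv) rfl⟩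

end Families

end

end

end MarkoffK3

theorem mainTheorem4 :
    ∀ F ∈ ({MarkoffK3.F₁, MarkoffK3.F₂, MarkoffK3.F₃} : Set (ℤ → MvPolynomial (Fin 3) ℤ)),
      ((fun M : ℝ => (MarkoffK3.countSoluble F M : ℝ)) =Θ[atTop] (fun M : ℝ => M)) ∧
      ((fun M : ℝ => M ^ (1 / 2 : ℝ) / Real.log M) =O[atTop]
        (fun M : ℝ => (MarkoffK3.countObstructed F M : ℝ))) := by
  rintro F (rfl | rfl | rfl)
  · exact ⟨MarkoffK3.isTheta_countSoluble_F₁, MarkoffK3.isBigO_countObstructed_F₁⟩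
  · exact ⟨MarkoffK3.isTheta_countSoluble_F₂, MarkoffK3.isBigO_countObstructed_F₂⟩
  · exact ⟨MarkoffK3.isTheta_countSoluble_F₃, MarkoffK3.isBigO_countObstructed_F₃⟩
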